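/- Let $L=(L_t)_{t\ge 0}$ be a real Lévy process (independent and stationary increments, $L_0=0$ a.s., a.s. càdlàg paths) on a probability space $(\Omega,\mathcal F,\mathbb P)$, without Gaussian component, i.e. with characteristic triplet of the form $(\gamma,0,\nu)$, and such that $\mathbb E L_1=0$ and $\mathbb E L_1^2<\infty$. Let $H\in(0,1)$ and let $Y=(Y_t)_{t\ge 0}$ be a fractional Lévy process by Molchan–Golosov transformation (fLpMG) with parameter $H$ driven by $L$, that is, a real stochastic process such that for every $t\ge 0$, almost surely, $$Y_t=\int_0^t z_H(t,s)\,dL_s .$$ Here the integral is the limit in probability of the elementary integrals $\sum_i a_i (L_{v_i}-L_{u_i})$ of step functions $\sum_i a_i 1_{(u_i,v_i]}$ that converge in $L^2$ to $1_{(0,t]}z_H(t,\cdot)$, and $z_H$ is the Molchan–Golosov kernel $$z_H(t,s)=c_H (t-s)^{H-\frac12}F\Big(\tfrac12-H,\,H-\tfrac12,\,H+\tfrac12,\,\tfrac{s-t}{s}\Big)\quad (0<s<t),\qquad z_H(t,s)=0 \text{ otherwise},$$ $$c_H=\frac{1}{\Gamma(H+\frac12)}\left(\frac{2H\,\Gamma(H+\frac12)\Gamma(\frac32-H)}{\Gamma(2-2H)}\right)^{1/2},$$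 where $F(a,b,c,\cdot)$ is Gauss' hypergeometric function, i.e. the analytic continuation to $(-\infty,1)$ of $\sum_{j\ge 0}\frac{(a)_j(b)_j}{(c)_j}\frac{x^j}{j!}$, $|x|<1$, with $(a)_0=1$ and $(a)_j=a(a+1)\cdots(a+j-1)$. 1. If $H>\frac12$, then $Y$ has a modification almost all of whose paths are, on every interval $[0,T]$, Hölder continuous of every order strictly less than $H-\frac12$. 2. If $H<\frac12$ and $L$ is non-degenerate (it is not the case that $L_1=0$ a.s.), then for every $T>0$ the paths of $Y$ on $[0,T]$ are discontinuous with positive probability. 3. If $H<\frac12$ and $L$ is non-degenerate, then for every $T>0$ the paths of $Y$ on $[0,T]$ are unbounded with positive probability. In 2 and 3, "with positive probability" means: on a set of outcomes that contains an event of positive probability. Since $Y$ is an arbitrary process with the stated property, these two assertions hold for every modification. -/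

import Mathlib

open MeasureTheory ProbabilityTheory Filter Set
open scoped NNReal ENNReal Topology

noncomputable section

/-! ### The Molchan-Golosov kernel -/

/-- `IsHypergeometricContinuation a b c g`: the function `g` is a real analytic function on
`(-∞, 1)` which on `(-1, 1)` is the sum of the Gauss series `∑ (a)_j (b)_j / (c)_j x ^ j / j!`. -/
def IsHypergeometricContinuation (a b c : ℝ) (g : ℝ → ℝ) : Prop :=
  AnalyticOnNhd ℝ g (Iio 1) ∧ ∀ x ∈ Ioo (-1 : ℝ) 1, g x = ordinaryHypergeometric a b c x

open Classical in
/-- Gauss' hypergeometric function `F(a, b, c, x)` for real `x < 1`: the sum of the Gauss series for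
`|x| < 1`, extended to `(-∞, 1)` by analytic continuation. -/
def gaussHypergeometric (a b c x : ℝ) : ℝ :=
  if h : ∃ g, IsHypergeometricContinuation a b c g then h.choose x else 0

/-- The analytic continuation is unique, so the choice in `gaussHypergeometric` is immaterial. -/
theorem gaussHypergeometric_eq {a b c : ℝ} {g : ℝ → ℝ}
    (hg : IsHypergeometricContinuation a b c g) {x : ℝ} (hx : x < 1) :
    gaussHypergeometric a b c x = g x := by
  have h : ∃ g, IsHypergeometricContinuation a b c g := ⟨g, hg⟩
  have hc := h.choose_spec
  rw [gaussHypergeometric, dif_pos h]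
  refine hc.1.eqOn_of_preconnected_of_eventuallyEq hg.1 isPreconnected_Iio
    (show (0 : ℝ) ∈ Iio 1 by simp) ?_ hx
  filter_upwards [Ioo_mem_nhds (show (-1 : ℝ) < 0 by norm_num) (show (0 : ℝ) < 1 by norm_num)]
    with y hy
  rw [hc.2 y hy, hg.2 y hy]

/-- The normalising constant `c_H`. -/
def molchanGolosovConst (H : ℝ) : ℝ :=
  1 / Real.Gamma (H + 1 / 2) *
    (2 * H * Real.Gamma (H + 1 / 2) * Real.Gamma (3 / 2 - H) / Real.Gamma (2 - 2 * H)) ^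
      (1 / 2 : ℝ)

/-- The Molchan-Golosov kernel `z_H(t, s)`. -/
def molchanGolosovKernel (H t s : ℝ) : ℝ :=
  if 0 < s ∧ s < t then
    molchanGolosovConst H * (t - s) ^ (H - 1 / 2) *
      gaussHypergeometric (1 / 2 - H) (H - 1 / 2) (H + 1 / 2) ((s - t) / s)
  else 0

/-! ### Lévy processes -/

/-- Right continuous with left limits. -/
def IsCadlagPath (f : ℝ≥0 → ℝ) : Prop :=
  ∀ t, ContinuousWithinAt f (Ici t) t ∧ ∃ l, Tendsto f (𝓝[<] t) (𝓝 l)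

/-- A real Lévy process `(L_t)_{t ≥ 0}` on the probability space `(Ω, P)`. -/
structure IsLevyProcess {Ω : Type*} [MeasurableSpace Ω] (P : Measure Ω) (L : ℝ≥0 → Ω → ℝ) :
    Prop where
  measurable : ∀ t, Measurable (L t)
  start_zero : ∀ᵐ ω ∂P, L 0 ω = 0
  indep_increments : HasIndepIncrements L P
  stationary_increments : ∀ s t, IdentDistrib (fun ω => L (s + t) ω - L s ω) (L t) P P
  cadlag : ∀ᵐ ω ∂P, IsCadlagPath (fun t => L t ω)

/-- A Lévy measure: no mass at `0` and `∫ (1 ∧ x²) ν(dx) < ∞`. -/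
def IsLevyMeasure (ν : Measure ℝ) : Prop :=
  ν {0} = 0 ∧ ∫⁻ x, ENNReal.ofReal (min 1 (x ^ 2)) ∂ν < ∞

/-- The characteristic exponent `Ψ` with triplet `(γ, σ², ν)`; the argument `v` is `σ²`. -/
def levyExponent (γ v : ℝ) (ν : Measure ℝ) (u : ℝ) : ℂ :=
  Complex.I * γ * u - (1 / 2 : ℂ) * v * (u : ℂ) ^ 2 +
    ∫ x : ℝ, (Complex.exp (Complex.I * u * x) - 1 -
      (if |x| < 1 then Complex.I * u * x else 0)) ∂ν

/-- `(γ, σ², ν)`, with `v = σ²`, is the characteristic triplet of `L`. -/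
structure HasLevyTriplet {Ω : Type*} [MeasurableSpace Ω] (P : Measure Ω) (L : ℝ≥0 → Ω → ℝ)
    (γ v : ℝ) (ν : Measure ℝ) : Prop where
  nonneg : 0 ≤ v
  levyMeasure : IsLevyMeasure ν
  charFun_eq : ∀ (t : ℝ≥0) (u : ℝ),
    ∫ ω, Complex.exp (Complex.I * u * L t ω) ∂P =
      Complex.exp (((t : ℝ) : ℂ) * levyExponent γ v ν u)

/-- The Lévy process `L` has no Gaussian component: its triplet is of the form `(γ, 0, ν)`. -/
def HasNoGaussianComponent {Ω : Type*} [MeasurableSpace Ω] (P : Measure Ω)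
    (L : ℝ≥0 → Ω → ℝ) : Prop :=
  ∃ (γ : ℝ) (ν : Measure ℝ), HasLevyTriplet P L γ 0 ν

/-! ### Integrals of deterministic functions -/

/-- The data of a step function `∑ i, coeff i * 1_{(left i, right i]}` on `[0, ∞)`. -/
structure StepFun where
  n : ℕ
  coeff : Fin n → ℝ
  left : Fin n → ℝ≥0
  right : Fin n → ℝ≥0
  left_le_right : ∀ i, left i ≤ right i

/-- The step function itself, as a function on `ℝ` vanishing on `(-∞, 0]`. -/
def StepFun.toFun (g : StepFun) (s : ℝ) : ℝ :=
  ∑ i, g.coeff i * (Ioc (g.left i : ℝ) (g.right i : ℝ)).indicator (fun _ => (1 : ℝ)) s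

/-- The elementary integral `∑ i, coeff i * (L_{right i} - L_{left i})`. -/
def StepFun.integral {Ω : Type*} (g : StepFun) (L : ℝ≥0 → Ω → ℝ) (ω : Ω) : ℝ :=
  ∑ i, g.coeff i * (L (g.right i) ω - L (g.left i) ω)

/-- `X` is (a version of) `∫_0^t f(s) dL_s` for a deterministic `f` and a square integrable, centred
Lévy process `L`: the limit in probability of the elementary integrals of step functions that
converge to `1_{(0, t]} f` in `L²`. -/
def IsLevyIntegral {Ω : Type*} [MeasurableSpace Ω] (P : Measure Ω) (L : ℝ≥0 → Ω → ℝ)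
    (t : ℝ≥0) (f : ℝ → ℝ) (X : Ω → ℝ) : Prop :=
  ∃ g : ℕ → StepFun,
    Tendsto (fun k => eLpNorm (fun s => (g k).toFun s - (Ioc 0 (t : ℝ)).indicator f s) 2 volume)
      atTop (𝓝 0) ∧
    TendstoInMeasure P (fun k => (g k).integral L) atTop X

/-- `Y` is the fractional Lévy process by Molchan-Golosov transformation with parameter `H` driven
by `L`: a process with `Y_t = ∫_0^t z_H(t, s) dL_s` almost surely, for each `t ≥ 0`. -/
structure IsFLpMG {Ω : Type*} [MeasurableSpace Ω] (P : Measure Ω) (H : ℝ) (L Y : ℝ≥0 → Ω → ℝ) :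
    Prop where
  hurst_pos : 0 < H
  hurst_lt_one : H < 1
  levy : IsLevyProcess P L
  noGaussian : HasNoGaussianComponent P L
  sq_integrable : MemLp (L 1) 2 P
  mean_zero : ∫ ω, L 1 ω ∂P = 0
  measurable : ∀ t, Measurable (Y t)
  eq_integral : ∀ t : ℝ≥0, IsLevyIntegral P L t (molchanGolosovKernel H t) (Y t)

end

/-! Everything about `L` is read off from the exponent `Ψ`: for a step function `g` the elementary
integral has characteristic function `exp ∫ Ψ(u g(s)) ds`. Three facts on `Ψ` suffice. A centred
square integrable `L` has `|Ψ(u)| ≤ C u²`, which bounds the second moment of integrals by the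
squared `L²` norm of the integrand. Without Gaussian part, `|Ψ(u)| ≤ κ u² + K_κ` for every `κ > 0`.
If `L` is non-degenerate, then `-Re Ψ(u) ≥ c u²` near `0`.

Case `H > 1/2`. With `β = H - 1/2`, Euler's integral turns the kernel into a constant times `s^(-β)
∫_s^t (u-s)^(β-1) u^β du` (`molchanGolosovKernel_eq_integral`), so its increments in `t` are
integrals over `(t, t']`. A Cauchy-Schwarz estimate bounds their squared `L²` norm by `O((t'-t)^q)`
for every `1 < q < 2H` (`lintegral_volterra_sq_le`), and the Kolmogorov-Chentsov criterion with
second moments gives every Hölder order below `(2H-1)/2`.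

Case `H < 1/2`. Near the diagonal the kernel is comparable to `(t-s)^(H-1/2)`, so a jump of `L`
shortly before a time `t` makes `Y_t` large. Take a grid of mesh `h` in `[T/2, T]` and put `ρ =
h^(H-1/2)`, which tends to infinity as `h → 0`. At each grid point, `Y` is the sum of a part
determined by the past and of the integral over the last block, which is independent of that past.
The last block exceeds a multiple of `ρ` with probability at least `c h`: this rare large value
replaces the jump, and it is where the absence of a Gaussian part matters, since a Gaussian block
would have typical size only `√h ρ`. Its variance is `O(h ρ²)`, so Chebyshev's inequality handles
large values of the past part. Hence, whatever the past is, `|Y| ≤ ε₀ρ - 1` has conditional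
probability at most `1 - c h`, up to approximation errors (`exists_incrementSum_anticoncentration`).
Multiplying over the `T/(2h)` blocks leaves at most `exp(-cT/2) < 1`, uniformly in `h`. Thus every
bound `M` fails with probability at least `1 - exp(-cT/2)`, and so does boundedness. Discontinuity
follows by compactness of `[0, T]`. -/

noncomputable section

/-! ### The Euler integral of the hypergeometric function -/

theorem rpow_le_add_of_mem_Icc {m M x p : ℝ} (hm : 0 < m) (hx : x ∈ Icc m M) :
    x ^ p ≤ m ^ p + M ^ p := by
  have hx0 : 0 < x := hm.trans_le hx.1
  have hM : 0 < M := hx0.trans_le hx.2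
  rcases le_total 0 p with hp | hp
  · have := Real.rpow_le_rpow hx0.le hx.2 hp
    have := Real.rpow_nonneg hm.le p
    linarith
  · have := Real.rpow_le_rpow_of_nonpos hm hx.1 hp
    have := Real.rpow_nonneg hM.le p
    linarith

/-- Differentiation under the integral sign is done in a complex variable because holomorphy yields
analyticity at once; the real statement follows by restriction. -/
theorem differentiableOn_integral_one_sub_mul_cpow (μ : Measure ℝ) [IsFiniteMeasure μ]
    (hμ : ∀ᵐ r ∂μ, r ∈ Ioo (0 : ℝ) 1) (p : ℝ) :
    DifferentiableOn ℂ (fun z : ℂ => ∫ r, (1 - z * (r : ℂ)) ^ (p : ℂ) ∂μ) {z | z.re < 1} := by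
  intro z₀ hz₀
  rw [mem_ofPred_eq] at hz₀
  set ε : ℝ := (1 - z₀.re) / 2 with hε
  have hε0 : 0 < ε := by simp only [hε]; linarith
  set m : ℝ := min 1 ε
  have hm : 0 < m := lt_min one_pos hε0
  set M : ℝ := 1 + ‖z₀‖ + ε
  -- On this ball `Re z < 1 - ε`, hence `Re (1 - z r) ≥ (1 - r) + r ε ≥ min 1 ε`. The base of the
  -- power therefore stays away from the branch cut and from `0`.
  have hre : ∀ z ∈ Metric.ball z₀ ε, ∀ r ∈ Ioo (0 : ℝ) 1, m ≤ (1 - z * (r : ℂ)).re := by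
    intro z hz r hr
    have h1 : z.re < 1 - ε := by
      have h2 : |(z - z₀).re| ≤ ‖z - z₀‖ := Complex.abs_re_le_norm _
      have h3 : ‖z - z₀‖ < ε := by simpa [dist_eq_norm] using hz
      have h4 := (abs_le.1 h2).2
      simp only [Complex.sub_re] at h4
      simp only [hε] at h3 ⊢
      linarith
    have h5 : (1 - z * (r : ℂ)).re = 1 - z.re * r := by simp
    rw [h5]
    rcases le_total ε 1 with h | h
    · have : m ≤ ε := min_le_right _ _
      nlinarith [hr.1, hr.2]
    · have : m ≤ 1 := min_le_left _ _
      nlinarith [hr.1, hr.2]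
  have hnorm : ∀ z ∈ Metric.ball z₀ ε, ∀ r ∈ Ioo (0 : ℝ) 1, ‖1 - z * (r : ℂ)‖ ∈ Icc m M := by
    intro z hz r hr
    refine ⟨(hre z hz r hr).trans ((le_abs_self _).trans (Complex.abs_re_le_norm _)), ?_⟩
    have h3 : ‖z - z₀‖ < ε := by simpa [dist_eq_norm] using hz
    have h4 : ‖z‖ ≤ ‖z₀‖ + ε := by
      have := norm_add_le z₀ (z - z₀)
      rw [add_sub_cancel] at this
      linarith
    calc ‖1 - z * (r : ℂ)‖ ≤ ‖(1 : ℂ)‖ + ‖z * (r : ℂ)‖ := norm_sub_le _ _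
      _ = 1 + ‖z‖ * |r| := by simp
      _ ≤ 1 + (‖z₀‖ + ε) * 1 := by
          gcongr
          rw [abs_of_pos hr.1]; exact hr.2.le
      _ = M := by ring
  have hmeas : ∀ (q : ℂ) (z : ℂ), AEStronglyMeasurable (fun r : ℝ => (1 - z * (r : ℂ)) ^ q) μ := by
    intro q z
    have : Measurable fun r : ℝ => (1 - z * (r : ℂ)) ^ q := by fun_prop
    exact this.aestronglyMeasurable
  have key := hasDerivAt_integral_of_dominated_loc_of_deriv_le (μ := μ) (𝕜 := ℂ)
    (F := fun z r => (1 - z * (r : ℂ)) ^ (p : ℂ))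
    (F' := fun z r => (p : ℂ) * (1 - z * (r : ℂ)) ^ ((p : ℂ) - 1) * (-(r : ℂ)))
    (bound := fun _ => |p| * (m ^ (p - 1) + M ^ (p - 1))) (x₀ := z₀)
    (Metric.ball_mem_nhds z₀ hε0) (Eventually.of_forall fun z => hmeas _ z) ?_ ?_ ?_ ?_ ?_
  · exact key.2.differentiableAt.differentiableWithinAt
  · refine Integrable.of_bound (hmeas _ _) (m ^ p + M ^ p) ?_
    filter_upwards [hμ] with r hr
    rw [Complex.norm_cpow_real]
    exact rpow_le_add_of_mem_Icc hm (hnorm z₀ (Metric.mem_ball_self hε0) r hr)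
  · exact ((hmeas _ _).const_mul _).mul (by fun_prop)
  · filter_upwards [hμ] with r hr z hz
    rw [norm_mul, norm_mul, ← Complex.ofReal_one, ← Complex.ofReal_sub, Complex.norm_cpow_real]
    have h1 := rpow_le_add_of_mem_Icc (p := p - 1) hm (hnorm z hz r hr)
    have h2 : ‖-(r : ℂ)‖ ≤ 1 := by simp [abs_of_pos hr.1, hr.2.le]
    have h3 : ‖(p : ℂ)‖ = |p| := by simp
    rw [h3]
    have h4 := Real.rpow_nonneg (norm_nonneg (1 - z * (r : ℂ))) (p - 1)
    calc |p| * ‖((1 : ℝ) : ℂ) - z * (r : ℂ)‖ ^ (p - 1) * ‖-(r : ℂ)‖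
        ≤ |p| * ‖((1 : ℝ) : ℂ) - z * (r : ℂ)‖ ^ (p - 1) * 1 := by gcongr
      _ ≤ |p| * (m ^ (p - 1) + M ^ (p - 1)) := by rw [mul_one]; gcongr; simpa using h1
  · exact integrable_const _
  · filter_upwards [hμ] with r hr z hz
    have h1 : HasDerivAt (fun z : ℂ => 1 - z * (r : ℂ)) (-(r : ℂ)) z := by
      simpa using ((hasDerivAt_id z).mul_const (r : ℂ)).const_sub 1
    exact h1.cpow_const (Or.inl (hm.trans_le (hre z hz r hr)))

theorem analyticOnNhd_integral_one_sub_mul_rpow (μ : Measure ℝ) [IsFiniteMeasure μ]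
    (hμ : ∀ᵐ r ∂μ, r ∈ Ioo (0 : ℝ) 1) (p : ℝ) :
    AnalyticOnNhd ℝ (fun x : ℝ => ∫ r, (1 - x * r) ^ p ∂μ) (Iio 1) := by
  have hopen : IsOpen {z : ℂ | z.re < 1} := isOpen_lt Complex.continuous_re continuous_const
  have h := (differentiableOn_integral_one_sub_mul_cpow μ hμ p).analyticOnNhd hopen
  intro x hx
  have h1 : AnalyticAt ℝ (fun z : ℂ => ∫ r, (1 - z * (r : ℂ)) ^ (p : ℂ) ∂μ) (x : ℂ) :=
    (h (x : ℂ) (by simpa using hx)).restrictScalars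
  have h2 : AnalyticAt ℝ (fun y : ℝ => (∫ r, (1 - (y : ℂ) * (r : ℂ)) ^ (p : ℂ) ∂μ).re) x :=
    (Complex.reCLM.analyticAt _).comp
      (AnalyticAt.comp (g := fun z : ℂ => ∫ r, (1 - z * (r : ℂ)) ^ (p : ℂ) ∂μ)
        (f := Complex.ofRealCLM) h1 (Complex.ofRealCLM.analyticAt x))
  refine h2.congr ?_
  filter_upwards [isOpen_Iio.mem_nhds hx] with y hy
  have : ∀ᵐ r : ℝ ∂μ, (1 - (y : ℂ) * (r : ℂ)) ^ (p : ℂ) = (((1 - y * r) ^ p : ℝ) : ℂ) := by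
    filter_upwards [hμ] with r hr
    rw [Complex.ofReal_cpow]
    · push_cast; rfl
    · have : y < 1 := hy
      nlinarith [hr.1, hr.2]
  rw [integral_congr_ae this, integral_complex_ofReal, Complex.ofReal_re]

theorem ringChoose_eq_ascPochhammer (a : ℝ) (n : ℕ) :
    Ring.choose (a + n - 1) n = (n.factorial : ℝ)⁻¹ * (ascPochhammer ℝ n).eval a := by
  rw [Ring.choose_eq_smul, Polynomial.descPochhammer_smeval_eq_ascPochhammer,
    Polynomial.ascPochhammer_smeval_cast, Polynomial.ascPochhammer_smeval_eq_eval, smul_eq_mul]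
  congr 2
  ring

theorem hasSum_one_sub_rpow_neg (a : ℝ) {x : ℝ} (hx : |x| < 1) :
    HasSum (fun n : ℕ => (n.factorial : ℝ)⁻¹ * (ascPochhammer ℝ n).eval a * x ^ n)
      ((1 - x) ^ (-a)) := by
  have h := (Real.one_div_one_sub_rpow_hasFPowerSeriesOnBall_zero a).hasSum (y := x)
    (by simpa [enorm_eq_nnnorm, ← NNReal.coe_lt_coe] using! hx)
  have h1 : (0 : ℝ) ≤ 1 - x := by linarith [(abs_lt.1 hx).2]
  simp only [zero_add] at h
  rw [one_div, ← Real.rpow_neg h1] at h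
  refine h.congr_fun fun n => ?_
  rw [FormalMultilinearSeries.ofScalars_apply_eq, ringChoose_eq_ascPochhammer, smul_eq_mul]

theorem summable_abs_one_sub_rpow_neg (a : ℝ) {x : ℝ} (hx : |x| < 1) :
    Summable fun n : ℕ => |(n.factorial : ℝ)⁻¹ * (ascPochhammer ℝ n).eval a * x ^ n| := 
  (hasSum_one_sub_rpow_neg a hx).summable.abs

theorem integral_one_sub_mul_rpow_eq_tsum (μ : Measure ℝ) [IsFiniteMeasure μ]
    (hμ : ∀ᵐ r ∂μ, r ∈ Ioo (0 : ℝ) 1) (a : ℝ) {x : ℝ} (hx : |x| < 1) :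
    ∫ r, (1 - x * r) ^ (-a) ∂μ =
      ∑' n : ℕ, (n.factorial : ℝ)⁻¹ * (ascPochhammer ℝ n).eval a * (∫ r, r ^ n ∂μ) * x ^ n := by
  set F : ℕ → ℝ → ℝ := fun n r => (n.factorial : ℝ)⁻¹ * (ascPochhammer ℝ n).eval a * (x * r) ^ n
  have hb : ∀ n, ∀ᵐ r ∂μ, ‖F n r‖ ≤ |(n.factorial : ℝ)⁻¹ * (ascPochhammer ℝ n).eval a * x ^ n| := by
    intro n
    filter_upwards [hμ] with r hr
    rw [Real.norm_eq_abs]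
    simp only [F, abs_mul, abs_pow]
    rw [abs_of_pos hr.1, mul_pow]
    have h1 : r ^ n ≤ 1 := pow_le_one₀ hr.1.le hr.2.le
    gcongr
    exact mul_le_of_le_one_right (by positivity) h1
  have hint : ∀ n, Integrable (F n) μ := fun n =>
    Integrable.of_bound (by fun_prop) _ (hb n)
  have hs := hasSum_integral_of_summable_integral_norm hint ?_
  · rw [← integral_congr_ae (μ := μ) (f := fun r => ∑' n, F n r)]
    · rw [← hs.tsum_eq]
      refine tsum_congr fun n => ?_
      simp only [F, mul_pow]
      rw [integral_const_mul, integral_const_mul]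
      ring
    · filter_upwards [hμ] with r hr
      refine (hasSum_one_sub_rpow_neg a ?_).tsum_eq
      rw [abs_mul, abs_of_pos hr.1]
      have := abs_nonneg x
      nlinarith [hr.1, hr.2]
  · refine Summable.of_nonneg_of_le (fun n => integral_nonneg fun r => norm_nonneg _) (fun n => ?_)
      ((summable_abs_one_sub_rpow_neg a hx).mul_left (μ.real univ))
    calc ∫ r, ‖F n r‖ ∂μ ≤ ∫ _, |(n.factorial : ℝ)⁻¹ * (ascPochhammer ℝ n).eval a * x ^ n| ∂μ :=
          integral_mono_ae (hint n).norm (integrable_const _) (hb n)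
      _ = _ := by simp

theorem ae_betaMeasure_mem_Ioo (α β : ℝ) : ∀ᵐ r ∂(betaMeasure α β), r ∈ Ioo (0 : ℝ) 1 := by
  rw [ae_iff, betaMeasure, withDensity_apply _ (by exact measurableSet_Ioo.compl)]
  refine (setLIntegral_congr_fun (g := 0) measurableSet_Ioo.compl fun r hr => ?_).trans (by simp)
  rw [betaPDF_eq, if_neg (by exact hr)]
  simp

/-- Multiplying the density by `r ^ n` gives a multiple of the density with parameter `α + n`, whose
total mass is `1`. The moments supply the Pochhammer quotient in the Gauss series. -/
theorem integral_pow_betaMeasure {α β : ℝ} (hα : 0 < α) (hβ : 0 < β) (n : ℕ) :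
    ∫ r, r ^ n ∂(betaMeasure α β) =
      (ascPochhammer ℝ n).eval α * ((ascPochhammer ℝ n).eval (α + β))⁻¹ := by
  have hpoch : ∀ x : ℝ, 0 < x → Real.Gamma (x + n) = (ascPochhammer ℝ n).eval x * Real.Gamma x := by
    intro x hx
    induction n with
    | zero => simp
    | succ n ih =>
      have : x + (n : ℝ) ≠ 0 := by positivity
      rw [Nat.cast_succ, ← add_assoc, Real.Gamma_add_one this, ih, ascPochhammer_succ_eval]
      ring
  have hαn : 0 < α + n := by positivity
  have h1 : ∫ r, betaPDFReal (α + n) β r = 1 := by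
    rw [integral_eq_lintegral_of_nonneg_ae, ← ENNReal.toReal_one]
    · congr 1
      exact lintegral_betaPDF_eq_one hαn hβ
    · refine Eventually.of_forall fun r => ?_
      by_cases h : 0 < r ∧ r < 1
      · exact (betaPDFReal_pos h.1 h.2 hαn hβ).le
      · simp [betaPDFReal, h]
    · exact (stronglyMeasurable_betaPDFReal _ _).aestronglyMeasurable
  rw [betaMeasure, integral_withDensity_eq_integral_toReal_smul₀ (f := betaPDF α β)
    (measurable_betaPDFReal α β).ennreal_ofReal.aemeasurable
    (Eventually.of_forall fun r => ENNReal.ofReal_lt_top)]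
  have h2 : ∀ r, (betaPDF α β r).toReal • r ^ n =
      (beta (α + n) β / beta α β) * betaPDFReal (α + n) β r := by
    intro r
    by_cases h : 0 < r ∧ r < 1
    · rw [betaPDF, ENNReal.toReal_ofReal (betaPDFReal_pos h.1 h.2 hα hβ).le]
      simp only [betaPDFReal, if_pos h, smul_eq_mul]
      rw [show α + n - 1 = (α - 1) + n by ring, Real.rpow_add h.1, Real.rpow_natCast]
      have := (beta_pos hα hβ).ne'
      have := (beta_pos hαn hβ).ne'
      field_simp
    · simp [betaPDF, betaPDFReal, h]
  simp_rw [h2]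
  rw [integral_const_mul, h1, mul_one, beta, beta, show α + n + β = α + β + n by ring,
    hpoch _ hα, hpoch _ (add_pos hα hβ)]
  have := (Real.Gamma_pos_of_pos hα).ne'
  have := (Real.Gamma_pos_of_pos hβ).ne'
  have := (Real.Gamma_pos_of_pos (add_pos hα hβ)).ne'
  field_simp

/-- **Euler's integral representation** of the hypergeometric function. -/
theorem isHypergeometricContinuation_integral (a : ℝ) {b d : ℝ} (hb : 0 < b) (hd : 0 < d) :
    IsHypergeometricContinuation a b (b + d)
      (fun x => ∫ r, (1 - x * r) ^ (-a) ∂(betaMeasure b d)) := by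
  have : IsProbabilityMeasure (betaMeasure b d) := isProbabilityMeasureBeta hb hd
  refine ⟨analyticOnNhd_integral_one_sub_mul_rpow _ (ae_betaMeasure_mem_Ioo b d) _, fun x hx => ?_⟩
  simp only
  rw [integral_one_sub_mul_rpow_eq_tsum _ (ae_betaMeasure_mem_Ioo b d) a (abs_lt.2 hx),
    ordinaryHypergeometric_eq_tsum]
  refine tsum_congr fun n => ?_
  rw [integral_pow_betaMeasure hb hd, smul_eq_mul]
  ring

/-- Euler's integral needs a positive second parameter. For `H < 1/2` the kernel has `H - 1/2 < 0`
there, and the two upper parameters must be exchanged. -/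
theorem IsHypergeometricContinuation.symm {a b c : ℝ} {g : ℝ → ℝ}
    (h : IsHypergeometricContinuation a b c g) : IsHypergeometricContinuation b a c g := by
  refine ⟨h.1, fun x hx => (h.2 x hx).trans ?_⟩
  rw [ordinaryHypergeometric, ordinaryHypergeometricSeries_symm, ordinaryHypergeometric]

theorem integral_betaMeasure_one {b : ℝ} (hb : 0 < b) (f : ℝ → ℝ) :
    ∫ r, f r ∂(betaMeasure b 1) = ∫ r in Ioo (0 : ℝ) 1, b * r ^ (b - 1) * f r := by
  rw [betaMeasure, integral_withDensity_eq_integral_toReal_smul₀ (f := betaPDF b 1)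
    (measurable_betaPDFReal b 1).ennreal_ofReal.aemeasurable
    (Eventually.of_forall fun r => ENNReal.ofReal_lt_top), ← integral_indicator measurableSet_Ioo]
  refine integral_congr_ae (Eventually.of_forall fun r => ?_)
  by_cases h : 0 < r ∧ r < 1
  · simp only [indicator_of_mem (show r ∈ Ioo (0 : ℝ) 1 from h)]
    rw [betaPDF, ENNReal.toReal_ofReal (betaPDFReal_pos h.1 h.2 hb one_pos).le]
    have h0 := (Real.Gamma_pos_of_pos hb).ne'
    simp only [betaPDFReal, if_pos h, smul_eq_mul, beta, Real.Gamma_one, Real.Gamma_add_one hb.ne']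
    simp
    field_simp
    simp
  · rw [indicator_of_notMem (show r ∉ Ioo (0 : ℝ) 1 from h)]
    simp [betaPDF, betaPDFReal, h]

/-! ### Estimates for the characteristic exponent -/

theorem norm_exp_I_mul_sub_one_sub_le (y : ℝ) :
    ‖Complex.exp (Complex.I * y) - 1 - Complex.I * y‖ ≤ 2 * y ^ 2 := by
  have hn : ‖Complex.I * (y : ℂ)‖ = |y| := by simp
  rcases le_total |y| 1 with h | h
  · have := Complex.norm_exp_sub_one_sub_id_le (x := Complex.I * y) (by rwa [hn])
    rw [hn, sq_abs] at this
    nlinarith [sq_nonneg y]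
  · have h1 := norm_sub_le (Complex.exp (Complex.I * y) - 1) (Complex.I * y)
    have h2 := Real.norm_exp_I_mul_ofReal_sub_one_le (x := y)
    rw [hn] at h1
    rw [Real.norm_eq_abs] at h2
    nlinarith [sq_abs y]

theorem norm_exp_I_mul_sub_one_le_two (y : ℝ) : ‖Complex.exp (Complex.I * y) - 1‖ ≤ 2 := by
  refine (norm_sub_le _ _).trans ?_
  rw [mul_comm, Complex.norm_exp_ofReal_mul_I]
  norm_num

/-- The integrand of the Lévy-Khintchine formula. -/
def levyIntegrand (u x : ℝ) : ℂ :=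
  Complex.exp (Complex.I * u * x) - 1 - (if |x| < 1 then Complex.I * u * x else 0)

theorem measurable_levyIntegrand (u : ℝ) : Measurable (levyIntegrand u) := by
  unfold levyIntegrand
  refine Measurable.sub (by fun_prop) (Measurable.ite ?_ (by fun_prop) (by fun_prop))
  exact measurableSet_lt (by fun_prop) (by fun_prop)

/-- This is the integrable majorant for fixed or bounded `u`; the linear bound
`norm_levyIntegrand_le_add` is the one that decays after division by `u ^ 2`. -/
theorem norm_levyIntegrand_le (u x : ℝ) :
    ‖levyIntegrand u x‖ ≤ 2 * (1 + u ^ 2) * min 1 (x ^ 2) := by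
  have e : Complex.I * u * x = Complex.I * ((u * x : ℝ) : ℂ) := by push_cast; ring
  unfold levyIntegrand
  split_ifs with h
  · have h1 : x ^ 2 ≤ 1 := by rw [← sq_abs]; exact pow_le_one₀ (abs_nonneg x) h.le
    rw [min_eq_right h1, e]
    refine (norm_exp_I_mul_sub_one_sub_le _).trans ?_
    nlinarith [sq_nonneg x]
  · have h1 : 1 ≤ x ^ 2 := by rw [← sq_abs]; exact one_le_pow₀ (not_lt.1 h)
    rw [min_eq_left h1, e, sub_zero]
    refine (norm_exp_I_mul_sub_one_le_two _).trans ?_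
    nlinarith [sq_nonneg u]

theorem norm_levyIntegrand_le_add (u x : ℝ) : ‖levyIntegrand u x‖ ≤ 2 + |u| * |x| := by
  have e : Complex.I * u * x = Complex.I * ((u * x : ℝ) : ℂ) := by push_cast; ring
  unfold levyIntegrand
  rw [e]
  refine (norm_sub_le _ _).trans (add_le_add (norm_exp_I_mul_sub_one_le_two _) ?_)
  split_ifs
  · simp
  · simp; positivity

theorem levyIntegrand_re (u x : ℝ) : (levyIntegrand u x).re = -(1 - Real.cos (u * x)) := by
  have e : Complex.I * u * x = ((u * x : ℝ) : ℂ) * Complex.I := by push_cast; ring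
  unfold levyIntegrand
  rw [e]
  have h := Complex.exp_ofReal_mul_I_re (u * x)
  split_ifs
  · rw [Complex.sub_re, Complex.sub_re, h]; simp
  · rw [Complex.sub_re, Complex.sub_re, h]; simp

theorem levyExponent_eq (γ : ℝ) (ν : Measure ℝ) (u : ℝ) :
    levyExponent γ 0 ν u = Complex.I * γ * u + ∫ x, levyIntegrand u x ∂ν := by
  simp [levyExponent, levyIntegrand]

namespace IsLevyMeasure

variable {ν : Measure ℝ}

theorem integrable_min (hν : IsLevyMeasure ν) : Integrable (fun x : ℝ => min 1 (x ^ 2)) ν := by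
  refine ⟨by fun_prop, ?_⟩
  rw [hasFiniteIntegral_iff_ofReal]
  · exact hν.2
  · exact Eventually.of_forall fun x => by positivity

theorem integrable_levyIntegrand (hν : IsLevyMeasure ν) (u : ℝ) :
    Integrable (levyIntegrand u) ν :=
  (hν.integrable_min.const_mul (2 * (1 + u ^ 2))).mono'
    (measurable_levyIntegrand u).aestronglyMeasurable
    (Eventually.of_forall fun x => norm_levyIntegrand_le u x)

theorem levyExponent_re (hν : IsLevyMeasure ν) (γ u : ℝ) :
    (levyExponent γ 0 ν u).re = -∫ x, (1 - Real.cos (u * x)) ∂ν := by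
  have h : (∫ x, levyIntegrand u x ∂ν).re = ∫ x, (levyIntegrand u x).re ∂ν :=
    (integral_re (hν.integrable_levyIntegrand u)).symm
  rw [levyExponent_eq, Complex.add_re, h]
  simp_rw [levyIntegrand_re]
  rw [integral_neg]
  simp

theorem integrable_one_sub_cos (hν : IsLevyMeasure ν) (u : ℝ) :
    Integrable (fun x => 1 - Real.cos (u * x)) ν := by
  have h := (hν.integrable_levyIntegrand u).re.neg
  refine h.congr (Eventually.of_forall fun x => ?_)
  have := levyIntegrand_re u x
  simp [this]

theorem levyExponent_re_nonpos (hν : IsLevyMeasure ν) (γ u : ℝ) :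
    (levyExponent γ 0 ν u).re ≤ 0 := by
  rw [hν.levyExponent_re, neg_nonpos]
  exact integral_nonneg fun x => sub_nonneg.2 (Real.cos_le_one _)

theorem norm_levyExponent_le (hν : IsLevyMeasure ν) (γ u : ℝ) :
    ‖levyExponent γ 0 ν u‖ ≤
      |γ| * |u| + 2 * (1 + u ^ 2) * ∫ x, min 1 (x ^ 2) ∂ν := by
  rw [levyExponent_eq]
  refine (norm_add_le _ _).trans (add_le_add (by simp) ?_)
  rw [← integral_const_mul]
  exact norm_integral_le_of_norm_le (hν.integrable_min.const_mul _)
    (Eventually.of_forall fun x => norm_levyIntegrand_le u x)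

theorem tendsto_levyExponent_zero (hν : IsLevyMeasure ν) (γ : ℝ) :
    Tendsto (levyExponent γ 0 ν) (𝓝 0) (𝓝 0) := by
  have h1 : Tendsto (fun u : ℝ => ∫ x, levyIntegrand u x ∂ν) (𝓝 0) (𝓝 (∫ _, (0 : ℂ) ∂ν)) := by
    refine tendsto_integral_filter_of_dominated_convergence
      (fun x : ℝ => 2 * (1 + 1) * min 1 (x ^ 2))
      (Eventually.of_forall fun u => (measurable_levyIntegrand u).aestronglyMeasurable) ?_
      (hν.integrable_min.const_mul _) (Eventually.of_forall fun x => ?_)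
    · filter_upwards [Metric.ball_mem_nhds (0 : ℝ) one_pos] with u hu
      refine Eventually.of_forall fun x => (norm_levyIntegrand_le u x).trans ?_
      have : u ^ 2 ≤ 1 := by
        rw [← sq_abs]
        exact pow_le_one₀ (abs_nonneg u) (le_of_lt (by simpa using hu))
      gcongr
    · have hc : Continuous fun u : ℝ => levyIntegrand u x := by
        unfold levyIntegrand
        split_ifs <;> fun_prop
      have := hc.tendsto 0
      simpa [levyIntegrand] using this
  have h2 : Tendsto (fun u : ℝ => Complex.I * γ * u) (𝓝 0) (𝓝 0) := by
    have hc : Continuous fun u : ℝ => Complex.I * γ * (u : ℂ) := by fun_prop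
    simpa using hc.tendsto 0
  have h3 := h2.add h1
  simp only [integral_zero, add_zero] at h3
  exact h3.congr fun u => (levyExponent_eq γ ν u).symm

/-- Dominated convergence: divided by `u²`, the integrand tends to `0` pointwise and stays below `4
min(1, x²)` for `|u| ≥ 1`. A Gaussian part would contribute a non-zero limit. -/
theorem tendsto_levyExponent_div_sq (hν : IsLevyMeasure ν) (γ : ℝ) :
    Tendsto (fun u : ℝ => ‖levyExponent γ 0 ν u‖ * (u ^ 2)⁻¹) (comap (fun u => |u|) atTop)
      (𝓝 0) := by
  have hinv : Tendsto (fun u : ℝ => |u|⁻¹) (comap (fun u => |u|) atTop) (𝓝 0) :=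
    tendsto_inv_atTop_zero.comp tendsto_comap
  have hinv2 : Tendsto (fun u : ℝ => (u ^ 2)⁻¹) (comap (fun u => |u|) atTop) (𝓝 0) := by
    have := hinv.pow 2
    simpa using this
  have hev : ∀ᶠ u : ℝ in comap (fun u => |u|) atTop, 1 ≤ |u| :=
    tendsto_comap.eventually (eventually_ge_atTop 1)
  have h1 : Tendsto (fun u : ℝ => ∫ x, ‖levyIntegrand u x‖ * (u ^ 2)⁻¹ ∂ν)
      (comap (fun u => |u|) atTop) (𝓝 (∫ _, (0 : ℝ) ∂ν)) := by
    refine tendsto_integral_filter_of_dominated_convergence (fun x : ℝ => 4 * min 1 (x ^ 2))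
      (Eventually.of_forall fun u =>
        ((measurable_levyIntegrand u).norm.mul_const _).aestronglyMeasurable) ?_
      (hν.integrable_min.const_mul _) (Eventually.of_forall fun x => ?_)
    · filter_upwards [hev] with u hu
      refine Eventually.of_forall fun x => ?_
      have hu2 : 1 ≤ u ^ 2 := by rw [← sq_abs]; exact one_le_pow₀ hu
      rw [Real.norm_of_nonneg (by positivity)]
      have hm : 0 ≤ min 1 (x ^ 2) := by positivity
      rw [← div_eq_mul_inv, div_le_iff₀ (by positivity)]
      refine (norm_levyIntegrand_le u x).trans ?_
      nlinarith
    · have hb : Tendsto (fun u : ℝ => 2 * (u ^ 2)⁻¹ + |x| * |u|⁻¹) (comap (fun u => |u|) atTop)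
          (𝓝 0) := by
        simpa using (hinv2.const_mul 2).add (hinv.const_mul |x|)
      refine squeeze_zero' (Eventually.of_forall fun u => by positivity) ?_ hb
      filter_upwards [hev] with u hu
      have hu0 : 0 < |u| := by linarith
      calc ‖levyIntegrand u x‖ * (u ^ 2)⁻¹ ≤ (2 + |u| * |x|) * (u ^ 2)⁻¹ := by
            gcongr; exact norm_levyIntegrand_le_add u x
        _ = 2 * (u ^ 2)⁻¹ + |x| * |u|⁻¹ := by
            rw [← sq_abs u]; field_simp
  have h2 : Tendsto (fun u : ℝ => |γ| * |u|⁻¹ + ∫ x, ‖levyIntegrand u x‖ * (u ^ 2)⁻¹ ∂ν)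
      (comap (fun u => |u|) atTop) (𝓝 0) := by
    simpa using (hinv.const_mul |γ|).add h1
  refine squeeze_zero' (Eventually.of_forall fun u => by positivity) ?_ h2
  filter_upwards [hev] with u hu
  have hu0 : 0 < |u| := by linarith
  rw [integral_mul_const]
  calc ‖levyExponent γ 0 ν u‖ * (u ^ 2)⁻¹
      ≤ (|γ| * |u| + ∫ x, ‖levyIntegrand u x‖ ∂ν) * (u ^ 2)⁻¹ := by
        gcongr
        rw [levyExponent_eq]
        exact (norm_add_le _ _).trans (add_le_add (by simp) (norm_integral_le_integral_norm _))
    _ = |γ| * |u|⁻¹ + (∫ x, ‖levyIntegrand u x‖ ∂ν) * (u ^ 2)⁻¹ := by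
        rw [add_mul, ← sq_abs u]; field_simp

/-- Without Gaussian part, the exponent is `o(u²)` at infinity. -/
theorem exists_norm_levyExponent_le (hν : IsLevyMeasure ν) (γ : ℝ) {κ : ℝ} (hκ : 0 < κ) :
    ∃ C, 0 ≤ C ∧ ∀ u, ‖levyExponent γ 0 ν u‖ ≤ κ * u ^ 2 + C := by
  have h := (hν.tendsto_levyExponent_div_sq γ).eventually (gt_mem_nhds hκ)
  obtain ⟨V, hV⟩ := eventually_atTop.1 (eventually_comap.1 h)
  set W := max V 1
  have hI : 0 ≤ ∫ x : ℝ, min 1 (x ^ 2) ∂ν := integral_nonneg fun x => by positivity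
  refine ⟨|γ| * W + 2 * (1 + W ^ 2) * ∫ x, min 1 (x ^ 2) ∂ν, by positivity, fun u => ?_⟩
  rcases le_total W |u| with hu | hu
  · have h1 := hV |u| ((le_max_left _ _).trans hu) u rfl
    have h2 : 0 < |u| := lt_of_lt_of_le (by positivity) hu
    have h3 : 0 < u ^ 2 := by rw [← sq_abs]; positivity
    rw [← div_eq_mul_inv, div_lt_iff₀ h3] at h1
    have : 0 ≤ |γ| * W + 2 * (1 + W ^ 2) * ∫ x, min 1 (x ^ 2) ∂ν := by positivity
    linarith
  · refine (hν.norm_levyExponent_le γ u).trans ?_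
    have h1 : u ^ 2 ≤ W ^ 2 := by rw [← sq_abs]; gcongr
    have h2 : 0 ≤ κ * u ^ 2 := by positivity
    have : |γ| * |u| + 2 * (1 + u ^ 2) * ∫ x, min 1 (x ^ 2) ∂ν ≤
        |γ| * W + 2 * (1 + W ^ 2) * ∫ x, min 1 (x ^ 2) ∂ν := by gcongr
    linarith

/-- A non-zero Lévy measure makes the real part of the exponent quadratic near the origin. -/
theorem exists_le_neg_levyExponent_re (hν : IsLevyMeasure ν) (h0 : ν ≠ 0) (γ : ℝ) :
    ∃ c v₀, 0 < c ∧ 0 < v₀ ∧ ∀ u, |u| ≤ v₀ → c * u ^ 2 ≤ -(levyExponent γ 0 ν u).re := by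
  have hunion : (⋃ n : ℕ, {x : ℝ | 1 / ((n : ℝ) + 1) ≤ |x| ∧ |x| ≤ n + 1}) = {0}ᶜ := by
    ext x
    simp only [mem_iUnion, mem_ofPred_eq, mem_compl_iff, mem_singleton_iff]
    constructor
    · rintro ⟨n, hn, -⟩ rfl
      rw [abs_zero] at hn
      have : 0 < 1 / ((n : ℝ) + 1) := by positivity
      linarith
    · intro hx
      obtain ⟨n, hn⟩ := exists_nat_ge (max |x| |x|⁻¹)
      have hx0 : 0 < |x| := abs_pos.2 hx
      refine ⟨n, ?_, ((le_max_left _ _).trans hn).trans (by linarith)⟩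
      rw [one_div]
      refine inv_le_of_inv_le₀ hx0 (((le_max_right _ _).trans hn).trans (by linarith))
  -- `ν` has no mass at `0`, so being non-zero it charges one of the annuli that exhaust the
  -- complement of `0`.
  have hpos : ∃ n : ℕ, ν {x : ℝ | 1 / ((n : ℝ) + 1) ≤ |x| ∧ |x| ≤ n + 1} ≠ 0 := by
    by_contra! hcon
    have h1 : ν ({0}ᶜ) = 0 := by rw [← hunion]; exact measure_iUnion_null hcon
    apply h0
    rw [← Measure.measure_univ_eq_zero, ← union_compl_self ({0} : Set ℝ)]
    exact measure_union_null hν.1 h1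
  obtain ⟨n, hn⟩ := hpos
  set K := {x : ℝ | 1 / ((n : ℝ) + 1) ≤ |x| ∧ |x| ≤ n + 1}
  have hKm : MeasurableSet K :=
    MeasurableSet.inter (measurableSet_le (f := fun _ => 1 / ((n : ℝ) + 1)) (g := fun x : ℝ => |x|)
      (by fun_prop) (by fun_prop)) (measurableSet_le (f := fun x : ℝ => |x|)
      (g := fun _ => (n : ℝ) + 1) (by fun_prop) (by fun_prop))
  -- `δ` serves twice: it bounds `|x|` from below on `K`, and `|u| ≤ δ` forces `|u x| ≤ 1` there
  -- because `δ (n + 1) = 1`.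
  set δ : ℝ := 1 / ((n : ℝ) + 1) with hδ
  have hδ0 : 0 < δ := by positivity
  have hδ1 : δ ≤ 1 := by
    rw [hδ, div_le_one (by positivity)]
    have : (0 : ℝ) ≤ n := by positivity
    linarith
  have hKfin : ν K ≠ ∞ := by
    have h2 : ∀ x ∈ K, ENNReal.ofReal (δ ^ 2) ≤ ENNReal.ofReal (min 1 (x ^ 2)) := by
      intro x hx
      refine ENNReal.ofReal_le_ofReal (le_min (pow_le_one₀ hδ0.le hδ1) ?_)
      rw [← sq_abs x]
      exact pow_le_pow_left₀ hδ0.le hx.1 2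
    have h3 : ENNReal.ofReal (δ ^ 2) * ν K ≤ ∫⁻ x, ENNReal.ofReal (min 1 (x ^ 2)) ∂ν := by
      rw [← setLIntegral_const]
      exact (setLIntegral_mono_ae (by fun_prop) (Eventually.of_forall h2)).trans
        (setLIntegral_le_lintegral _ _)
    intro hK
    rw [hK, ENNReal.mul_top (by simpa using hδ0.ne')] at h3
    exact (lt_of_le_of_lt h3 hν.2).ne rfl
  have hKr : 0 < ν.real K := ENNReal.toReal_pos hn hKfin
  refine ⟨2 / Real.pi ^ 2 * δ ^ 2 * ν.real K, δ, by positivity, hδ0, fun u hu => ?_⟩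
  rw [hν.levyExponent_re, neg_neg]
  have h4 : ∫ x in K, (2 / Real.pi ^ 2 * δ ^ 2 * u ^ 2 : ℝ) ∂ν ≤
      ∫ x in K, (1 - Real.cos (u * x)) ∂ν := by
    refine setIntegral_mono_on (integrableOn_const hKfin)
      (hν.integrable_one_sub_cos u).integrableOn hKm fun x hx => ?_
    have hux : |u * x| ≤ 1 := by
      rw [abs_mul]
      calc |u| * |x| ≤ δ * (n + 1) := by gcongr; exact hx.2
        _ = 1 := by rw [hδ]; field_simp
    have h5 := Real.cos_le_one_sub_mul_cos_sq (hux.trans (by linarith [Real.pi_gt_three]))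
    have h6 : δ ^ 2 ≤ x ^ 2 := by
      rw [← sq_abs x]
      exact pow_le_pow_left₀ hδ0.le hx.1 2
    have h7 : 2 / Real.pi ^ 2 * δ ^ 2 * u ^ 2 ≤ 2 / Real.pi ^ 2 * (u * x) ^ 2 := by
      rw [mul_assoc, mul_pow, mul_comm (u ^ 2)]
      gcongr
    linarith
  have h8 : ∫ x in K, (1 - Real.cos (u * x)) ∂ν ≤ ∫ x, (1 - Real.cos (u * x)) ∂ν :=
    setIntegral_le_integral (hν.integrable_one_sub_cos u)
      (Eventually.of_forall fun x => sub_nonneg.2 (Real.cos_le_one _))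
  rw [setIntegral_const, smul_eq_mul] at h4
  calc _ = ν.real K * (2 / Real.pi ^ 2 * δ ^ 2 * u ^ 2) := by ring
    _ ≤ _ := h4.trans h8

end IsLevyMeasure

/-! ### The exponent of a centred square integrable Lévy process -/

section LevyProcess

variable {Ω : Type*} [MeasurableSpace Ω] {P : Measure Ω}
  {L : ℝ≥0 → Ω → ℝ} {γ : ℝ} {ν : Measure ℝ}

theorem norm_integral_exp_sub_one_le [IsProbabilityMeasure P] {X : Ω → ℝ} (hX : MemLp X 2 P) (h0 : ∫ ω, X ω ∂P = 0)
    (u : ℝ) :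
    ‖∫ ω, Complex.exp (Complex.I * u * X ω) ∂P - 1‖ ≤ 2 * (∫ ω, X ω ^ 2 ∂P) * u ^ 2 := by
  have hi : Integrable X P := hX.integrable (by norm_num)
  have hm : AEStronglyMeasurable (fun ω => Complex.exp (Complex.I * u * X ω)) P := by
    have := hX.1.aemeasurable
    exact AEMeasurable.aestronglyMeasurable (by fun_prop)
  have he : Integrable (fun ω => Complex.exp (Complex.I * u * X ω)) P := by
    refine Integrable.of_bound hm 1 (Eventually.of_forall fun ω => ?_)
    rw [show Complex.I * u * X ω = ((u * X ω : ℝ) : ℂ) * Complex.I by push_cast; ring,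
      Complex.norm_exp_ofReal_mul_I]
  have hl : Integrable (fun ω => Complex.I * u * (X ω : ℂ)) P := hi.ofReal.const_mul _
  have h1 : ∫ ω, Complex.exp (Complex.I * u * X ω) ∂P - 1 =
      ∫ ω, (Complex.exp (Complex.I * u * X ω) - 1 - Complex.I * u * X ω) ∂P := by
    have he1 : Integrable (fun ω => Complex.exp (Complex.I * u * X ω) - 1) P :=
      he.sub (integrable_const _)
    rw [integral_sub he1 hl, integral_sub he (integrable_const _), integral_const_mul, integral_complex_ofReal, h0]
    simp
  rw [h1, mul_right_comm, ← integral_const_mul]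
  refine norm_integral_le_of_norm_le (hX.integrable_sq.const_mul _) (Eventually.of_forall fun ω => ?_)
  have := norm_exp_I_mul_sub_one_sub_le (u * X ω)
  push_cast at this
  rw [← mul_assoc] at this
  refine this.trans (le_of_eq (by ring))

theorem HasLevyTriplet.exp_levyExponent (h : HasLevyTriplet P L γ 0 ν) (u : ℝ) :
    Complex.exp (levyExponent γ 0 ν u) = ∫ ω, Complex.exp (Complex.I * u * L 1 ω) ∂P := by
  rw [h.charFun_eq 1 u]; simp

/-- Mean zero and finite variance give `|exp Ψ(u) - 1| ≤ 2σ²u²` with `σ² = E L_1²`. Near `0` the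
exponent is small, so `|Ψ| ≤ 2 |exp Ψ - 1|`. For `|u| ≥ δ` the constant in the growth bound `u² + C`
is absorbed by `C u² / δ²`. No second moment of `ν` has to be computed. -/
theorem HasLevyTriplet.exists_norm_levyExponent_le_mul_sq [IsProbabilityMeasure P]
    (h : HasLevyTriplet P L γ 0 ν)
    (hL : MemLp (L 1) 2 P) (h0 : ∫ ω, L 1 ω ∂P = 0) :
    ∃ C, 0 ≤ C ∧ ∀ u, ‖levyExponent γ 0 ν u‖ ≤ C * u ^ 2 := by
  have hν := h.levyMeasure
  have hev := (hν.tendsto_levyExponent_zero γ).eventually (Metric.ball_mem_nhds 0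
    (by norm_num : (0 : ℝ) < 1 / 2))
  obtain ⟨δ, hδ, hδ'⟩ := Metric.eventually_nhds_iff.1 hev
  obtain ⟨C, hC, hC'⟩ := hν.exists_norm_levyExponent_le γ one_pos
  have hs : 0 ≤ ∫ ω, L 1 ω ^ 2 ∂P := integral_nonneg fun ω => sq_nonneg _
  refine ⟨4 * (∫ ω, L 1 ω ^ 2 ∂P) + 1 + C / δ ^ 2, by positivity, fun u => ?_⟩
  rcases lt_or_ge |u| δ with hu | hu
  · have h1 : ‖levyExponent γ 0 ν u‖ < 1 / 2 := by simpa using hδ' (y := u) (by simpa using hu)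
    have h2 := Complex.norm_exp_sub_one_sub_id_le (x := levyExponent γ 0 ν u) (by linarith)
    have h3 := norm_integral_exp_sub_one_le hL h0 u
    rw [← h.exp_levyExponent] at h3
    set z := levyExponent γ 0 ν u
    have h4 : ‖z‖ ≤ ‖Complex.exp z - 1‖ + ‖Complex.exp z - 1 - z‖ := by
      have := norm_sub_le (Complex.exp z - 1) (Complex.exp z - 1 - z)
      simpa using this
    have h5 : ‖z‖ ^ 2 ≤ 1 / 2 * ‖z‖ := by nlinarith [norm_nonneg z]
    have h6 : 0 ≤ (1 + C / δ ^ 2) * u ^ 2 := by positivity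
    nlinarith
  · have h1 : C ≤ C / δ ^ 2 * u ^ 2 := by
      rw [div_mul_eq_mul_div, le_div_iff₀ (by positivity), ← sq_abs u]
      gcongr
    have := hC' u
    have h3 : 0 ≤ 4 * (∫ ω, L 1 ω ^ 2 ∂P) * u ^ 2 := by positivity
    nlinarith

/-- With `ν = 0` only the drift remains, `L 1` is almost surely the constant `γ`, and centring
forces `γ = 0`. -/
theorem HasLevyTriplet.levyMeasure_ne_zero [IsProbabilityMeasure P] (h : HasLevyTriplet P L γ 0 ν)
    (hm : Measurable (L 1)) (h0 : ∫ ω, L 1 ω ∂P = 0) (hne : ¬ ∀ᵐ ω ∂P, L 1 ω = 0) : ν ≠ 0 := by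
  rintro rfl
  apply hne
  have : IsProbabilityMeasure (P.map (L 1)) := Measure.isProbabilityMeasure_map hm.aemeasurable
  have h1 : P.map (L 1) = Measure.dirac γ := by
    refine Measure.ext_of_charFun (funext fun u => ?_)
    rw [charFun_apply_real, charFun_dirac, integral_map hm.aemeasurable (by fun_prop)]
    have h2 := h.exp_levyExponent u
    rw [levyExponent_eq] at h2
    simp only [integral_zero_measure, add_zero] at h2
    calc _ = ∫ ω, Complex.exp (Complex.I * u * L 1 ω) ∂P := by
          congr with ω; congr 1; ring
      _ = _ := by rw [← h2]; congr 1; simp; ring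
  have h2 : ∀ᵐ ω ∂P, L 1 ω = γ := by
    have : ∀ᵐ x ∂(P.map (L 1)), x = γ := by rw [h1]; simp [ae_dirac_eq]
    exact ae_of_ae_map hm.aemeasurable this
  have h3 : γ = 0 := by
    rw [← h0, integral_congr_ae h2]
    simp
  simpa [h3] using h2

end LevyProcess

/-! ### Partitions and sums over increments -/

/-- The function `g` is constant on each interval `(q i, q (i + 1)]`. -/
def IsConstOnCells (q : ℕ → ℝ≥0) (g : ℝ → ℝ) : Prop :=
  ∀ i, ∀ s ∈ Ioc (q i : ℝ) (q (i + 1) : ℝ), g s = g (q (i + 1) : ℝ)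

/-- The sum of `g (q (i + 1)) * (L (q (i + 1)) - L (q i))` over `a ≤ i < b`. -/
def incrementSum {Ω : Type*} (L : ℝ≥0 → Ω → ℝ) (q : ℕ → ℝ≥0) (g : ℝ → ℝ) (a b : ℕ) (ω : Ω) : ℝ :=
  ∑ i ∈ Finset.Ico a b, g (q (i + 1) : ℝ) * (L (q (i + 1)) ω - L (q i) ω)

theorem exists_partition (S : Finset ℝ≥0) :
    ∃ (q : ℕ → ℝ≥0) (N : ℕ), Monotone q ∧ ∀ x ∈ S, ∃ j ≤ N, q j = x := by
  have hcard : 0 < (insert 0 S).card := Finset.card_pos.2 (Finset.insert_nonempty _ _)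
  set e := (insert 0 S).orderEmbOfFin rfl
  -- The index is capped at the last point, so that `q` is monotone on all of `ℕ`; the point `0` is
  -- inserted only to have a non-empty set.
  refine ⟨fun j => e ⟨min j ((insert 0 S).card - 1), by omega⟩, (insert 0 S).card - 1, ?_, ?_⟩
  · intro i j hij
    exact e.monotone (Fin.mk_le_mk.2 (min_le_min_right _ hij))
  · intro x hx
    have hx' : x ∈ Set.range e := by
      rw [Finset.range_orderEmbOfFin]
      exact Finset.mem_insert_of_mem hx
    obtain ⟨⟨i, hi⟩, rfl⟩ := hx'
    have hi' : i ≤ (insert 0 S).card - 1 := Nat.le_sub_one_of_lt hi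
    refine ⟨i, hi', ?_⟩
    exact congrArg e (Fin.ext (min_eq_left hi'))

/-- Each summand is the increment of `G` along the partition clamped to `[u, v]`, and these
increments telescope. -/
theorem sum_indicator_mul_sub (G : ℝ≥0 → ℝ) {q : ℕ → ℝ≥0} (hq : Monotone q) {N : ℕ} {u v : ℝ≥0}
    (huv : u ≤ v) (hu : ∃ j ≤ N, q j = u) (hv : ∃ j ≤ N, q j = v) :
    ∑ i ∈ Finset.Ico 0 N, (Ioc (u : ℝ) (v : ℝ)).indicator (fun _ => (1 : ℝ)) (q (i + 1)) *
      (G (q (i + 1)) - G (q i)) = G v - G u := by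
  obtain ⟨a, haN, rfl⟩ := hu
  obtain ⟨b, hbN, rfl⟩ := hv
  have hN : max (q a) (min (q b) (q N)) = q b := by
    rw [min_eq_left (hq hbN), max_eq_right huv]
  have h0 : max (q a) (min (q b) (q 0)) = q a :=
    max_eq_left ((min_le_right _ _).trans (hq (Nat.zero_le _)))
  have htel := Finset.sum_range_sub (fun j => G (max (q a) (min (q b) (q j)))) N
  rw [hN, h0] at htel
  rw [← htel, Finset.range_eq_Ico]
  refine Finset.sum_congr rfl fun i _ => ?_
  rcases le_or_gt (q (i + 1)) (q a) with h | h
  · rw [indicator_of_notMem (fun hm => absurd hm.1 (not_lt.2 (by exact_mod_cast h))), zero_mul,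
      max_eq_left ((min_le_right _ _).trans h),
      max_eq_left ((min_le_right _ _).trans ((hq (Nat.le_succ i)).trans h)), sub_self]
  rcases lt_or_ge (q b) (q (i + 1)) with h' | h'
  · have hbi : q b ≤ q i := by
      by_contra! hlt
      have : i < b := hq.reflect_lt hlt
      exact absurd (hq this) (not_le.2 h')
    rw [indicator_of_notMem (fun hm => absurd hm.2 (not_le.2 (by exact_mod_cast h'))), zero_mul,
      min_eq_left h'.le, min_eq_left hbi, sub_self]
  · have hai : q a ≤ q i := by
      by_contra! hlt
      have : i < a := hq.reflect_lt hlt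
      exact absurd (hq this) (not_le.2 h)
    rw [indicator_of_mem (show ((q (i + 1) : ℝ)) ∈ Ioc (q a : ℝ) (q b : ℝ) from
      ⟨by exact_mod_cast h, by exact_mod_cast h'⟩), one_mul, min_eq_right h', max_eq_right h.le,
      min_eq_right ((hq (Nat.le_succ i)).trans h'), max_eq_right hai]

/-! ### Step functions and elementary integrals over a partition -/

namespace StepFun

/-- The finite set of all endpoints of a step function. -/
def endpoints (g : StepFun) : Finset ℝ≥0 :=
  Finset.univ.image g.left ∪ Finset.univ.image g.right

theorem left_mem_endpoints (g : StepFun) (i : Fin g.n) : g.left i ∈ g.endpoints :=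
  Finset.mem_union_left _ (Finset.mem_image_of_mem _ (Finset.mem_univ i))

theorem right_mem_endpoints (g : StepFun) (i : Fin g.n) : g.right i ∈ g.endpoints :=
  Finset.mem_union_right _ (Finset.mem_image_of_mem _ (Finset.mem_univ i))

variable {g : StepFun} {q : ℕ → ℝ≥0} {N : ℕ}

theorem isConstOnCells (hq : Monotone q) (hN : ∀ x ∈ g.endpoints, ∃ j ≤ N, q j = x) :
    IsConstOnCells q g.toFun := by
  intro i s hs
  unfold toFun
  refine Finset.sum_congr rfl fun k _ => ?_
  obtain ⟨a, -, ha⟩ := hN _ (g.left_mem_endpoints k)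
  obtain ⟨b, -, hb⟩ := hN _ (g.right_mem_endpoints k)
  have hiff : s ∈ Ioc (g.left k : ℝ) (g.right k : ℝ) ↔
      ((q (i + 1) : ℝ)) ∈ Ioc (g.left k : ℝ) (g.right k : ℝ) := by
    rw [← ha, ← hb]
    constructor
    · rintro ⟨h1, h2⟩
      refine ⟨h1.trans_le hs.2, ?_⟩
      have h3 : q i < q b := by exact_mod_cast hs.1.trans_le h2
      exact_mod_cast hq (hq.reflect_lt h3)
    · rintro ⟨h1, h2⟩
      refine ⟨?_, hs.2.trans h2⟩
      have h3 : a < i + 1 := hq.reflect_lt (by exact_mod_cast h1)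
      have h4 : q a ≤ q i := hq (Nat.lt_succ_iff.1 h3)
      exact lt_of_le_of_lt (by exact_mod_cast h4) hs.1
  by_cases h : s ∈ Ioc (g.left k : ℝ) (g.right k : ℝ)
  · rw [indicator_of_mem h, indicator_of_mem (hiff.1 h)]
  · rw [indicator_of_notMem h, indicator_of_notMem (fun hh => h (hiff.2 hh))]

theorem integral_eq_incrementSum {Ω : Type*} (L : ℝ≥0 → Ω → ℝ) (hq : Monotone q)
    (hN : ∀ x ∈ g.endpoints, ∃ j ≤ N, q j = x) :
    g.integral L = incrementSum L q g.toFun 0 N := by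
  funext ω
  unfold integral incrementSum toFun
  simp_rw [Finset.sum_mul]
  rw [Finset.sum_comm]
  refine Finset.sum_congr rfl fun k _ => ?_
  rw [← sum_indicator_mul_sub (fun t => L t ω) hq (g.left_le_right k)
    (hN _ (g.left_mem_endpoints k)) (hN _ (g.right_mem_endpoints k)), Finset.mul_sum]
  exact Finset.sum_congr rfl fun i _ => by ring

theorem measurable_toFun (g : StepFun) : Measurable g.toFun := by
  unfold toFun
  exact Finset.measurable_sum _ fun i _ =>
    (measurable_const.indicator measurableSet_Ioc).const_mul _

theorem memLp_toFun (g : StepFun) : MemLp g.toFun 2 volume := by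
  unfold toFun
  refine memLp_finsetSum _ fun i _ => MemLp.const_mul ?_ _
  exact memLp_indicator_const 2 measurableSet_Ioc 1 (Or.inr (by simp))

theorem measurable_integral {Ω : Type*} [MeasurableSpace Ω] (g : StepFun) {L : ℝ≥0 → Ω → ℝ}
    (hL : ∀ t, Measurable (L t)) : Measurable (g.integral L) := by
  unfold integral
  exact Finset.measurable_sum _ fun i _ => ((hL _).sub (hL _)).const_mul _

/-- The difference of two step functions. -/
def sub (g h : StepFun) : StepFun where
  n := g.n + h.n
  coeff := Fin.append g.coeff (fun i => -h.coeff i)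
  left := Fin.append g.left h.left
  right := Fin.append g.right h.right
  left_le_right := by
    intro i
    refine Fin.addCases (fun i => ?_) (fun i => ?_) i
    · simpa using g.left_le_right i
    · simpa using h.left_le_right i

theorem sub_toFun (g h : StepFun) (s : ℝ) : (g.sub h).toFun s = g.toFun s - h.toFun s := by
  refine (Fin.sum_univ_add (a := g.n) (b := h.n) _).trans ?_
  simp [toFun, sub, sub_eq_add_neg]

theorem sub_integral {Ω : Type*} (g h : StepFun) (L : ℝ≥0 → Ω → ℝ) (ω : Ω) :
    (g.sub h).integral L ω = g.integral L ω - h.integral L ω := by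
  refine (Fin.sum_univ_add (a := g.n) (b := h.n) _).trans ?_
  simp only [integral, sub, Fin.append_left, Fin.append_right, neg_mul,
    Finset.sum_neg_distrib, sub_eq_add_neg]

end StepFun

/-! ### Integrals of functions constant on cells -/

section Cells

variable {q : ℕ → ℝ≥0} {g : ℝ → ℝ}

theorem IsConstOnCells.eqOn (hg : IsConstOnCells q g) (hq : Monotone q) {E : Type*} (Φ : ℝ → E)
    (i : ℕ) : EqOn (fun _ => Φ (g (q (i + 1) : ℝ))) (fun s => Φ (g s))
      (uIoc (q i : ℝ) (q (i + 1) : ℝ)) := by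
  intro s hs
  rw [uIoc_of_le (by exact_mod_cast hq (Nat.le_succ i))] at hs
  simp only [hg i s hs]

/-- Only finitely many values of `g` occur on the interval, so no regularity of `Φ` is needed; in
particular none of the Lévy exponent. -/
theorem IsConstOnCells.intervalIntegrable (hg : IsConstOnCells q g) (hq : Monotone q) {E : Type*}
    [NormedAddCommGroup E] (Φ : ℝ → E) {a b : ℕ} (hab : a ≤ b) :
    IntervalIntegrable (fun s => Φ (g s)) volume (q a : ℝ) (q b : ℝ) := by
  refine IntervalIntegrable.trans_iterate_Ico (a := fun i => (q i : ℝ)) hab fun i _ => ?_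
  exact intervalIntegrable_const.congr (hg.eqOn hq Φ i)

theorem IsConstOnCells.integral_eq_sum (hg : IsConstOnCells q g) (hq : Monotone q) {E : Type*}
    [NormedAddCommGroup E] [NormedSpace ℝ E] [CompleteSpace E] (Φ : ℝ → E) {a b : ℕ}
    (hab : a ≤ b) :
    ∫ s in (q a : ℝ)..(q b : ℝ), Φ (g s) =
      ∑ i ∈ Finset.Ico a b, ((q (i + 1) : ℝ) - (q i : ℝ)) • Φ (g (q (i + 1) : ℝ)) := by
  rw [← intervalIntegral.sum_integral_adjacent_intervals_Ico (a := fun i => (q i : ℝ)) hab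
    fun i _ => intervalIntegrable_const.congr (hg.eqOn hq Φ i)]
  refine Finset.sum_congr rfl fun i _ => ?_
  rw [← intervalIntegral.integral_const]
  refine intervalIntegral.integral_congr_ae (Eventually.of_forall fun s hs => ?_)
  exact (hg.eqOn hq Φ i hs).symm

end Cells

/-! ### Characteristic functions and second moments of sums over increments -/

theorem Complex.norm_exp_sub_one_le_of_re_nonpos {z : ℂ} (hz : z.re ≤ 0) :
    ‖Complex.exp z - 1‖ ≤ ‖z‖ := by
  have h := (convex_halfSpace_re_le 0).norm_image_sub_le_of_norm_deriv_le (𝕜 := ℂ)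
    (f := Complex.exp) (C := 1) (x := 0) (y := z)
    (fun w _ => Complex.differentiableAt_exp) (fun w hw => ?_) (by simp) hz
  · simpa using h
  · rw [Complex.deriv_exp, Complex.norm_exp]
    exact Real.exp_le_one_iff.2 hw

theorem tendsto_two_mul_one_sub_cos_div (x : ℝ) :
    Tendsto (fun u : ℝ => 2 * (1 - Real.cos (u * x)) / u ^ 2) (𝓝[≠] 0) (𝓝 (x ^ 2)) := by
  have h1 : HasDerivAt (fun u : ℝ => 2 * Real.sin (u * x / 2)) x 0 := by
    have h2 : HasDerivAt (fun u : ℝ => u * x / 2) (x / 2) 0 := by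
      simpa using ((hasDerivAt_id (0 : ℝ)).mul_const x).div_const 2
    have h3 := h2.sin.const_mul 2
    rw [zero_mul, zero_div, Real.cos_zero, one_mul, mul_div_cancel₀ _ two_ne_zero] at h3
    exact h3
  have h2 := (hasDerivAt_iff_tendsto_slope_zero.1 h1).pow 2
  refine h2.congr fun u => ?_
  simp only [zero_add, zero_mul, zero_div, Real.sin_zero, mul_zero, sub_zero, smul_eq_mul]
  have h4 : Real.cos (u * x) = 1 - 2 * Real.sin (u * x / 2) ^ 2 := by
    have h5 := Real.cos_two_mul (u * x / 2)
    rw [mul_div_cancel₀ _ two_ne_zero] at h5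
    have := Real.sin_sq_add_cos_sq (u * x / 2)
    linarith
  rw [h4]
  ring

section Moments

variable {Ω : Type*} [MeasurableSpace Ω] {P : Measure Ω}

theorem re_integral_exp_I_mul [IsFiniteMeasure P] {X : Ω → ℝ} (hX : Measurable X) (u : ℝ) :
    (∫ ω, Complex.exp (Complex.I * u * X ω) ∂P).re = ∫ ω, Real.cos (u * X ω) ∂P := by
  have hb : Integrable (fun ω => Complex.exp (Complex.I * u * X ω)) P := by
    refine Integrable.of_bound (by fun_prop) 1 (Eventually.of_forall fun ω => ?_)
    rw [show Complex.I * u * X ω = ((u * X ω : ℝ) : ℂ) * Complex.I by push_cast; ring,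
      Complex.norm_exp_ofReal_mul_I]
  have h := integral_re hb
  simp only [RCLike.re_to_complex] at h
  rw [← h]
  congr with ω
  rw [show Complex.I * u * X ω = ((u * X ω : ℝ) : ℂ) * Complex.I by push_cast; ring,
    Complex.exp_ofReal_mul_I_re]

theorem integral_one_sub_cos_le [IsProbabilityMeasure P] {X : Ω → ℝ} (hX : Measurable X) (u : ℝ) :
    ∫ ω, (1 - Real.cos (u * X ω)) ∂P ≤ ‖∫ ω, Complex.exp (Complex.I * u * X ω) ∂P - 1‖ := by
  have hi : Integrable (fun ω => Real.cos (u * X ω)) P :=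
    Integrable.of_bound (by fun_prop) 1 (Eventually.of_forall fun ω => Real.abs_cos_le_one _)
  rw [integral_sub (integrable_const _) hi, ← re_integral_exp_I_mul hX, integral_const,
    probReal_univ, one_smul, norm_sub_rev]
  refine le_trans (le_of_eq ?_) (Complex.re_le_norm _)
  simp

/-- A quadratic bound for the characteristic function bounds the second moment. -/
theorem lintegral_enorm_sq_le [IsProbabilityMeasure P] {X : Ω → ℝ} (hX : Measurable X) {B : ℝ}
    (hB : ∀ u : ℝ, ‖∫ ω, Complex.exp (Complex.I * u * X ω) ∂P - 1‖ ≤ B * u ^ 2) :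
    ∫⁻ ω, ‖X ω‖ₑ ^ 2 ∂P ≤ ENNReal.ofReal (2 * B) := by
  -- Since `2(1 - cos(uX))/u²` tends to `X²` as `u → 0`, Fatou's lemma bounds the second moment
  -- without assuming that it is finite.
  set f : ℝ → Ω → ℝ≥0∞ := fun u ω => ENNReal.ofReal (2 * (1 - Real.cos (u * X ω)) / u ^ 2)
  have hlim : ∀ ω, liminf (fun u => f u ω) (𝓝[≠] (0 : ℝ)) = ‖X ω‖ₑ ^ 2 := by
    intro ω
    have h := ENNReal.tendsto_ofReal (tendsto_two_mul_one_sub_cos_div (X ω))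
    rw [h.liminf_eq, ← sq_abs, ENNReal.ofReal_pow (abs_nonneg _), Real.enorm_eq_ofReal_abs]
  calc ∫⁻ ω, ‖X ω‖ₑ ^ 2 ∂P = ∫⁻ ω, liminf (fun u => f u ω) (𝓝[≠] (0 : ℝ)) ∂P := by
        simp_rw [hlim]
    _ ≤ liminf (fun u => ∫⁻ ω, f u ω ∂P) (𝓝[≠] (0 : ℝ)) :=
        lintegral_liminf_le fun u => by simp only [f]; fun_prop
    _ ≤ ENNReal.ofReal (2 * B) := by
        refine liminf_le_of_frequently_le' (Eventually.frequently ?_)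
        filter_upwards [self_mem_nhdsWithin] with u hu
        have hu2 : 0 < u ^ 2 := by have : u ≠ 0 := hu; positivity
        have hnn : ∀ ω, 0 ≤ 2 * (1 - Real.cos (u * X ω)) / u ^ 2 := fun ω => by
          have := Real.cos_le_one (u * X ω)
          have : 0 ≤ 1 - Real.cos (u * X ω) := by linarith
          positivity
        have hi : Integrable (fun ω => 2 * (1 - Real.cos (u * X ω)) / u ^ 2) P := by
          refine (((integrable_const 1).sub ?_).const_mul 2).div_const _
          exact Integrable.of_bound (by fun_prop) 1
            (Eventually.of_forall fun ω => Real.abs_cos_le_one _)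
        rw [← ofReal_integral_eq_lintegral_ofReal hi (Eventually.of_forall hnn)]
        refine ENNReal.ofReal_le_ofReal ?_
        rw [integral_div, integral_const_mul, div_le_iff₀ hu2, mul_assoc]
        exact mul_le_mul_of_nonneg_left ((integral_one_sub_cos_le hX u).trans (hB u)) two_pos.le

end Moments

/-! ### Characteristic functions and `L²` bounds of Lévy sums -/

section Increments

variable {Ω : Type*} [MeasurableSpace Ω] {P : Measure Ω} {L : ℝ≥0 → Ω → ℝ} {γ : ℝ}
  {ν : Measure ℝ} {q : ℕ → ℝ≥0} {g : ℝ → ℝ}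

theorem measurable_incrementSum (hL : ∀ t, Measurable (L t)) (q : ℕ → ℝ≥0) (g : ℝ → ℝ) (a b : ℕ) :
    Measurable (incrementSum L q g a b) := by
  unfold incrementSum
  exact Finset.measurable_sum _ fun i _ => ((hL _).sub (hL _)).const_mul _

theorem integral_exp_increment (hL : IsLevyProcess P L) (h : HasLevyTriplet P L γ 0 ν)
    {s t : ℝ≥0} (hst : s ≤ t) (u : ℝ) :
    ∫ ω, Complex.exp (Complex.I * u * ((L t ω - L s ω : ℝ) : ℂ)) ∂P =
      Complex.exp ((((t : ℝ) - s : ℝ) : ℂ) * levyExponent γ 0 ν u) := by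
  have h1 := hL.stationary_increments s (t - s)
  rw [add_tsub_cancel_of_le hst] at h1
  have h2 := (h1.comp (u := fun x : ℝ => Complex.exp (Complex.I * u * (x : ℂ)))
    (by fun_prop)).integral_eq
  simp only [Function.comp_def] at h2
  rw [h2, h.charFun_eq, NNReal.coe_sub hst]

/-- Independence factorises the characteristic function, and stationarity makes each factor an
exponential of cell length times `Ψ`. The resulting Riemann sum equals the integral exactly because
`g` is constant on cells. -/
theorem integral_exp_incrementSum (hL : IsLevyProcess P L)
    (h : HasLevyTriplet P L γ 0 ν) (hq : Monotone q) (hg : IsConstOnCells q g) {a b : ℕ}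
    (hab : a ≤ b) (u : ℝ) :
    ∫ ω, Complex.exp (Complex.I * u * incrementSum L q g a b ω) ∂P =
      Complex.exp (∫ s in (q a : ℝ)..(q b : ℝ), levyExponent γ 0 ν (u * g s)) := by
  have hind := (hL.indep_increments.nat hq).comp
    (fun i x => Complex.exp (Complex.I * ((u * g (q (i + 1)) : ℝ) : ℂ) * (x : ℂ)))
    (fun i => by fun_prop)
  have hind2 := hind.precomp (g := fun i : ↥(Finset.Ico a b) => (i : ℕ))
    Subtype.val_injective
  have hprod := hind2.integral_prod_eq_prod_integral (fun i => by
    have h1 := hL.measurable (q (i + 1))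
    have h2 := hL.measurable (q i)
    exact Measurable.aestronglyMeasurable (by simp only [Function.comp_def]; fun_prop))
  rw [hg.integral_eq_sum hq (fun x => levyExponent γ 0 ν (u * x)) hab, Complex.exp_sum]
  have e1 : ∀ ω, Complex.exp (Complex.I * u * incrementSum L q g a b ω) =
      (∏ i : ↥(Finset.Ico a b), ((fun x : ℝ => Complex.exp (Complex.I *
        ((u * g (q (i + 1)) : ℝ) : ℂ) * (x : ℂ))) ∘
          fun ω => L (q (i + 1)) ω - L (q i) ω)) ω := by
    intro ω
    rw [Finset.prod_apply, Finset.prod_coe_sort (Finset.Ico a b) (fun i =>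
      ((fun x : ℝ => Complex.exp (Complex.I * ((u * g (q (i + 1)) : ℝ) : ℂ) * (x : ℂ))) ∘
          fun ω => L (q (i + 1)) ω - L (q i) ω) ω)]
    simp only [Function.comp_apply]
    rw [← Complex.exp_sum, incrementSum]
    congr 1
    push_cast
    rw [Finset.mul_sum]
    exact Finset.sum_congr rfl fun i _ => by ring
  simp_rw [e1]
  refine hprod.trans ?_
  rw [Finset.prod_coe_sort (Finset.Ico a b) (fun i => ∫ ω,
      ((fun x : ℝ => Complex.exp (Complex.I * ((u * g (q (i + 1)) : ℝ) : ℂ) * (x : ℂ))) ∘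
          fun ω => L (q (i + 1)) ω - L (q i) ω) ω ∂P)]
  refine Finset.prod_congr rfl fun i _ => ?_
  simp only [Function.comp_apply]
  rw [integral_exp_increment hL h (hq (Nat.le_succ i)), Complex.real_smul]

theorem re_integral_levyExponent_nonpos (hν : IsLevyMeasure ν) (hq : Monotone q)
    (hg : IsConstOnCells q g) {a b : ℕ} (hab : a ≤ b) (u : ℝ) :
    (∫ s in (q a : ℝ)..(q b : ℝ), levyExponent γ 0 ν (u * g s)).re ≤ 0 := by
  rw [hg.integral_eq_sum hq (fun x => levyExponent γ 0 ν (u * x)) hab, Complex.re_sum]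
  refine Finset.sum_nonpos fun i _ => ?_
  rw [Complex.smul_re, smul_eq_mul]
  refine mul_nonpos_of_nonneg_of_nonpos (sub_nonneg.2 ?_) (hν.levyExponent_re_nonpos _ _)
  exact_mod_cast hq (Nat.le_succ i)

/-- On the half plane `Re z ≤ 0` one has `|exp z - 1| ≤ |z|`. The bound is used twice: with `C = 0`
it controls the variance, and with small `κ` it expresses the absence of a Gaussian part. -/
theorem norm_integral_exp_incrementSum_sub_one_le (hL : IsLevyProcess P L)
    (h : HasLevyTriplet P L γ 0 ν) (hq : Monotone q) (hg : IsConstOnCells q g) {a b : ℕ}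
    (hab : a ≤ b) {κ C : ℝ} (hκ : ∀ u, ‖levyExponent γ 0 ν u‖ ≤ κ * u ^ 2 + C) (u : ℝ) :
    ‖∫ ω, Complex.exp (Complex.I * u * incrementSum L q g a b ω) ∂P - 1‖ ≤
      κ * u ^ 2 * (∫ s in (q a : ℝ)..(q b : ℝ), g s ^ 2) + C * ((q b : ℝ) - q a) := by
  have hqab : (q a : ℝ) ≤ q b := by exact_mod_cast hq hab
  rw [integral_exp_incrementSum hL h hq hg hab]
  refine (Complex.norm_exp_sub_one_le_of_re_nonpos
    (re_integral_levyExponent_nonpos h.levyMeasure hq hg hab u)).trans ?_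
  refine (intervalIntegral.norm_integral_le_integral_norm hqab).trans ?_
  have h2 := hg.intervalIntegrable hq (fun x => x ^ 2) hab
  rw [← intervalIntegral.integral_const_mul, mul_comm C, ← smul_eq_mul _ C,
    ← intervalIntegral.integral_const, ← intervalIntegral.integral_add (h2.const_mul _)
      intervalIntegrable_const]
  refine intervalIntegral.integral_mono_on hqab
    (hg.intervalIntegrable hq (fun x => ‖levyExponent γ 0 ν (u * x)‖) hab)
    ((h2.const_mul _).add intervalIntegrable_const) fun s _ => ?_
  refine (hκ _).trans (le_of_eq ?_)
  ring

theorem lintegral_incrementSum_sq_le [IsProbabilityMeasure P] (hL : IsLevyProcess P L)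
    (h : HasLevyTriplet P L γ 0 ν) (hq : Monotone q) (hg : IsConstOnCells q g) {a b : ℕ}
    (hab : a ≤ b) {C : ℝ} (hC : ∀ u, ‖levyExponent γ 0 ν u‖ ≤ C * u ^ 2) :
    ∫⁻ ω, ‖incrementSum L q g a b ω‖ₑ ^ 2 ∂P ≤
      ENNReal.ofReal (2 * C * ∫ s in (q a : ℝ)..(q b : ℝ), g s ^ 2) := by
  rw [mul_assoc]
  refine lintegral_enorm_sq_le (measurable_incrementSum hL.measurable q g a b) fun u => ?_
  have := norm_integral_exp_incrementSum_sub_one_le hL h hq hg hab (κ := C) (C := 0)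
    (fun u => by simpa using hC u) u
  refine this.trans (le_of_eq ?_)
  ring

/-- An inequality replaces the isometry of the stochastic integral: the constant `2 * C` comes from
the exponent, and its exact value is irrelevant below. -/
theorem StepFun.lintegral_integral_sq_le [IsProbabilityMeasure P] (hL : IsLevyProcess P L)
    (h : HasLevyTriplet P L γ 0 ν) {C : ℝ} (hC0 : 0 ≤ C)
    (hC : ∀ u, ‖levyExponent γ 0 ν u‖ ≤ C * u ^ 2) (f : StepFun) :
    ∫⁻ ω, ‖f.integral L ω‖ₑ ^ 2 ∂P ≤ ENNReal.ofReal (2 * C) * ∫⁻ s, ‖f.toFun s‖ₑ ^ 2 := by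
  obtain ⟨q, N, hq, hN⟩ := exists_partition f.endpoints
  have hqN : (q 0 : ℝ) ≤ q N := by exact_mod_cast hq (Nat.zero_le N)
  rw [f.integral_eq_incrementSum L hq hN]
  refine (lintegral_incrementSum_sq_le hL h hq (f.isConstOnCells hq hN) (Nat.zero_le N) hC).trans ?_
  rw [ENNReal.ofReal_mul (by positivity)]
  gcongr
  rw [intervalIntegral.integral_of_le hqN, ofReal_integral_eq_lintegral_ofReal
    f.memLp_toFun.integrable_sq.integrableOn (Eventually.of_forall fun s => sq_nonneg _)]
  refine (setLIntegral_le_lintegral _ _).trans (lintegral_mono fun s => ?_)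
  rw [← sq_abs, ENNReal.ofReal_pow (abs_nonneg _), Real.enorm_eq_ofReal_abs]

theorem StepFun.eLpNorm_integral_le [IsProbabilityMeasure P] (hL : IsLevyProcess P L)
    (h : HasLevyTriplet P L γ 0 ν) {C : ℝ} (hC0 : 0 ≤ C)
    (hC : ∀ u, ‖levyExponent γ 0 ν u‖ ≤ C * u ^ 2) (f : StepFun) :
    eLpNorm (f.integral L) 2 P ^ 2 ≤ ENNReal.ofReal (2 * C) * eLpNorm f.toFun 2 volume ^ 2 := by
  have e1 := eLpNorm_nnreal_pow_eq_lintegral (μ := P) (f := f.integral L) (p := 2) two_ne_zero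
  have e2 := eLpNorm_nnreal_pow_eq_lintegral (μ := volume) (f := f.toFun) (p := 2) two_ne_zero
  simp only [NNReal.coe_ofNat, ENNReal.coe_ofNat, ENNReal.rpow_ofNat] at e1 e2
  rw [e1, e2]
  exact f.lintegral_integral_sq_le hL h hC0 hC

end Increments

/-! ### The Molchan-Golosov kernel -/

theorem molchanGolosovConst_pos {H : ℝ} (h0 : 0 < H) (h1 : H < 1) : 0 < molchanGolosovConst H := by
  have e1 := Real.Gamma_pos_of_pos (show 0 < H + 1 / 2 by linarith)
  have e2 := Real.Gamma_pos_of_pos (show 0 < 3 / 2 - H by linarith)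
  have e3 := Real.Gamma_pos_of_pos (show 0 < 2 - 2 * H by linarith)
  unfold molchanGolosovConst
  positivity

/-- Euler's integral applies with Beta parameters `(1/2 - H, 2H)` after exchanging the upper
parameters if `H < 1/2`, and with `(H - 1/2, 1)` if `H > 1/2`. Without this existence
`gaussHypergeometric` would take its default value `0`. -/
theorem exists_isHypergeometricContinuation {H : ℝ} (h0 : 0 < H) (hH : H ≠ 1 / 2) :
    ∃ g, IsHypergeometricContinuation (1 / 2 - H) (H - 1 / 2) (H + 1 / 2) g := by
  rcases lt_or_gt_of_ne hH with h | h
  · have := (isHypergeometricContinuation_integral (H - 1 / 2) (b := 1 / 2 - H) (d := 2 * H)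
      (by linarith) (by linarith)).symm
    rw [show 1 / 2 - H + 2 * H = H + 1 / 2 by ring] at this
    exact ⟨_, this⟩
  · have := isHypergeometricContinuation_integral (1 / 2 - H) (b := H - 1 / 2) (d := 1)
      (by linarith) (by linarith)
    rw [show H - 1 / 2 + 1 = H + 1 / 2 by ring] at this
    exact ⟨_, this⟩

theorem continuousOn_gaussHypergeometric {H : ℝ} (h0 : 0 < H) (hH : H ≠ 1 / 2) :
    ContinuousOn (gaussHypergeometric (1 / 2 - H) (H - 1 / 2) (H + 1 / 2)) (Iio 1) := by
  obtain ⟨g, hg⟩ := exists_isHypergeometricContinuation h0 hH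
  exact hg.1.continuousOn.congr fun x hx => gaussHypergeometric_eq hg hx

theorem gaussHypergeometric_zero {H : ℝ} (h0 : 0 < H) (hH : H ≠ 1 / 2) :
    gaussHypergeometric (1 / 2 - H) (H - 1 / 2) (H + 1 / 2) 0 = 1 := by
  obtain ⟨g, hg⟩ := exists_isHypergeometricContinuation h0 hH
  rw [gaussHypergeometric_eq hg one_pos, hg.2 0 (by norm_num), ordinaryHypergeometric_zero]

theorem measurable_molchanGolosovKernel {H : ℝ} (h0 : 0 < H) (hH : H ≠ 1 / 2) (t : ℝ) :
    Measurable (molchanGolosovKernel H t) := by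
  classical
  have hc : ContinuousOn (fun s => molchanGolosovConst H * (t - s) ^ (H - 1 / 2) *
      gaussHypergeometric (1 / 2 - H) (H - 1 / 2) (H + 1 / 2) ((s - t) / s)) (Ioo 0 t) := by
    refine (continuousOn_const.mul ?_).mul ?_
    · exact ContinuousOn.rpow_const (by fun_prop) fun s hs => Or.inl (sub_pos.2 hs.2).ne'
    · refine (continuousOn_gaussHypergeometric h0 hH).comp
        (ContinuousOn.div (by fun_prop) (by fun_prop) fun s hs => hs.1.ne') fun s hs => ?_
      have : (s - t) / s < 0 := div_neg_of_neg_of_pos (sub_neg.2 hs.2) hs.1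
      exact this.trans one_pos
  have := hc.measurable_piecewise (g := fun _ => (0 : ℝ)) continuousOn_const measurableSet_Ioo
  convert this using 1
  funext s
  simp only [piecewise, molchanGolosovKernel, mem_Ioo]

/-- For `H < 1/2` the kernel is comparable to `(t - s) ^ (H - 1/2)` near the diagonal. -/
theorem exists_molchanGolosovKernel_bounds {H : ℝ} (h0 : 0 < H) (hH : H < 1 / 2) {T : ℝ}
    (hT : 0 < T) :
    ∃ δ > 0, ∀ s t, T ≤ s → s < t → t - s < δ →
      molchanGolosovConst H / 2 * (t - s) ^ (H - 1 / 2) ≤ molchanGolosovKernel H t s ∧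
      molchanGolosovKernel H t s ≤ 2 * molchanGolosovConst H * (t - s) ^ (H - 1 / 2) := by
  have hc := molchanGolosovConst_pos h0 (by linarith)
  have hcont : ContinuousAt (gaussHypergeometric (1 / 2 - H) (H - 1 / 2) (H + 1 / 2)) 0 :=
    (continuousOn_gaussHypergeometric h0 hH.ne).continuousAt (Iio_mem_nhds one_pos)
  have hev := hcont.eventually (Ioo_mem_nhds
    (show (1 / 2 : ℝ) < gaussHypergeometric (1 / 2 - H) (H - 1 / 2) (H + 1 / 2) 0 by
      rw [gaussHypergeometric_zero h0 hH.ne]; norm_num)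
    (show gaussHypergeometric (1 / 2 - H) (H - 1 / 2) (H + 1 / 2) 0 < 2 by
      rw [gaussHypergeometric_zero h0 hH.ne]; norm_num))
  obtain ⟨η, hη, hη'⟩ := Metric.eventually_nhds_iff.1 hev
  -- For `s ≥ T` the argument satisfies `|(s - t)/s| < δ/T = η`, where the hypergeometric factor is
  -- within `(1/2, 2)`.
  refine ⟨η * T, by positivity, fun s t hs hst hd => ?_⟩
  have hs0 : 0 < s := hT.trans_le hs
  have hx := hη' (y := (s - t) / s) (by
    rw [Real.dist_eq, sub_zero, abs_div, abs_of_neg (sub_neg.2 hst), abs_of_pos hs0,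
      div_lt_iff₀ hs0]
    nlinarith)
  have hp := Real.rpow_pos_of_pos (sub_pos.2 hst) (H - 1 / 2)
  have hcp : 0 < molchanGolosovConst H * (t - s) ^ (H - 1 / 2) := by positivity
  rw [molchanGolosovKernel, if_pos ⟨hs0, hst⟩]
  constructor
  · nlinarith [hx.1]
  · nlinarith [hx.2]

/-! ### The kernel for `H > 1/2` -/

theorem lintegral_Ioo_sub_rpow {a b p : ℝ} (hab : a ≤ b) (hp : -1 < p) :
    ∫⁻ x in Ioo a b, ENNReal.ofReal ((x - a) ^ p) =
      ENNReal.ofReal ((b - a) ^ (p + 1) / (p + 1)) := by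
  have hi : IntervalIntegrable (fun x : ℝ => (x - a) ^ p) volume a b := by
    have := (intervalIntegral.intervalIntegrable_rpow' (a := 0) (b := b - a) hp).comp_sub_right a
    simpa using this
  rw [Measure.restrict_congr_set Ioo_ae_eq_Ioc, ← ofReal_integral_eq_lintegral_ofReal hi.1,
    ← intervalIntegral.integral_of_le hab,
    intervalIntegral.integral_comp_sub_right (fun x => x ^ p), integral_rpow (Or.inl hp)]
  · rw [sub_self, Real.zero_rpow (by linarith), sub_zero]
  · refine (ae_restrict_iff' measurableSet_Ioc).2 (Eventually.of_forall fun x hx => ?_)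
    exact Real.rpow_nonneg (sub_nonneg.2 hx.1.le) _

theorem lintegral_Ioo_rsub_rpow {a b p : ℝ} (hab : a ≤ b) (hp : -1 < p) :
    ∫⁻ x in Ioo a b, ENNReal.ofReal ((b - x) ^ p) =
      ENNReal.ofReal ((b - a) ^ (p + 1) / (p + 1)) := by
  have hi : IntervalIntegrable (fun x : ℝ => (b - x) ^ p) volume a b := by
    have := (intervalIntegral.intervalIntegrable_rpow' (a := b - a) (b := 0) hp).comp_sub_left b
    simpa using this
  rw [Measure.restrict_congr_set Ioo_ae_eq_Ioc, ← ofReal_integral_eq_lintegral_ofReal hi.1,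
    ← intervalIntegral.integral_of_le hab,
    intervalIntegral.integral_comp_sub_left (fun x => x ^ p), integral_rpow (Or.inl hp)]
  · rw [sub_self, Real.zero_rpow (by linarith), sub_zero]
  · refine (ae_restrict_iff' measurableSet_Ioc).2 (Eventually.of_forall fun x hx => ?_)
    exact Real.rpow_nonneg (sub_nonneg.2 hx.2) _

/-- Substitute `u = s + (t - s) r` in Euler's integral, where `1 - r (s - t)/s = u/s`. The point is
that `t` now occurs only as the upper limit of integration. -/
theorem molchanGolosovKernel_eq_integral {H s t : ℝ} (hH : 1 / 2 < H) (hs : 0 < s) (hst : s < t) :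
    molchanGolosovKernel H t s = molchanGolosovConst H * (H - 1 / 2) * s ^ (-(H - 1 / 2)) *
      ∫ u in s..t, (u - s) ^ (H - 1 / 2 - 1) * u ^ (H - 1 / 2) := by
  set β := H - 1 / 2 with hβ
  have hβ0 : 0 < β := by linarith
  have hts : 0 < t - s := sub_pos.2 hst
  have hg := isHypergeometricContinuation_integral (-β) hβ0 one_pos
  have hx : (s - t) / s < 1 := (div_neg_of_neg_of_pos (sub_neg.2 hst) hs).trans one_pos
  rw [molchanGolosovKernel, if_pos ⟨hs, hst⟩, show (1 : ℝ) / 2 - H = -β by simp [hβ],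
    show H + 1 / 2 = β + 1 by simp only [hβ]; ring, gaussHypergeometric_eq hg hx,
    integral_betaMeasure_one hβ0, ← integral_Ioc_eq_integral_Ioo,
    ← intervalIntegral.integral_of_le zero_le_one]
  have hsub := intervalIntegral.integral_comp_mul_add (a := 0) (b := 1)
    (fun u => (u - s) ^ (β - 1) * u ^ β) hts.ne' s
  simp only [mul_zero, zero_add, mul_one, sub_add_cancel, add_sub_cancel_right, smul_eq_mul] at hsub
  have hI : ∫ u in s..t, (u - s) ^ (β - 1) * u ^ β =
      (t - s) * ∫ r in (0 : ℝ)..1, ((t - s) * r) ^ (β - 1) * ((t - s) * r + s) ^ β := by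
    rw [hsub]; field_simp
  rw [hI, mul_assoc, mul_assoc, mul_assoc, ← hβ]
  congr 1
  rw [← intervalIntegral.integral_const_mul, ← intervalIntegral.integral_const_mul,
    ← intervalIntegral.integral_const_mul, ← intervalIntegral.integral_const_mul]
  refine intervalIntegral.integral_congr_ae (Eventually.of_forall fun r hr => ?_)
  rw [uIoc_of_le zero_le_one] at hr
  have e1 : 1 - (s - t) / s * r = ((t - s) * r + s) / s := by field_simp; ring
  have e2 : 0 < (t - s) * r + s := by have := hr.1; positivity
  rw [neg_neg, e1, Real.div_rpow e2.le hs.le, Real.mul_rpow hts.le hr.1.le, Real.rpow_sub_one hts.ne',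
    Real.rpow_neg hs.le]
  field_simp

/-- The Volterra kernel whose integral over `(t, t']` is the increment of the Molchan-Golosov kernel,
up to a constant. -/
def volterraKernel (β u s : ℝ) : ℝ≥0∞ :=
  if 0 < s ∧ s < u then ENNReal.ofReal (s ^ (-β) * (u - s) ^ (β - 1) * u ^ β) else 0

theorem intervalIntegrable_volterra {β s t : ℝ} (hβ : 0 < β) :
    IntervalIntegrable (fun u => (u - s) ^ (β - 1) * u ^ β) volume s t := by
  have h := (intervalIntegral.intervalIntegrable_rpow' (a := 0) (b := t - s) (r := β - 1)
    (by linarith)).comp_sub_right s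
  simp only [zero_add, sub_add_cancel] at h
  exact h.mul_continuousOn (Real.continuous_rpow_const hβ.le).continuousOn

theorem ofReal_integral_volterra {β s t t' : ℝ} (hβ : 0 < β) (hs : 0 < s) (hst : s ≤ t)
    (htt : t ≤ t') :
    ENNReal.ofReal (s ^ (-β) * ∫ u in t..t', (u - s) ^ (β - 1) * u ^ β) =
      ∫⁻ u in Ioc t t', volterraKernel β u s := by
  have hi : IntervalIntegrable (fun u => (u - s) ^ (β - 1) * u ^ β) volume t t' :=
    (intervalIntegrable_volterra (s := s) (t := t) hβ).symm.trans (intervalIntegrable_volterra hβ)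
  rw [← intervalIntegral.integral_const_mul, intervalIntegral.integral_of_le htt,
    ofReal_integral_eq_lintegral_ofReal (hi.1.const_mul _)]
  · refine setLIntegral_congr_fun measurableSet_Ioc fun u hu => ?_
    simp only [volterraKernel]
    rw [if_pos ⟨hs, hst.trans_lt hu.1⟩, mul_assoc]
  · refine (ae_restrict_iff' measurableSet_Ioc).2 (Eventually.of_forall fun u hu => ?_)
    have h1 : 0 ≤ u - s := by linarith [hu.1]
    have h2 : 0 ≤ u := by linarith
    have := Real.rpow_nonneg h1 (β - 1)
    have := Real.rpow_nonneg h2 β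
    have := Real.rpow_nonneg hs.le (-β)
    simp only [Pi.zero_apply]
    positivity

/-- If `s < t`, subtracting the two integrals leaves the one over `(t, t']`. If `t ≤ s < t'`, only
the later kernel is non-zero and its integral runs over `(s, t']`, part of `(t, t']`. -/
theorem enorm_molchanGolosovKernel_sub_le {H : ℝ} (hH : 1 / 2 < H) (hH1 : H < 1) {t t' : ℝ}
    (htt : t ≤ t') (s : ℝ) :
    ‖(Ioc 0 t').indicator (molchanGolosovKernel H t') s -
        (Ioc 0 t).indicator (molchanGolosovKernel H t) s‖ₑ ≤
      ENNReal.ofReal (molchanGolosovConst H * (H - 1 / 2)) *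
        ∫⁻ u in Ioc t t', volterraKernel (H - 1 / 2) u s := by
  have hβ : 0 < H - 1 / 2 := by linarith
  have hC : 0 < molchanGolosovConst H * (H - 1 / 2) :=
    mul_pos (molchanGolosovConst_pos (by linarith) hH1) hβ
  have hind : ∀ t : ℝ, (Ioc 0 t).indicator (molchanGolosovKernel H t) s =
      molchanGolosovKernel H t s := by
    intro t
    by_cases h : s ∈ Ioc 0 t
    · rw [indicator_of_mem h]
    · rw [indicator_of_notMem h, molchanGolosovKernel, if_neg fun hh => h ⟨hh.1, hh.2.le⟩]
  have hz : ∀ t : ℝ, ¬ (0 < s ∧ s < t) → molchanGolosovKernel H t s = 0 := fun t h => by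
    rw [molchanGolosovKernel, if_neg h]
  have hen : ∀ a b : ℝ, 0 ≤ a → 0 ≤ b → a = molchanGolosovConst H * (H - 1 / 2) * b →
      ‖a‖ₑ = ENNReal.ofReal (molchanGolosovConst H * (H - 1 / 2)) * ENNReal.ofReal b := by
    rintro a b ha hb rfl
    rw [Real.enorm_eq_ofReal ha, ENNReal.ofReal_mul hC.le]
  have hnn : ∀ t t', 0 < s → s ≤ t → t ≤ t' → 0 ≤ s ^ (-(H - 1 / 2)) *
      ∫ u in t..t', (u - s) ^ (H - 1 / 2 - 1) * u ^ (H - 1 / 2) := by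
    intro t t' hs hst htt
    refine mul_nonneg (Real.rpow_nonneg hs.le _) (intervalIntegral.integral_nonneg htt ?_)
    intro u hu
    exact mul_nonneg (Real.rpow_nonneg (by linarith [hu.1]) _)
      (Real.rpow_nonneg (by linarith [hu.1]) _)
  rw [hind, hind]
  by_cases h' : 0 < s ∧ s < t'
  swap
  · rw [hz t' h', hz t fun h => h' ⟨h.1, h.2.trans_le htt⟩]
    simp
  rcases lt_or_ge s t with hst | hst
  · have e : molchanGolosovKernel H t' s - molchanGolosovKernel H t s =
        molchanGolosovConst H * (H - 1 / 2) * (s ^ (-(H - 1 / 2)) *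
          ∫ u in t..t', (u - s) ^ (H - 1 / 2 - 1) * u ^ (H - 1 / 2)) := by
      rw [molchanGolosovKernel_eq_integral hH h'.1 h'.2, molchanGolosovKernel_eq_integral hH h'.1 hst,
        ← mul_sub, intervalIntegral.integral_interval_sub_left (intervalIntegrable_volterra hβ)
          (intervalIntegrable_volterra hβ), mul_assoc]
    have h3 := hnn t t' h'.1 hst.le htt
    rw [hen _ _ (by rw [e]; exact mul_nonneg hC.le h3) h3 e,
      ofReal_integral_volterra hβ h'.1 hst.le htt]
  · have e : molchanGolosovKernel H t' s - molchanGolosovKernel H t s =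
        molchanGolosovConst H * (H - 1 / 2) * (s ^ (-(H - 1 / 2)) *
          ∫ u in s..t', (u - s) ^ (H - 1 / 2 - 1) * u ^ (H - 1 / 2)) := by
      rw [molchanGolosovKernel_eq_integral hH h'.1 h'.2, hz t fun h => absurd h.2 (not_lt.2 hst)]
      ring
    have h3 := hnn s t' h'.1 le_rfl h'.2.le
    rw [hen _ _ (by rw [e]; exact mul_nonneg hC.le h3) h3 e,
      ofReal_integral_volterra hβ h'.1 le_rfl h'.2.le]
    gcongr

/-- Since `p ≤ 0`, replacing `s` by `max s t` increases the integrand; the interval that remains is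
no longer than `t' - t`. -/
theorem lintegral_volterra_weight_le {p t t' : ℝ} (hp : -1 < p) (hp0 : p ≤ 0)
    (s : ℝ) :
    ∫⁻ u in Ioc t t', (if s < u then ENNReal.ofReal ((u - s) ^ p) else 0) ≤
      ENNReal.ofReal ((t' - t) ^ (p + 1) / (p + 1)) := by
  set m := max s t
  rcases le_or_gt t' m with hm | hm
  · have : ∀ u ∈ Ioc t t', (if s < u then ENNReal.ofReal ((u - s) ^ p) else 0) = 0 := by
      intro u hu
      rw [if_neg]
      intro hsu
      have : m < u := max_lt hsu hu.1
      linarith [hu.2]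
    rw [setLIntegral_congr_fun measurableSet_Ioc this]
    simp
  · have h1 : ∫⁻ u in Ioc t t', (if s < u then ENNReal.ofReal ((u - s) ^ p) else 0) ≤
        ∫⁻ u in Ioc m t', ENNReal.ofReal ((u - m) ^ p) := by
      rw [← lintegral_indicator measurableSet_Ioc, ← lintegral_indicator measurableSet_Ioc]
      refine lintegral_mono fun u => ?_
      by_cases hu : u ∈ Ioc t t'
      · rw [indicator_of_mem hu]
        split_ifs with hsu
        · have hmu : m < u := max_lt hsu hu.1
          rw [indicator_of_mem (show u ∈ Ioc m t' from ⟨hmu, hu.2⟩)]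
          exact ENNReal.ofReal_le_ofReal (Real.rpow_le_rpow_of_nonpos (sub_pos.2 hmu)
            (sub_le_sub_left (le_max_left _ _) _) hp0)
        · exact zero_le
      · rw [indicator_of_notMem hu]
        exact zero_le
    refine h1.trans ?_
    rw [← Measure.restrict_congr_set Ioo_ae_eq_Ioc, lintegral_Ioo_sub_rpow hm.le hp]
    refine ENNReal.ofReal_le_ofReal ?_
    have hp1 : 0 < p + 1 := by linarith
    gcongr
    exact le_max_right _ _

/-- Only one factor is singular on each side of `u/2`, and the other is bounded by its value at
`u/2`. The `4` majorises `2^(1-ε)` and `2^(2β)`. -/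
theorem lintegral_beta_weight_le {β ε u : ℝ} (hβ : 0 < β) (hβ1 : β < 1 / 2) (hε : 0 < ε)
    (hε1 : ε < 1) (hu : 0 < u) :
    ∫⁻ s in Ioo 0 u, ENNReal.ofReal (s ^ (-(2 * β)) * u ^ (2 * β) * (u - s) ^ (-1 + ε)) ≤
      ENNReal.ofReal (4 * (1 / (1 - 2 * β) + 1 / ε) * u ^ ε) := by
  have hu2 : 0 < u / 2 := by positivity
  have hpt : ∀ s ∈ Ioo 0 u, s ^ (-(2 * β)) * u ^ (2 * β) * (u - s) ^ (-1 + ε) ≤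
      u ^ (2 * β) * (u / 2) ^ (-1 + ε) * (s - 0) ^ (-(2 * β)) +
        u ^ (2 * β) * (u / 2) ^ (-(2 * β)) * (u - s) ^ (-1 + ε) := by
    intro s hs
    rw [sub_zero]
    have p1 := Real.rpow_pos_of_pos hs.1 (-(2 * β))
    have p2 := Real.rpow_pos_of_pos (sub_pos.2 hs.2) (-1 + ε)
    have p3 := Real.rpow_pos_of_pos hu (2 * β)
    have p4 := Real.rpow_pos_of_pos hu2 (-1 + ε)
    have p5 := Real.rpow_pos_of_pos hu2 (-(2 * β))
    rcases le_total s (u / 2) with h | h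
    · have : (u - s) ^ (-1 + ε) ≤ (u / 2) ^ (-1 + ε) :=
        Real.rpow_le_rpow_of_nonpos hu2 (by linarith) (by linarith)
      calc s ^ (-(2 * β)) * u ^ (2 * β) * (u - s) ^ (-1 + ε)
          ≤ s ^ (-(2 * β)) * u ^ (2 * β) * (u / 2) ^ (-1 + ε) := by gcongr
        _ = u ^ (2 * β) * (u / 2) ^ (-1 + ε) * s ^ (-(2 * β)) := by ring
        _ ≤ _ := le_add_of_nonneg_right (by positivity)
    · have : s ^ (-(2 * β)) ≤ (u / 2) ^ (-(2 * β)) :=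
        Real.rpow_le_rpow_of_nonpos hu2 h (by linarith)
      calc s ^ (-(2 * β)) * u ^ (2 * β) * (u - s) ^ (-1 + ε)
          ≤ (u / 2) ^ (-(2 * β)) * u ^ (2 * β) * (u - s) ^ (-1 + ε) := by gcongr
        _ = u ^ (2 * β) * (u / 2) ^ (-(2 * β)) * (u - s) ^ (-1 + ε) := by ring
        _ ≤ _ := le_add_of_nonneg_left (by positivity)
  have hA : 0 ≤ u ^ (2 * β) * (u / 2) ^ (-1 + ε) := by positivity
  have hB : 0 ≤ u ^ (2 * β) * (u / 2) ^ (-(2 * β)) := by positivity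
  have h2β : 0 < 1 - 2 * β := by linarith
  calc ∫⁻ s in Ioo 0 u, ENNReal.ofReal (s ^ (-(2 * β)) * u ^ (2 * β) * (u - s) ^ (-1 + ε))
      ≤ ∫⁻ s in Ioo 0 u, (ENNReal.ofReal (u ^ (2 * β) * (u / 2) ^ (-1 + ε)) *
          ENNReal.ofReal ((s - 0) ^ (-(2 * β))) +
        ENNReal.ofReal (u ^ (2 * β) * (u / 2) ^ (-(2 * β))) *
          ENNReal.ofReal ((u - s) ^ (-1 + ε))) := by
        refine setLIntegral_mono' measurableSet_Ioo fun s hs => ?_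
        rw [← ENNReal.ofReal_mul hA, ← ENNReal.ofReal_mul hB]
        exact (ENNReal.ofReal_le_ofReal (hpt s hs)).trans ENNReal.ofReal_add_le
    _ = ENNReal.ofReal (u ^ (2 * β) * (u / 2) ^ (-1 + ε) * (u ^ (1 - 2 * β) / (1 - 2 * β)) +
          u ^ (2 * β) * (u / 2) ^ (-(2 * β)) * (u ^ ε / ε)) := by
        rw [lintegral_add_left (by fun_prop), lintegral_const_mul _ (by fun_prop),
          lintegral_const_mul _ (by fun_prop), lintegral_Ioo_sub_rpow hu.le (by linarith),
          lintegral_Ioo_rsub_rpow hu.le (by linarith), ← ENNReal.ofReal_mul hA,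
          ← ENNReal.ofReal_mul hB, sub_zero, show -(2 * β) + 1 = 1 - 2 * β by ring,
          show -1 + ε + 1 = ε by ring, ← ENNReal.ofReal_add (by positivity) (by positivity)]
    _ ≤ _ := by
        refine ENNReal.ofReal_le_ofReal ?_
        have d1 : u ^ (2 * β) * (u / 2) ^ (-1 + ε) * u ^ (1 - 2 * β) =
            2 ^ (1 - ε) * u ^ ε := by
          rw [Real.div_rpow hu.le two_pos.le, div_eq_mul_inv, ← Real.rpow_neg two_pos.le,
            show -(-1 + ε) = 1 - ε by ring]
          have : u ^ (2 * β) * u ^ (-1 + ε) * u ^ (1 - 2 * β) = u ^ ε := by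
            rw [← Real.rpow_add hu, ← Real.rpow_add hu]; congr 1; ring
          linear_combination (2 : ℝ) ^ (1 - ε) * this
        have d2 : u ^ (2 * β) * (u / 2) ^ (-(2 * β)) = 2 ^ (2 * β) := by
          rw [Real.div_rpow hu.le two_pos.le, div_eq_mul_inv, ← Real.rpow_neg two_pos.le,
            show -(-(2 * β)) = 2 * β by ring]
          have : u ^ (2 * β) * u ^ (-(2 * β)) = 1 := by
            rw [← Real.rpow_add hu, add_neg_cancel, Real.rpow_zero]
          linear_combination (2 : ℝ) ^ (2 * β) * this
        have d3 : (2 : ℝ) ^ (1 - ε) ≤ 4 := by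
          calc (2 : ℝ) ^ (1 - ε) ≤ 2 ^ (2 : ℝ) :=
                Real.rpow_le_rpow_of_exponent_le one_le_two (by linarith)
            _ = 4 := by norm_num
        have d4 : (2 : ℝ) ^ (2 * β) ≤ 4 := by
          calc (2 : ℝ) ^ (2 * β) ≤ 2 ^ (2 : ℝ) :=
                Real.rpow_le_rpow_of_exponent_le one_le_two (by linarith)
            _ = 4 := by norm_num
        have hue := Real.rpow_pos_of_pos hu ε
        calc _ = 2 ^ (1 - ε) * u ^ ε / (1 - 2 * β) + 2 ^ (2 * β) * u ^ ε / ε := by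
              rw [← d1, ← d2]; ring
          _ ≤ 4 * u ^ ε / (1 - 2 * β) + 4 * u ^ ε / ε := by gcongr
          _ = _ := by ring

/-- The squared `L²` norm of the increments of the Molchan-Golosov kernel, up to an arbitrarily
small loss in the exponent. -/
theorem lintegral_volterra_sq_le {β ε : ℝ} (hβ : 0 < β) (hβ1 : β < 1 / 2) (hε : 0 < ε)
    (hε1 : ε < 2 * β) {t t' T : ℝ} (ht : 0 ≤ t) (htt : t ≤ t') (hT : t' ≤ T) :
    ∫⁻ s, (∫⁻ u in Ioc t t', volterraKernel β u s) ^ 2 ≤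
      ENNReal.ofReal (4 * (1 / (1 - 2 * β) + 1 / ε) * T ^ ε / (2 * β - ε) *
        (t' - t) ^ (2 * β - ε + 1)) := by
  -- The kernel is split as `b^(1/2) a^(1/2)` for Cauchy-Schwarz in `u`. The integral of `b` in `u`
  -- gives `(t'-t)^(2β-ε)`, that of `a` in `s` is `O(u^ε)`, and the remaining integration in `u`
  -- adds one power of `t' - t`. The loss `ε` makes `(u-s)^(-1+ε)` integrable in `s`.
  set a : ℝ → ℝ → ℝ≥0∞ := fun u s => if 0 < s ∧ s < u then
    ENNReal.ofReal (s ^ (-(2 * β)) * u ^ (2 * β) * (u - s) ^ (-1 + ε)) else 0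
  set b : ℝ → ℝ → ℝ≥0∞ := fun u s => if s < u then ENNReal.ofReal ((u - s) ^ (2 * β - ε - 1)) else 0
  have hbm : ∀ s, Measurable fun u => b u s := fun s =>
    Measurable.ite (measurableSet_lt measurable_const measurable_id) (by fun_prop) measurable_const
  have ham : Measurable fun p : ℝ × ℝ => a p.1 p.2 := by
    refine Measurable.ite ?_ (by fun_prop) measurable_const
    exact MeasurableSet.inter
      (measurableSet_lt (f := fun _ : ℝ × ℝ => (0 : ℝ)) (g := Prod.snd) (by fun_prop) (by fun_prop))
      (measurableSet_lt (f := (Prod.snd : ℝ × ℝ → ℝ)) (g := Prod.fst) (by fun_prop) (by fun_prop))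
  have hfac : ∀ u s, volterraKernel β u s ≤ (b u s) ^ (1 / 2 : ℝ) * (a u s) ^ (1 / 2 : ℝ) := by
    intro u s
    by_cases h : 0 < s ∧ s < u
    · simp only [volterraKernel, a, b, if_pos h, if_pos h.2]
      have hu : 0 < u := h.1.trans h.2
      have hus : 0 < u - s := sub_pos.2 h.2
      have e1 := Real.rpow_pos_of_pos h.1 (-(2 * β))
      have e2 := Real.rpow_pos_of_pos hu (2 * β)
      have e3 := Real.rpow_pos_of_pos hus (-1 + ε)
      have e4 := Real.rpow_pos_of_pos hus (2 * β - ε - 1)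
      rw [ENNReal.ofReal_rpow_of_pos e4, ENNReal.ofReal_rpow_of_pos (by positivity),
        ← ENNReal.ofReal_mul (by positivity)]
      refine ENNReal.ofReal_le_ofReal (le_of_eq ?_)
      rw [Real.mul_rpow (by positivity) e3.le, Real.mul_rpow e1.le e2.le, ← Real.rpow_mul h.1.le,
        ← Real.rpow_mul hu.le, ← Real.rpow_mul hus.le, ← Real.rpow_mul hus.le]
      have e5 : (u - s) ^ (β - 1) =
          (u - s) ^ ((2 * β - ε - 1) * (1 / 2)) * (u - s) ^ ((-1 + ε) * (1 / 2)) := by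
        rw [← Real.rpow_add hus]; congr 1; ring
      rw [e5, show -(2 * β) * (1 / 2) = -β by ring, show 2 * β * (1 / 2) = β by ring]
      ring
    · simp [volterraKernel, if_neg h]
  have hCS : ∀ s, (∫⁻ u in Ioc t t', volterraKernel β u s) ^ 2 ≤
      ENNReal.ofReal ((t' - t) ^ (2 * β - ε) / (2 * β - ε)) * ∫⁻ u in Ioc t t', a u s := by
    intro s
    have ham' : Measurable fun u => a u s := ham.comp (by fun_prop : Measurable fun u : ℝ => (u, s))
    have h1 := ENNReal.lintegral_mul_le_Lp_mul_Lq (volume.restrict (Ioc t t'))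
      (p := 2) (q := 2) (by constructor <;> norm_num)
      ((hbm s).pow_const (1 / 2 : ℝ)).aemeasurable (ham'.pow_const (1 / 2 : ℝ)).aemeasurable
    simp only [Pi.mul_apply, ← ENNReal.rpow_mul] at h1
    norm_num at h1
    have h2 : ∫⁻ u in Ioc t t', volterraKernel β u s ≤
        (∫⁻ u in Ioc t t', b u s) ^ (1 / 2 : ℝ) * (∫⁻ u in Ioc t t', a u s) ^ (1 / 2 : ℝ) := by
      refine (lintegral_mono fun u => hfac u s).trans ?_
      simpa using h1
    calc (∫⁻ u in Ioc t t', volterraKernel β u s) ^ 2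
        ≤ ((∫⁻ u in Ioc t t', b u s) ^ (1 / 2 : ℝ) *
            (∫⁻ u in Ioc t t', a u s) ^ (1 / 2 : ℝ)) ^ 2 := by gcongr
      _ = (∫⁻ u in Ioc t t', b u s) * (∫⁻ u in Ioc t t', a u s) := by
          rw [mul_pow, ← ENNReal.rpow_natCast, ← ENNReal.rpow_mul, ← ENNReal.rpow_natCast,
            ← ENNReal.rpow_mul]
          norm_num
      _ ≤ _ := by
          gcongr
          have := lintegral_volterra_weight_le (p := 2 * β - ε - 1) (t := t)
            (t' := t') (by linarith) (by linarith) s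
          rwa [sub_add_cancel] at this
  have hpos : 0 < 2 * β - ε := by linarith
  have h1β : 0 < 1 - 2 * β := by linarith
  have hT0 : 0 ≤ T := by linarith
  have hinner : ∀ u ∈ Ioc t t', ∫⁻ s, a u s ≤
      ENNReal.ofReal (4 * (1 / (1 - 2 * β) + 1 / ε) * T ^ ε) := by
    intro u hu
    have hu0 : 0 < u := ht.trans_lt hu.1
    have e : ∫⁻ s, a u s = ∫⁻ s in Ioo 0 u,
        ENNReal.ofReal (s ^ (-(2 * β)) * u ^ (2 * β) * (u - s) ^ (-1 + ε)) := by
      rw [← lintegral_indicator measurableSet_Ioo]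
      refine lintegral_congr fun s => ?_
      simp only [a, indicator, mem_Ioo]
    rw [e]
    refine (lintegral_beta_weight_le hβ hβ1 hε (by linarith) hu0).trans
      (ENNReal.ofReal_le_ofReal ?_)
    have := hu.2.trans hT
    gcongr
  calc ∫⁻ s, (∫⁻ u in Ioc t t', volterraKernel β u s) ^ 2
      ≤ ∫⁻ s, ENNReal.ofReal ((t' - t) ^ (2 * β - ε) / (2 * β - ε)) * ∫⁻ u in Ioc t t', a u s :=
        lintegral_mono hCS
    _ = ENNReal.ofReal ((t' - t) ^ (2 * β - ε) / (2 * β - ε)) *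
          ∫⁻ u in Ioc t t', ∫⁻ s, a u s := by
        rw [lintegral_const_mul' _ _ ENNReal.ofReal_ne_top, lintegral_lintegral_swap]
        exact (ham.comp measurable_swap).aemeasurable
    _ ≤ ENNReal.ofReal ((t' - t) ^ (2 * β - ε) / (2 * β - ε)) *
          ∫⁻ _ in Ioc t t', ENNReal.ofReal (4 * (1 / (1 - 2 * β) + 1 / ε) * T ^ ε) := by
        gcongr 1
        exact setLIntegral_mono' measurableSet_Ioc hinner
    _ = _ := by
        have htt0 : 0 ≤ t' - t := sub_nonneg.2 htt
        rw [setLIntegral_const, Real.volume_Ioc, ← ENNReal.ofReal_mul (by positivity),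
          ← ENNReal.ofReal_mul (by positivity), Real.rpow_add_one' htt0 (by linarith)]
        congr 1
        ring

/-! ### Anti-concentration -/

/-- Where `|N y| ≤ 1`, both sides are quadratic: `1 - cos y ≤ y²/2` and `1 - cos(N y) ≥ (N y)²/6`,
as `π² ≤ 12`. After taking expectations, closeness of the characteristic function to `1` at the high
frequency forces mass on `|y| > 1/N`. -/
theorem one_sub_cos_le_add_ite {N : ℝ} (hN : 1 ≤ N) (y : ℝ) :
    1 - Real.cos y ≤ 3 / N ^ 2 * (1 - Real.cos (N * y)) + if 1 / N < |y| then 2 else 0 := by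
  have hN0 : 0 < N := by linarith
  have h1 : 0 ≤ 3 / N ^ 2 * (1 - Real.cos (N * y)) :=
    mul_nonneg (by positivity) (sub_nonneg.2 (Real.cos_le_one _))
  split_ifs with h
  · have := Real.neg_one_le_cos y
    linarith
  · have hy : |N * y| ≤ 1 := by
      rw [abs_mul, abs_of_pos hN0, mul_comm, ← le_div_iff₀ hN0]
      exact not_lt.1 h
    have h2 := Real.cos_le_one_sub_mul_cos_sq (hy.trans (by linarith [Real.pi_gt_three]))
    have h3 := Real.one_sub_sq_div_two_le_cos (x := y)
    have hpi : Real.pi ^ 2 ≤ 12 := by nlinarith [Real.pi_lt_d2, Real.pi_pos]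
    have h4 : 1 / 6 * (N * y) ^ 2 ≤ 2 / Real.pi ^ 2 * (N * y) ^ 2 := by
      refine mul_le_mul_of_nonneg_right ?_ (sq_nonneg _)
      rw [div_le_div_iff₀ (by norm_num) (by positivity)]
      linarith
    have h5 : 3 / N ^ 2 * (1 / 6 * (N * y) ^ 2) ≤ 3 / N ^ 2 * (1 - Real.cos (N * y)) := by
      gcongr
      linarith
    have h6 : 3 / N ^ 2 * (1 / 6 * (N * y) ^ 2) = y ^ 2 / 2 := by field_simp; ring
    linarith

/-- A random variable of small variance whose characteristic function is close to `1` at high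
frequencies, but not too close at frequency `η / ρ`, is not concentrated on intervals of length
comparable to `ρ`. -/
theorem exists_anticoncentration {κ₀ Γ η C : ℝ} (hκ₀ : 0 < κ₀) (hΓ : 0 < Γ) (hη : 0 < η)
    (hC : 0 ≤ C) {K : ℝ → ℝ} (hK : ∀ κ, 0 ≤ K κ) :
    ∃ c ε₀ h₀ : ℝ, 0 < c ∧ 0 < ε₀ ∧ 0 < h₀ ∧ ∀ {Ω : Type*} [MeasurableSpace Ω] (P : Measure Ω)
      [IsProbabilityMeasure P] {A : Ω → ℝ} (_ : Measurable A) {h ρ V : ℝ}, 0 < h → h ≤ h₀ → 0 < ρ →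
      V ≤ Γ * h * ρ ^ 2 → ∫⁻ ω, ‖A ω‖ₑ ^ 2 ∂P ≤ ENNReal.ofReal (2 * C * V) →
      (∀ κ, 0 < κ → ∀ u : ℝ, ‖∫ ω, Complex.exp (Complex.I * u * A ω) ∂P - 1‖ ≤
        κ * u ^ 2 * V + K κ * h) →
      κ₀ * h ≤ ∫ ω, (1 - Real.cos (η / ρ * A ω)) ∂P →
      ∀ b : ℝ, P {ω | |A ω + b| ≤ ε₀ * ρ} ≤ ENNReal.ofReal (1 - c * h) := by
  -- At frequency `N η / ρ`, this `κ` makes the quadratic error exactly `κ₀ h / 4` after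
  -- multiplication by `3 / N²`, whatever `N` is. Then `N` is taken so large that the constant error
  -- is also at most `κ₀ h / 4`, and `ε₀` is such that `|η A / ρ| > 1 / N` means `|A| > 3 ε₀ ρ`.
  set κ : ℝ := κ₀ / (12 * η ^ 2 * Γ) with hκ
  have hκ0 : 0 < κ := by positivity
  set N : ℝ := 1 + 12 * K κ / κ₀ with hN
  have hN1 : 1 ≤ N := by have := hK κ; rw [hN]; have : 0 ≤ 12 * K κ / κ₀ := by positivity
                         linarith
  have hN0 : 0 < N := by linarith
  set ε₀ : ℝ := 1 / (3 * N * η) with hε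
  have hε0 : 0 < ε₀ := by positivity
  -- The first bound on `h` keeps `1 - c h ≥ 1/2`; the second keeps the Chebyshev bound `2 C Γ h /
  -- ε₀²` at most `1/2`.
  refine ⟨κ₀ / 4, ε₀, min (2 / κ₀) (ε₀ ^ 2 / (4 * C * Γ + 1)), by positivity, hε0, by positivity, ?_⟩
  intro Ω _ P _ A hA h ρ V hh hh₀ hρ hV hA2 hAκ hlow b
  have hh1 : κ₀ / 4 * h ≤ 1 / 2 := by
    have := hh₀.trans (min_le_left _ _)
    rw [le_div_iff₀ hκ₀] at this
    linarith
  have hh2 : h * (4 * C * Γ + 1) ≤ ε₀ ^ 2 := by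
    have := hh₀.trans (min_le_right _ _)
    rwa [le_div_iff₀ (by positivity)] at this
  have hbig : κ₀ / 4 * h ≤ P.real {ω | 3 * (ε₀ * ρ) < |A ω|} := by
    have hset : {ω | 3 * (ε₀ * ρ) < |A ω|} = {ω | 1 / N < |η / ρ * A ω|} := by
      ext ω
      simp only [mem_ofPred_eq]
      have e : 1 / N = 3 * (ε₀ * ρ) * (η / ρ) := by rw [hε]; field_simp
      rw [abs_mul, abs_of_pos (div_pos hη hρ), mul_comm (η / ρ), e]
      exact (mul_lt_mul_iff_left₀ (div_pos hη hρ)).symm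
    have hm : MeasurableSet {ω | 1 / N < |η / ρ * A ω|} :=
      measurableSet_lt measurable_const (by fun_prop)
    have hcos : ∀ u : ℝ, Integrable (fun ω => 1 - Real.cos (u * A ω)) P := fun u =>
      (integrable_const 1).sub (Integrable.of_bound (by fun_prop) 1
        (Eventually.of_forall fun ω => Real.abs_cos_le_one _))
    have hind : Integrable ({ω | 1 / N < |η / ρ * A ω|}.indicator fun _ => (2 : ℝ)) P :=
      (integrable_const 2).indicator hm
    have h1 : ∫ ω, (1 - Real.cos (η / ρ * A ω)) ∂P ≤
        ∫ ω, (3 / N ^ 2 * (1 - Real.cos (N * η / ρ * A ω)) +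
          {ω | 1 / N < |η / ρ * A ω|}.indicator (fun _ => (2 : ℝ)) ω) ∂P := by
      refine integral_mono (hcos _) (((hcos _).const_mul _).add hind) fun ω => ?_
      have := one_sub_cos_le_add_ite hN1 (η / ρ * A ω)
      rw [← mul_assoc, ← mul_div_assoc] at this
      exact this
    rw [integral_add ((hcos _).const_mul _) hind, integral_const_mul, integral_indicator_const _ hm,
      smul_eq_mul] at h1
    have h2 := (integral_one_sub_cos_le hA (N * η / ρ)).trans (hAκ κ hκ0 (N * η / ρ))
    have h3 : 3 / N ^ 2 * (κ * (N * η / ρ) ^ 2 * V + K κ * h) ≤ κ₀ / 2 * h := by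
      have e1 : 3 / N ^ 2 * (κ * (N * η / ρ) ^ 2 * V) ≤ κ₀ / 4 * h := by
        calc 3 / N ^ 2 * (κ * (N * η / ρ) ^ 2 * V)
            ≤ 3 / N ^ 2 * (κ * (N * η / ρ) ^ 2 * (Γ * h * ρ ^ 2)) := by gcongr
          _ = κ₀ / 4 * h := by rw [hκ]; field_simp; norm_num
      have e2 : 3 / N ^ 2 * (K κ * h) ≤ κ₀ / 4 * h := by
        rw [← mul_assoc]
        gcongr
        rw [div_mul_eq_mul_div, div_le_iff₀ (by positivity)]
        have e3 : 12 * K κ ≤ κ₀ * N := by rw [hN]; field_simp; linarith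
        have e4 : N ≤ N ^ 2 := by nlinarith
        nlinarith
      rw [mul_add]
      linarith
    have h4 : 3 / N ^ 2 * ∫ ω, (1 - Real.cos (N * η / ρ * A ω)) ∂P ≤ κ₀ / 2 * h :=
      (mul_le_mul_of_nonneg_left h2 (by positivity)).trans h3
    rw [hset]
    linarith
  -- A small shift cannot compensate the event `|A| > 3 ε₀ ρ`. A large shift would have to be
  -- cancelled by `|A| ≥ ε₀ ρ`, which the variance makes unlikely.
  rcases le_or_gt |b| (2 * (ε₀ * ρ)) with hb | hb
  · have hm : MeasurableSet {ω | 3 * (ε₀ * ρ) < |A ω|} := measurableSet_lt measurable_const (by fun_prop)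
    have hsub : {ω | |A ω + b| ≤ ε₀ * ρ} ⊆ {ω | 3 * (ε₀ * ρ) < |A ω|}ᶜ := by
      intro ω hω
      simp only [mem_ofPred_eq, mem_compl_iff, not_lt] at hω ⊢
      have := abs_sub_abs_le_abs_sub (A ω) (-b)
      rw [sub_neg_eq_add, abs_neg] at this
      linarith
    refine (measure_mono hsub).trans ?_
    rw [← ofReal_measureReal (measure_ne_top _ _), probReal_compl_eq_one_sub hm]
    exact ENNReal.ofReal_le_ofReal (by linarith)
  · have hR : 0 < ε₀ * ρ := by positivity
    have hsub : {ω | |A ω + b| ≤ ε₀ * ρ} ⊆ {ω | ENNReal.ofReal ((ε₀ * ρ) ^ 2) ≤ ‖A ω‖ₑ ^ 2} := by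
      intro ω hω
      simp only [mem_ofPred_eq] at hω ⊢
      rw [Real.enorm_eq_ofReal_abs, ← ENNReal.ofReal_pow (abs_nonneg _)]
      refine ENNReal.ofReal_le_ofReal (pow_le_pow_left₀ hR.le ?_ 2)
      have := abs_sub_abs_le_abs_sub b (A ω + b)
      rw [show b - (A ω + b) = -A ω by ring, abs_neg] at this
      linarith
    have h0 : ENNReal.ofReal ((ε₀ * ρ) ^ 2) ≠ 0 := by
      rw [Ne, ENNReal.ofReal_eq_zero, not_le]; positivity
    refine (measure_mono hsub).trans ((meas_ge_le_lintegral_div (by fun_prop) h0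
      ENNReal.ofReal_ne_top).trans ((ENNReal.div_le_div_right hA2 _).trans ?_))
    rw [← ENNReal.ofReal_div_of_pos (by positivity)]
    refine ENNReal.ofReal_le_ofReal ?_
    rw [div_le_iff₀ (by positivity)]
    have e1 : 2 * C * V ≤ 2 * C * (Γ * h * ρ ^ 2) := by gcongr
    have e2 : 2 * C * (Γ * h * ρ ^ 2) ≤ 1 / 2 * (ε₀ * ρ) ^ 2 := by
      have : 4 * C * Γ * h ≤ ε₀ ^ 2 := by linarith
      have := mul_le_mul_of_nonneg_right this (sq_nonneg ρ)
      rw [mul_pow]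
      linarith
    have e3 : 1 / 2 * (ε₀ * ρ) ^ 2 ≤ (1 - κ₀ / 4 * h) * (ε₀ * ρ) ^ 2 := by
      gcongr
      linarith
    linarith

/-! ### Lévy sums over one short block -/

section Block

variable {Ω : Type*} [MeasurableSpace Ω] {P : Measure Ω} [IsProbabilityMeasure P]
  {L : ℝ≥0 → Ω → ℝ} {γ : ℝ} {ν : Measure ℝ}

/-- Half of the block, on which the kernel `f` is comparable to `ρ`, already gives the required
order `h`. Since `g` is only `L²` close to `f`, the places where it is not comparable are paid for
by the squared distance. -/
theorem re_integral_levyExponent_le (hν : IsLevyMeasure ν) {c v₀ c₁ c₂ : ℝ} (hc : 0 < c)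
    (hv₀ : 0 < v₀) (hc₁ : 0 < c₁) (hc₂ : 0 < c₂)
    (hψ : ∀ u, |u| ≤ v₀ → c * u ^ 2 ≤ -(levyExponent γ 0 ν u).re)
    {q : ℕ → ℝ≥0} (hq : Monotone q) {g f : ℝ → ℝ} (hg : IsConstOnCells q g) {a b : ℕ} (hab : a ≤ b)
    {h ρ : ℝ} (hh : 0 < h) (hqh : (q b : ℝ) = q a + h) (hρ : 0 < ρ)
    (hf : ∀ s ∈ Ioc (q a : ℝ) (q a + h / 2), c₁ * ρ ≤ f s ∧ f s ≤ c₂ * ρ)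
    (hgf : IntervalIntegrable (fun s => (g s - f s) ^ 2) volume (q a) (q b))
    (hD : ∫ s in (q a : ℝ)..(q b : ℝ), (g s - f s) ^ 2 ≤ (c₁ * ρ) ^ 2 * h / 16) :
    (∫ s in (q a : ℝ)..(q b : ℝ), levyExponent γ 0 ν (v₀ / (c₂ + c₁) / ρ * g s)).re ≤
      -(c * (v₀ / (c₂ + c₁)) ^ 2 * c₁ ^ 2 / 16 * h) := by
  set η := v₀ / (c₂ + c₁) with hη
  have hη0 : 0 < η := by positivity
  set K := c * η ^ 2 * c₁ ^ 2 / 4 with hK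
  have hK0 : 0 < K := by positivity
  have hqab : (q a : ℝ) ≤ q b := by exact_mod_cast hq hab
  set J : Set ℝ := Ioc (q a : ℝ) (q a + h / 2)
  -- If `|g - f| ≤ c₁ρ/2`, then `η g / ρ` lies in `(0, v₀]` and the quadratic lower bound gives `K`.
  -- Otherwise the subtracted term is at least `K`. Integration yields `K h/2 - K h/4`.
  have hpt : ∀ s, K * J.indicator (fun _ => (1 : ℝ)) s - K * (4 / (c₁ * ρ) ^ 2) * (g s - f s) ^ 2 ≤
      -(levyExponent γ 0 ν (η / ρ * g s)).re := by
    intro s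
    have hre := hν.levyExponent_re_nonpos γ (η / ρ * g s)
    have hsq : 0 ≤ K * (4 / (c₁ * ρ) ^ 2) * (g s - f s) ^ 2 := by positivity
    by_cases hs : s ∈ J
    · rw [indicator_of_mem hs, mul_one]
      obtain ⟨hf1, hf2⟩ := hf s hs
      rcases le_or_gt |g s - f s| (c₁ * ρ / 2) with hd | hd
      · have hd' := abs_le.1 hd
        have hg1 : c₁ * ρ / 2 ≤ g s := by linarith
        have hg2 : g s ≤ (c₂ + c₁) * ρ := by nlinarith
        have hg0 : 0 < g s := lt_of_lt_of_le (by positivity) hg1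
        have hle : |η / ρ * g s| ≤ v₀ := by
          rw [abs_of_pos (by positivity)]
          calc η / ρ * g s ≤ η / ρ * ((c₂ + c₁) * ρ) := by gcongr
            _ = v₀ := by rw [hη]; field_simp
        have h1 := hψ _ hle
        have h2 : K ≤ c * (η / ρ * g s) ^ 2 := by
          calc K = c * (η / ρ * (c₁ * ρ / 2)) ^ 2 := by rw [hK]; field_simp; norm_num
            _ ≤ _ := by gcongr
        linarith
      · have h1 : (c₁ * ρ / 2) ^ 2 ≤ (g s - f s) ^ 2 := by
          rw [← sq_abs (g s - f s)]
          exact pow_le_pow_left₀ (by positivity) hd.le 2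
        have h2 : K ≤ K * (4 / (c₁ * ρ) ^ 2) * (g s - f s) ^ 2 := by
          calc K = K * (4 / (c₁ * ρ) ^ 2) * (c₁ * ρ / 2) ^ 2 := by field_simp; norm_num
            _ ≤ _ := by gcongr
        linarith
    · rw [indicator_of_notMem hs, mul_zero]
      linarith
  have hψi := hg.intervalIntegrable hq (fun x => levyExponent γ 0 ν (η / ρ * x)) hab
  have hre : (∫ s in (q a : ℝ)..(q b : ℝ), levyExponent γ 0 ν (η / ρ * g s)).re =
      ∫ s in (q a : ℝ)..(q b : ℝ), (levyExponent γ 0 ν (η / ρ * g s)).re := by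
    rw [intervalIntegral.integral_of_le hqab, intervalIntegral.integral_of_le hqab]
    exact (integral_re hψi.1).symm
  have hJi : IntervalIntegrable (J.indicator fun _ => (1 : ℝ)) volume (q a) (q b) := by
    rw [intervalIntegrable_iff_integrableOn_Ioc_of_le hqab]
    exact (integrableOn_const (by simp)).indicator measurableSet_Ioc
  have hJint : ∫ s in (q a : ℝ)..(q b : ℝ), J.indicator (fun _ => (1 : ℝ)) s = h / 2 := by
    rw [intervalIntegral.integral_of_le hqab, setIntegral_indicator measurableSet_Ioc,
      inter_eq_right.2 (Ioc_subset_Ioc_right (by rw [hqh]; linarith)), setIntegral_const]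
    rw [Real.volume_real_Ioc_of_le (by linarith)]
    simp
  have hmono := intervalIntegral.integral_mono_on hqab ((hJi.const_mul K).sub
    (hgf.const_mul (K * (4 / (c₁ * ρ) ^ 2))))
    (hg.intervalIntegrable hq (fun x => -(levyExponent γ 0 ν (η / ρ * x)).re) hab)
    fun s _ => hpt s
  rw [intervalIntegral.integral_sub (hJi.const_mul K) (hgf.const_mul _),
    intervalIntegral.integral_const_mul, intervalIntegral.integral_const_mul, hJint,
    intervalIntegral.integral_neg, ← hre] at hmono
  have h1 : K * (4 / (c₁ * ρ) ^ 2) * ∫ s in (q a : ℝ)..(q b : ℝ), (g s - f s) ^ 2 ≤ K * h / 4 := by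
    calc _ ≤ K * (4 / (c₁ * ρ) ^ 2) * ((c₁ * ρ) ^ 2 * h / 16) := by gcongr
      _ = K * h / 4 := by field_simp; norm_num
  have h2 : c * η ^ 2 * c₁ ^ 2 / 16 * h = K * h / 4 := by rw [hK]; ring
  rw [h2]
  linarith

/-- Anti-concentration of sums over increments in a short interval. -/
theorem exists_incrementSum_anticoncentration (hL : IsLevyProcess P L)
    (ht : HasLevyTriplet P L γ 0 ν) (hL2 : MemLp (L 1) 2 P) (hL0 : ∫ ω, L 1 ω ∂P = 0)
    (hne : ¬ ∀ᵐ ω ∂P, L 1 ω = 0) {c₁ c₂ Γ : ℝ} (hc₁ : 0 < c₁) (hc₂ : 0 < c₂) (hΓ : 0 < Γ) :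
    ∃ c ε₀ h₀ : ℝ, 0 < c ∧ 0 < ε₀ ∧ 0 < h₀ ∧
      ∀ {q : ℕ → ℝ≥0} (_ : Monotone q) {g f : ℝ → ℝ} (_ : IsConstOnCells q g) {a b : ℕ} (_ : a ≤ b)
      {h ρ : ℝ}, 0 < h → h ≤ h₀ → (q b : ℝ) = q a + h → 0 < ρ →
      (∀ s ∈ Ioc (q a : ℝ) (q a + h / 2), c₁ * ρ ≤ f s ∧ f s ≤ c₂ * ρ) →
      IntervalIntegrable (fun s => (g s - f s) ^ 2) volume (q a) (q b) →
      ∫ s in (q a : ℝ)..(q b : ℝ), (g s - f s) ^ 2 ≤ (c₁ * ρ) ^ 2 * h / 16 →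
      ∫ s in (q a : ℝ)..(q b : ℝ), g s ^ 2 ≤ Γ * h * ρ ^ 2 →
      ∀ x : ℝ, P {ω | |incrementSum L q g a b ω + x| ≤ ε₀ * ρ} ≤ ENNReal.ofReal (1 - c * h) := by
  have hν := ht.levyMeasure
  obtain ⟨C, hC0, hC⟩ := ht.exists_norm_levyExponent_le_mul_sq hL2 hL0
  obtain ⟨cψ, v₀, hcψ, hv₀, hψ⟩ := hν.exists_le_neg_levyExponent_re
    (ht.levyMeasure_ne_zero (hL.measurable 1) hL0 hne) γ
  have hKex : ∀ κ : ℝ, ∃ K, 0 ≤ K ∧ (0 < κ → ∀ u, ‖levyExponent γ 0 ν u‖ ≤ κ * u ^ 2 + K) := by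
    intro κ
    rcases le_or_gt κ 0 with h | h
    · exact ⟨0, le_rfl, fun h' => absurd h' (not_lt.2 h)⟩
    · obtain ⟨K, hK0, hK⟩ := hν.exists_norm_levyExponent_le γ h
      exact ⟨K, hK0, fun _ => hK⟩
  choose K hK0 hK using hKex
  set η := v₀ / (c₂ + c₁) with hη
  have hη0 : 0 < η := by positivity
  set κ₁ := cψ * η ^ 2 * c₁ ^ 2 / 16 with hκ₁
  have hκ₁0 : 0 < κ₁ := by positivity
  obtain ⟨c, ε₀, h₀, hc, hε₀, hh₀, key⟩ :=
    exists_anticoncentration (half_pos hκ₁0) hΓ hη0 hC0 hK0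
  refine ⟨c, ε₀, min h₀ (1 / κ₁), hc, hε₀, by positivity, ?_⟩
  intro q hq g f hg a b hab h ρ hh hhh hqh hρ hf hgf hD hV x
  refine key P (measurable_incrementSum hL.measurable q g a b) hh (hhh.trans (min_le_left _ _)) hρ
    hV (lintegral_incrementSum_sq_le hL ht hq hg hab hC) (fun κ hκ u => ?_) ?_ x
  · have := norm_integral_exp_incrementSum_sub_one_le hL ht hq hg hab (hK κ hκ) u
    rwa [hqh, add_sub_cancel_left, ← hqh] at this
  · have h1 := re_integral_levyExponent_le hν hcψ hv₀ hc₁ hc₂ hψ hq hg hab hh hqh hρ hf hgf hD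
    rw [← hη, ← hκ₁] at h1
    have hm := measurable_incrementSum hL.measurable q g a b
    have hi : Integrable (fun ω => Real.cos (η / ρ * incrementSum L q g a b ω)) P :=
      Integrable.of_bound (by fun_prop) 1 (Eventually.of_forall fun ω => Real.abs_cos_le_one _)
    rw [integral_sub (integrable_const _) hi, ← re_integral_exp_I_mul hm, integral_const,
      probReal_univ, one_smul, integral_exp_incrementSum hL ht hq hg hab]
    refine le_sub_comm.1 ((Complex.re_le_norm _).trans ?_)
    rw [Complex.norm_exp]
    have hx1 : κ₁ * h ≤ 1 := by
      have := hhh.trans (min_le_right _ _)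
      rw [le_div_iff₀ hκ₁0] at this
      linarith
    have hx0 : 0 ≤ κ₁ * h := by positivity
    refine (Real.exp_le_exp.2 h1).trans ?_
    -- The inequality `exp(-x) ≤ 1 - x/2` on `[0, 1]` accounts for the half of `κ₁` and for the
    -- restriction `h ≤ 1 / κ₁`.
    have h2 : Real.exp (-(κ₁ * h)) ≤ 1 - (κ₁ * h) / 2 := by
      have h3 := Real.add_one_le_exp (κ₁ * h)
      rw [Real.exp_neg, inv_le_comm₀ (Real.exp_pos _) (by linarith)]
      refine le_trans ?_ h3
      rw [inv_le_comm₀ (by linarith) (by linarith), ← one_div, div_le_iff₀ (by linarith)]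
      nlinarith
    linarith

end Block

/-! ### Products of conditional bounds -/

section Product

variable {Ω : Type*} [MeasurableSpace Ω] {P : Measure Ω} [IsProbabilityMeasure P]

/-- By Fubini, the past may be frozen at `X = x`; what it adds is then a deterministic shift, and
the bound on `A` is uniform in shifts. -/
theorem IndepFun.measure_inter_abs_add_le {α : Type*} [MeasurableSpace α] {X : Ω → α} {A : Ω → ℝ}
    (hXA : IndepFun X A P) (hX : Measurable X) (hA : Measurable A) {D : Set α}
    (hD : MeasurableSet D) {B : α → ℝ} (hB : Measurable B) {R : ℝ} {r : ℝ≥0∞}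
    (hr : ∀ b, P {ω | |A ω + b| ≤ R} ≤ r) :
    P {ω | X ω ∈ D ∧ |B (X ω) + A ω| ≤ R} ≤ r * P {ω | X ω ∈ D} := by
  have hmap := (indepFun_iff_map_prod_eq_prod_map_map hX.aemeasurable hA.aemeasurable).1 hXA
  set S : Set (α × ℝ) := {p | p.1 ∈ D ∧ |B p.1 + p.2| ≤ R}
  have hS : MeasurableSet S := (hD.preimage measurable_fst).inter
    (measurableSet_le (f := fun p : α × ℝ => |B p.1 + p.2|) (g := fun _ => R)
      (by fun_prop) measurable_const)
  have : IsProbabilityMeasure (P.map A) := Measure.isProbabilityMeasure_map hA.aemeasurable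
  have : IsProbabilityMeasure (P.map X) := Measure.isProbabilityMeasure_map hX.aemeasurable
  have e1 : P {ω | X ω ∈ D ∧ |B (X ω) + A ω| ≤ R} = (P.map fun ω => (X ω, A ω)) S := by
    rw [Measure.map_apply (hX.prodMk hA) hS]; rfl
  have e2 : P {ω | X ω ∈ D} = (P.map X) D := by rw [Measure.map_apply hX hD]; rfl
  rw [e1, e2, hmap, Measure.prod_apply hS, ← setLIntegral_const, ← lintegral_indicator hD]
  refine lintegral_mono fun x => ?_
  by_cases hx : x ∈ D
  · rw [indicator_of_mem hx, Measure.map_apply hA (measurable_prodMk_left hS)]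
    refine (measure_mono fun ω hω => ?_).trans (hr (B x))
    have := hω.2
    simpa [add_comm] using this
  · rw [indicator_of_notMem hx]
    have : Prod.mk x ⁻¹' S = ∅ := by
      ext y
      simp [S, hx]
    rw [this, measure_empty]

/-- Induction on the number of blocks. The integrand changes with `j`, so the past part of the new
sum is unrelated to the earlier sums; only its measurability with respect to the past increments is
used. -/
theorem measure_forall_abs_incrementSum_le {L : ℝ≥0 → Ω → ℝ} (hL : ∀ t, Measurable (L t))
    (hind : HasIndepIncrements L P) {q : ℕ → ℝ≥0} (hq : Monotone q) {m : ℕ → ℕ} (hm : Monotone m)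
    (g : ℕ → ℝ → ℝ) {R : ℝ} {r : ℝ≥0∞} {n : ℕ}
    (hr : ∀ j < n, ∀ b, P {ω | |incrementSum L q (g j) (m j) (m (j + 1)) ω + b| ≤ R} ≤ r) :
    P {ω | ∀ j < n, |incrementSum L q (g j) 0 (m (j + 1)) ω| ≤ R} ≤ r ^ n := by
  induction n with
  | zero => simp
  | succ n ih =>
    set ξ : ℕ → Ω → ℝ := fun i ω => L (q (i + 1)) ω - L (q i) ω
    have hξ : ∀ i, Measurable (ξ i) := fun i => (hL _).sub (hL _)
    have hξi : iIndepFun ξ P := hind.nat hq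
    have hdisj : Disjoint (Finset.Ico 0 (m n)) (Finset.Ico (m n) (m (n + 1))) :=
      Finset.Ico_disjoint_Ico_consecutive _ _ _
    have h0 := hξi.indepFun_finset (Finset.Ico 0 (m n)) (Finset.Ico (m n) (m (n + 1))) hdisj hξ
    -- The past increments are extended by zero to a sequence, so that the earlier events and the
    -- shift are functions of one random element `X`.
    set φ : (↥(Finset.Ico 0 (m n)) → ℝ) → (ℕ → ℝ) := fun x i =>
      if h : i ∈ Finset.Ico 0 (m n) then x ⟨i, h⟩ else 0
    have hφ : Measurable φ := by
      refine measurable_pi_lambda _ fun i => ?_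
      by_cases h : i ∈ Finset.Ico 0 (m n)
      · simp only [φ, dif_pos h]; fun_prop
      · simp only [φ, dif_neg h]; fun_prop
    set θ : (↥(Finset.Ico (m n) (m (n + 1))) → ℝ) → ℝ := fun x =>
      ∑ i : ↥(Finset.Ico (m n) (m (n + 1))), g n (q ((i : ℕ) + 1)) * x i
    have hθ : Measurable θ := Finset.measurable_sum _ fun i _ =>
      (measurable_pi_apply i).const_mul _
    have h1 := h0.comp (φ := φ) (ψ := θ) hφ hθ
    set X : Ω → ℕ → ℝ := φ ∘ fun ω i => ξ i ω
    have hX : Measurable X := hφ.comp (by fun_prop)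
    have hA : θ ∘ (fun ω i => ξ i ω) = incrementSum L q (g n) (m n) (m (n + 1)) := by
      funext ω
      exact Finset.sum_coe_sort (Finset.Ico (m n) (m (n + 1)))
        (fun i => g n (q (i + 1)) * ξ i ω)
    rw [hA] at h1
    have hXs : ∀ (f : ℝ → ℝ) (k : ℕ), k ≤ m n → ∀ ω, incrementSum L q f 0 k ω =
        ∑ i ∈ Finset.Ico 0 k, f (q (i + 1)) * X ω i := by
      intro f k hk ω
      refine Finset.sum_congr rfl fun i hi => ?_
      have hi' : i ∈ Finset.Ico 0 (m n) :=
        Finset.mem_Ico.2 ⟨Nat.zero_le _, (Finset.mem_Ico.1 hi).2.trans_le hk⟩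
      simp only [X, φ, Function.comp_apply, dif_pos hi', ξ]
    set D : Set (ℕ → ℝ) :=
      {x | ∀ j < n, |∑ i ∈ Finset.Ico 0 (m (j + 1)), g j (q (i + 1)) * x i| ≤ R}
    have hD : MeasurableSet D := by
      have : D = ⋂ j, ⋂ (_ : j < n),
          {x | |∑ i ∈ Finset.Ico 0 (m (j + 1)), g j (q (i + 1)) * x i| ≤ R} := by
        ext x; simp [D]
      rw [this]
      refine MeasurableSet.iInter fun j => MeasurableSet.iInter fun _ => ?_
      exact measurableSet_le (by fun_prop) measurable_const
    have hDX : {ω | X ω ∈ D} = {ω | ∀ j < n, |incrementSum L q (g j) 0 (m (j + 1)) ω| ≤ R} := by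
      ext ω
      simp only [D, mem_ofPred_eq]
      refine forall₂_congr fun j hj => ?_
      rw [hXs _ _ (hm hj)]
    have h2 := IndepFun.measure_inter_abs_add_le h1 hX (measurable_incrementSum hL q _ _ _) hD
      (B := fun x => ∑ i ∈ Finset.Ico 0 (m n), g n (q (i + 1)) * x i) (by fun_prop)
      (hr n (Nat.lt_succ_self n))
    rw [pow_succ, mul_comm]
    refine (measure_mono fun ω hω => ?_).trans (h2.trans ?_)
    · simp only [mem_ofPred_eq] at hω ⊢
      have h3 : ω ∈ {ω | X ω ∈ D} := by
        rw [hDX]; exact fun j hj => hω j (hj.trans (Nat.lt_succ_self n))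
      refine ⟨h3, ?_⟩
      have h4 := hω n (Nat.lt_succ_self n)
      have h5 : incrementSum L q (g n) 0 (m (n + 1)) ω =
          incrementSum L q (g n) 0 (m n) ω + incrementSum L q (g n) (m n) (m (n + 1)) ω :=
        (Finset.sum_Ico_consecutive _ (Nat.zero_le _) (hm (Nat.le_succ n))).symm
      rw [h5, hXs _ _ le_rfl] at h4
      exact h4
    · rw [hDX]
      gcongr
      exact ih fun j hj => hr j (hj.trans (Nat.lt_succ_self n))

end Product

/-! ### Unboundedness for `H < 1/2` -/

theorem integral_sq_le_of_eLpNorm_sq_le {α : Type*} [MeasurableSpace α] {μ : Measure α} {F : α → ℝ}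
    (hF : AEStronglyMeasurable F μ) {η : ℝ} (hη : 0 ≤ η)
    (h : eLpNorm F 2 μ ^ 2 ≤ ENNReal.ofReal η) :
    MemLp F 2 μ ∧ ∫ x, F x ^ 2 ∂μ ≤ η := by
  have hlt : eLpNorm F 2 μ < ∞ := by
    have h1 : eLpNorm F 2 μ ^ 2 < ∞ := h.trans_lt ENNReal.ofReal_lt_top
    exact (ENNReal.pow_lt_top_iff.1 h1).resolve_right two_ne_zero
  refine ⟨⟨hF, hlt⟩, ?_⟩
  have e1 := eLpNorm_nnreal_pow_eq_lintegral (μ := μ) (f := F) (p := 2) two_ne_zero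
  simp only [NNReal.coe_ofNat, ENNReal.coe_ofNat, ENNReal.rpow_ofNat] at e1
  rw [integral_eq_lintegral_of_nonneg_ae (Eventually.of_forall fun x => sq_nonneg _)
    (hF.pow 2)]
  refine ENNReal.toReal_le_of_le_ofReal hη (le_trans (le_of_eq ?_) h)
  rw [e1]
  refine lintegral_congr fun x => ?_
  rw [← sq_abs, ENNReal.ofReal_pow (abs_nonneg _), Real.enorm_eq_ofReal_abs]

/-- The integral of `(t-s)^(2H-1)` over a block of length `h` is `h^(2H)/(2H)`, and `h^(2H) = h ρ²`
with `ρ = h^(H-1/2)`. -/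
theorem integral_molchanGolosovKernel_sq_le {H h t C : ℝ} (hH : 0 < H) (hh : 0 < h)
    {f : ℝ → ℝ} (hfi : IntervalIntegrable (fun s => f s ^ 2) volume (t - h) t)
    (hf : ∀ s ∈ Ioo (t - h) t, 0 ≤ f s ∧ f s ≤ C * (t - s) ^ (H - 1 / 2)) :
    ∫ s in (t - h)..t, f s ^ 2 ≤ C ^ 2 / (2 * H) * h * (h ^ (H - 1 / 2)) ^ 2 := by
  have hle : t - h ≤ t := by linarith
  have hi : IntervalIntegrable (fun s : ℝ => C ^ 2 * (t - s) ^ (2 * H - 1)) volume (t - h) t := by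
    have := (intervalIntegral.intervalIntegrable_rpow' (a := h) (b := 0) (r := 2 * H - 1)
      (by linarith)).comp_sub_left t
    rw [sub_zero] at this
    exact this.const_mul _
  have h1 : ∫ s in (t - h)..t, f s ^ 2 ≤ ∫ s in (t - h)..t, C ^ 2 * (t - s) ^ (2 * H - 1) := by
    refine intervalIntegral.integral_mono_on_of_le_Ioo hle hfi hi fun s hs => ?_
    obtain ⟨h2, h3⟩ := hf s hs
    have hts : 0 < t - s := sub_pos.2 hs.2
    calc f s ^ 2 ≤ (C * (t - s) ^ (H - 1 / 2)) ^ 2 := pow_le_pow_left₀ h2 h3 2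
      _ = C ^ 2 * (t - s) ^ (2 * H - 1) := by
        rw [mul_pow, ← Real.rpow_mul_natCast hts.le]
        congr 2
        push_cast; ring
  refine h1.trans (le_of_eq ?_)
  rw [intervalIntegral.integral_const_mul,
    intervalIntegral.integral_comp_sub_left (fun x : ℝ => x ^ (2 * H - 1)),
    integral_rpow (Or.inl (by linarith)), sub_self, sub_sub_cancel, sub_add_cancel,
    Real.zero_rpow (by linarith), sub_zero, ← Real.rpow_mul_natCast hh.le]
  have : h ^ (2 * H) = h * h ^ ((H - 1 / 2) * ((2 : ℕ) : ℝ)) := by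
    nth_rw 2 [← Real.rpow_one h]
    rw [← Real.rpow_add hh]
    congr 1
    push_cast; ring
  rw [this]
  ring

section Unbounded

variable {Ω : Type*} [MeasurableSpace Ω] {P : Measure Ω}
  {H : ℝ} {L Y : ℝ≥0 → Ω → ℝ}

theorem IsLevyIntegral.exists_stepFun {t : ℝ≥0} {f : ℝ → ℝ} {X : Ω → ℝ}
    (h : IsLevyIntegral P L t f X) {η : ℝ} (hη : 0 < η) :
    ∃ g : StepFun,
      eLpNorm (fun s => g.toFun s - (Ioc 0 (t : ℝ)).indicator f s) 2 volume ^ 2 ≤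
        ENNReal.ofReal η ∧
      P {ω | 1 / 2 ≤ |g.integral L ω - X ω|} ≤ ENNReal.ofReal η := by
  obtain ⟨g, hg1, hg2⟩ := h
  have h1 : Tendsto (fun k => eLpNorm (fun s => (g k).toFun s -
      (Ioc 0 (t : ℝ)).indicator f s) 2 volume ^ 2) atTop (𝓝 0) := by
    simpa using ENNReal.Tendsto.pow (n := 2) hg1
  have h2 := tendstoInMeasure_iff_norm.1 hg2 (1 / 2) (by norm_num)
  have hη' : 0 < ENNReal.ofReal η := ENNReal.ofReal_pos.2 hη
  obtain ⟨k, hk1, hk2⟩ := ((h1.eventually (ge_mem_nhds hη')).and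
    (h2.eventually (ge_mem_nhds hη'))).exists
  exact ⟨g k, hk1, hk2⟩

theorem measure_half_le_abs_le {X : Ω → ℝ} (hX : Measurable X) {B : ℝ}
    (hB : ∫⁻ ω, ‖X ω‖ₑ ^ 2 ∂P ≤ ENNReal.ofReal B) :
    P {ω | 1 / 2 ≤ |X ω|} ≤ ENNReal.ofReal (4 * B) := by
  have hsub : {ω | 1 / 2 ≤ |X ω|} ⊆ {ω | ENNReal.ofReal (1 / 4) ≤ ‖X ω‖ₑ ^ 2} := by
    intro ω hω
    simp only [mem_ofPred_eq] at hω ⊢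
    rw [Real.enorm_eq_ofReal_abs, ← ENNReal.ofReal_pow (abs_nonneg _)]
    refine ENNReal.ofReal_le_ofReal ?_
    nlinarith
  refine (measure_mono hsub).trans ((meas_ge_le_lintegral_div (by fun_prop) (by simp)
    ENNReal.ofReal_ne_top).trans ((ENNReal.div_le_div_right hB _).trans (le_of_eq ?_)))
  rw [← ENNReal.ofReal_div_of_pos (by norm_num)]
  congr 1
  ring

theorem exists_common_partition {n : ℕ} (g : ℕ → StepFun) {t : ℕ → ℝ≥0} (ht : StrictMono t) :
    ∃ (q : ℕ → ℝ≥0) (N : ℕ) (m : ℕ → ℕ), Monotone q ∧ Monotone m ∧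
      (∀ j < n, ∀ x ∈ (g j).endpoints, ∃ i ≤ N, q i = x) ∧
      ∀ j ≤ n, m j ≤ N ∧ q (m j) = t j := by
  obtain ⟨q, N, hq, hN⟩ := exists_partition
    ((Finset.range n).biUnion (fun j => (g j).endpoints) ∪ (Finset.range (n + 1)).image t)
  choose idx hidxN hidxq using fun j => hN (t (min j n)) (Finset.mem_union_right _
    (Finset.mem_image_of_mem _ (Finset.mem_range.2 (Nat.lt_succ_of_le (min_le_right _ _)))))
  refine ⟨q, N, fun j => idx (min j n), hq, ?_, ?_, ?_⟩
  · intro i j hij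
    rcases (min_le_min_right n hij).eq_or_lt with h | h
    · simp only [h, le_refl]
    · refine (hq.reflect_lt ?_).le
      rw [hidxq, hidxq, min_assoc, min_self, min_assoc, min_self]
      exact ht h
  · intro j hj x hx
    exact hN x (Finset.mem_union_left _ (Finset.mem_biUnion.2 ⟨j, Finset.mem_range.2 hj, hx⟩))
  · intro j hj
    refine ⟨hidxN _, ?_⟩
    rw [hidxq, min_assoc, min_self, min_eq_left hj]

/-- The product estimate is proved for step functions `g j` approximating the kernels at the grid
points, all written over one partition. The `1` subtracted from the threshold absorbs two errors of
size `1/2`: the approximation of `Y`, and the part of `g j` beyond its grid point. -/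
theorem IsFLpMG.exists_measure_forall_abs_le [IsProbabilityMeasure P]
    (hY : IsFLpMG P H L Y) (hH : H < 1 / 2)
    (hne : ¬ ∀ᵐ ω ∂P, L 1 ω = 0) {a : ℝ≥0} (ha : 0 < a) :
    ∃ c ε₀ h₀ : ℝ, 0 < c ∧ 0 < ε₀ ∧ 0 < h₀ ∧ ∀ h : ℝ≥0, 0 < h → (h : ℝ) ≤ h₀ → ∀ n : ℕ,
      P {ω | ∀ j < n, |Y (a + ((j + 1 : ℕ) : ℝ≥0) * h) ω| ≤ ε₀ * (h : ℝ) ^ (H - 1 / 2) - 1} ≤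
        ENNReal.ofReal (1 - c * h) ^ n := by
  obtain ⟨γ, ν, htrip⟩ := hY.noGaussian
  have hL := hY.levy
  have hH0 := hY.hurst_pos
  have hcH := molchanGolosovConst_pos hH0 hY.hurst_lt_one
  set cH := molchanGolosovConst H
  obtain ⟨δ, hδ, hker⟩ := exists_molchanGolosovKernel_bounds hH0 hH
    (show (0 : ℝ) < a by exact_mod_cast ha)
  obtain ⟨C, hC0, hC⟩ := htrip.exists_norm_levyExponent_le_mul_sq hY.sq_integrable hY.mean_zero
  -- From `g² ≤ 2(g - f)² + 2f²`: the first term contributes `2`, the second twice the block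
  -- integral of the squared kernel.
  set Γ := 2 * ((2 * cH) ^ 2 / (2 * H)) + 2 with hΓ
  obtain ⟨c, ε₀, h₀, hc, hε₀, hh₀, key⟩ := exists_incrementSum_anticoncentration hL htrip
    hY.sq_integrable hY.mean_zero hne (c₁ := cH / 2) (c₂ := 4 * cH) (Γ := Γ) (by positivity)
    (by positivity) (by positivity)
  refine ⟨c, ε₀, min h₀ (δ / 2), hc, hε₀, by positivity, fun h hh hhh n => ?_⟩
  have hh0 : (0 : ℝ) < h := by exact_mod_cast hh
  have hhδ : (h : ℝ) < δ := (hhh.trans (min_le_right _ _)).trans_lt (by linarith)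
  set ρ : ℝ := (h : ℝ) ^ (H - 1 / 2) with hρ
  have hρ0 : 0 < ρ := Real.rpow_pos_of_pos hh0 _
  set t : ℕ → ℝ≥0 := fun j => a + (j : ℝ≥0) * h with ht
  have htm : StrictMono t := by
    intro i j hij
    have : (i : ℝ≥0) < j := by exact_mod_cast hij
    simp only [ht]
    gcongr
  have htsucc : ∀ j, (t (j + 1) : ℝ) = t j + h := fun j => by simp only [ht]; push_cast; ring
  have hta : ∀ j, (a : ℝ) ≤ t j := fun j => by
    simp only [ht]; push_cast
    have : (0 : ℝ) ≤ (j : ℝ) * h := by positivity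
    linarith
  refine ENNReal.le_of_forall_pos_le_add fun ε hε _ => ?_
  have hε' : (0 : ℝ) < ε := by exact_mod_cast hε
  -- Three demands on the approximation: it must not spoil the variance bound, nor the comparison of
  -- `g` with the kernel on each block, and the `n` exceptional events must have total probability
  -- at most `ε`.
  set η : ℝ := min (min (h * ρ ^ 2) ((cH / 2 * ρ) ^ 2 * h / 16)) (ε / ((n + 1) * (1 + 8 * C))) with hη
  have hη0 : 0 < η := by positivity
  have hη1 : η ≤ h * ρ ^ 2 := (min_le_left _ _).trans (min_le_left _ _)
  have hη2 : η ≤ (cH / 2 * ρ) ^ 2 * h / 16 := (min_le_left _ _).trans (min_le_right _ _)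
  have hη3 : n * (η + 8 * C * η) ≤ ε := by
    have h1 : η ≤ ε / ((n + 1) * (1 + 8 * C)) := min_le_right _ _
    rw [le_div_iff₀ (by positivity)] at h1
    have : 0 ≤ η * (1 + 8 * C) := by positivity
    nlinarith
  choose g hg1 hg2 using fun j => (hY.eq_integral (t (j + 1))).exists_stepFun hη0
  obtain ⟨q, N, m, hq, hm, hqend, hqm⟩ := exists_common_partition (n := n) g htm
  set f : ℕ → ℝ → ℝ := fun j =>
    (Ioc 0 (t (j + 1) : ℝ)).indicator (molchanGolosovKernel H (t (j + 1))) with hf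
  have hfm : ∀ j, Measurable (f j) := fun j =>
    (measurable_molchanGolosovKernel hH0 hH.ne _).indicator measurableSet_Ioc
  have hgf : ∀ j, MemLp (fun s => (g j).toFun s - f j s) 2 volume ∧
      ∫ s, ((g j).toFun s - f j s) ^ 2 ≤ η := fun j =>
    integral_sq_le_of_eLpNorm_sq_le (((g j).measurable_toFun.sub (hfm j)).aestronglyMeasurable)
      hη0.le (hg1 j)
  have hgfi : ∀ j (x y : ℝ), IntervalIntegrable (fun s => ((g j).toFun s - f j s) ^ 2) volume x y :=
    fun j x y => (hgf j).1.integrable_sq.intervalIntegrable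
  have hgfD : ∀ j (x y : ℝ), x ≤ y → ∫ s in x..y, ((g j).toFun s - f j s) ^ 2 ≤ η := by
    intro j x y hxy
    rw [intervalIntegral.integral_of_le hxy]
    exact (setIntegral_le_integral (hgf j).1.integrable_sq
      (Eventually.of_forall fun s => sq_nonneg _)).trans (hgf j).2
  have hfi : ∀ j, Integrable (fun s => f j s ^ 2) volume := by
    intro j
    have := ((g j).memLp_toFun.sub (hgf j).1).integrable_sq
    refine this.congr (Eventually.of_forall fun s => ?_)
    simp
  have hfeq : ∀ j, ∀ s : ℝ, 0 < s → s ≤ (t (j + 1) : ℝ) →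
      f j s = molchanGolosovKernel H (t (j + 1)) s :=
    fun j s h1 h2 => indicator_of_mem (show s ∈ Ioc 0 (t (j + 1) : ℝ) from ⟨h1, h2⟩) _
  have ha0 : (0 : ℝ) < a := by exact_mod_cast ha
  have hblock : ∀ j < n, ∀ x, P {ω | |incrementSum L q (g j).toFun (m j) (m (j + 1)) ω + x| ≤
      ε₀ * ρ} ≤ ENNReal.ofReal (1 - c * h) := by
    intro j hj x
    have hq1 := (hqm j hj.le).2
    have hq2 := (hqm (j + 1) hj).2
    have hle : (t j : ℝ) ≤ t (j + 1) := by rw [htsucc]; linarith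
    refine key hq ((g j).isConstOnCells hq (hqend j hj)) (f := f j) (hm (Nat.le_succ j)) hh0
      (hhh.trans (min_le_left _ _)) (by rw [hq1, hq2, htsucc]) hρ0 (fun s hs => ?_) (hgfi _ _ _)
      ?_ ?_ x
    · rw [hq1] at hs
      have hs0 : (a : ℝ) ≤ s := (hta j).trans hs.1.le
      have hd1 : (t (j + 1) : ℝ) - s ≤ h := by rw [htsucc]; linarith [hs.1]
      have hd2 : (h : ℝ) / 2 ≤ (t (j + 1) : ℝ) - s := by rw [htsucc]; linarith [hs.2]
      have hst : s < t (j + 1) := by linarith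
      rw [hfeq j s (by linarith) hst.le]
      obtain ⟨k1, k2⟩ := hker s (t (j + 1)) hs0 hst (by linarith)
      have hp1 : ρ ≤ ((t (j + 1) : ℝ) - s) ^ (H - 1 / 2) :=
        Real.rpow_le_rpow_of_nonpos (by linarith) hd1 (by linarith)
      have hp2 : ((t (j + 1) : ℝ) - s) ^ (H - 1 / 2) ≤ 2 * ρ := by
        calc ((t (j + 1) : ℝ) - s) ^ (H - 1 / 2) ≤ ((h : ℝ) / 2) ^ (H - 1 / 2) :=
              Real.rpow_le_rpow_of_nonpos (by linarith) hd2 (by linarith)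
          _ = ρ * 2 ^ (1 / 2 - H) := by
              rw [Real.div_rpow hh0.le two_pos.le, div_eq_mul_inv, ← Real.rpow_neg two_pos.le,
                neg_sub]
          _ ≤ ρ * 2 ^ (1 : ℝ) := by
              gcongr
              · exact one_le_two
              · linarith
          _ = 2 * ρ := by rw [Real.rpow_one]; ring
      constructor
      · exact le_trans (by gcongr) k1
      · refine k2.trans ?_
        calc 2 * cH * ((t (j + 1) : ℝ) - s) ^ (H - 1 / 2) ≤ 2 * cH * (2 * ρ) := by gcongr
          _ = 4 * cH * ρ := by ring
    · rw [hq1, hq2]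
      exact (hgfD j _ _ hle).trans hη2
    · rw [hq1, hq2]
      have hf2 : ∫ s in (t j : ℝ)..(t (j + 1) : ℝ), f j s ^ 2 ≤
          (2 * cH) ^ 2 / (2 * H) * h * ρ ^ 2 := by
        have htj : (t j : ℝ) = t (j + 1) - h := by rw [htsucc]; ring
        rw [htj]
        refine integral_molchanGolosovKernel_sq_le hH0 hh0
          (hfi j).intervalIntegrable fun s hs => ?_
        rw [← htj] at hs
        have hs0 : (a : ℝ) ≤ s := (hta j).trans hs.1.le
        rw [hfeq j s (by linarith) hs.2.le]
        obtain ⟨k1, k2⟩ := hker s (t (j + 1)) hs0 hs.2 (by rw [htsucc]; linarith [hs.1])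
        have := Real.rpow_pos_of_pos (sub_pos.2 hs.2) (H - 1 / 2)
        exact ⟨le_trans (by positivity) k1, k2⟩
      calc ∫ s in (t j : ℝ)..(t (j + 1) : ℝ), (g j).toFun s ^ 2
          ≤ ∫ s in (t j : ℝ)..(t (j + 1) : ℝ),
              (2 * ((g j).toFun s - f j s) ^ 2 + 2 * f j s ^ 2) := by
            refine intervalIntegral.integral_mono_on hle
              (g j).memLp_toFun.integrable_sq.intervalIntegrable
              (((hgfi j _ _).const_mul 2).add ((hfi j).intervalIntegrable.const_mul 2))
              fun s _ => ?_
            nlinarith [sq_nonneg ((g j).toFun s - 2 * f j s)]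
        _ = 2 * (∫ s in (t j : ℝ)..(t (j + 1) : ℝ), ((g j).toFun s - f j s) ^ 2) +
              2 * ∫ s in (t j : ℝ)..(t (j + 1) : ℝ), f j s ^ 2 := by
            rw [intervalIntegral.integral_add ((hgfi j _ _).const_mul 2)
              ((hfi j).intervalIntegrable.const_mul 2), intervalIntegral.integral_const_mul,
              intervalIntegral.integral_const_mul]
        _ ≤ 2 * (h * ρ ^ 2) + 2 * ((2 * cH) ^ 2 / (2 * H) * h * ρ ^ 2) := by
            gcongr
            exact (hgfD j _ _ hle).trans hη1
        _ = Γ * h * ρ ^ 2 := by rw [hΓ]; ring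
  have hprod := measure_forall_abs_incrementSum_le hL.measurable hL.indep_increments hq hm
    (fun j => (g j).toFun) (n := n) hblock
  -- A step function may charge times after `t (j + 1)`. The kernel vanishes there, so this part has
  -- squared `L²` norm at most `η` and is negligible by Chebyshev's inequality.
  have herr : ∀ j < n, P {ω | 1 / 2 ≤ |incrementSum L q (g j).toFun (m (j + 1)) N ω|} ≤
      ENNReal.ofReal (8 * C * η) := by
    intro j hj
    obtain ⟨hmN, hqt⟩ := hqm (j + 1) hj
    have hle : (t (j + 1) : ℝ) ≤ q N := by rw [← hqt]; exact_mod_cast hq hmN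
    have h1 := lintegral_incrementSum_sq_le hL htrip hq ((g j).isConstOnCells hq (hqend j hj))
      hmN hC
    rw [hqt] at h1
    have h2 : ∫ s in (t (j + 1) : ℝ)..(q N : ℝ), (g j).toFun s ^ 2 ≤ η := by
      refine le_trans (le_of_eq ?_) (hgfD j (t (j + 1)) (q N) hle)
      refine intervalIntegral.integral_congr_ae (Eventually.of_forall fun s hs => ?_)
      rw [uIoc_of_le hle] at hs
      have : f j s = 0 := indicator_of_notMem (fun hmem => absurd hmem.2 (not_le.2 hs.1)) _
      rw [this, sub_zero]
    have h3 : ENNReal.ofReal (2 * C * ∫ s in (t (j + 1) : ℝ)..(q N : ℝ), (g j).toFun s ^ 2) ≤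
        ENNReal.ofReal (2 * C * η) := ENNReal.ofReal_le_ofReal (by gcongr)
    refine (measure_half_le_abs_le (measurable_incrementSum hL.measurable q _ _ _)
      (h1.trans h3)).trans (le_of_eq ?_)
    congr 1
    ring
  set E₁ := {ω | ∀ j < n, |incrementSum L q (g j).toFun 0 (m (j + 1)) ω| ≤ ε₀ * ρ}
  set F : ℕ → Set Ω := fun j => {ω | 1 / 2 ≤ |(g j).integral L ω - Y (t (j + 1)) ω|} ∪
    {ω | 1 / 2 ≤ |incrementSum L q (g j).toFun (m (j + 1)) N ω|}
  have hsub : {ω | ∀ j < n, |Y (t (j + 1)) ω| ≤ ε₀ * ρ - 1} ⊆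
      E₁ ∪ ⋃ j ∈ Finset.range n, F j := by
    intro ω hω
    by_cases hF : ω ∈ ⋃ j ∈ Finset.range n, F j
    · exact Or.inr hF
    · refine Or.inl fun j hj => ?_
      have hFj : ω ∉ F j := fun hh => hF (mem_biUnion (Finset.mem_coe.2 (Finset.mem_range.2 hj)) hh)
      simp only [F, mem_union, mem_ofPred_eq, not_or, not_le] at hFj
      have h1 := hω j hj
      have h2 : (g j).integral L ω = incrementSum L q (g j).toFun 0 (m (j + 1)) ω +
          incrementSum L q (g j).toFun (m (j + 1)) N ω := by
        rw [(g j).integral_eq_incrementSum L hq (hqend j hj)]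
        exact (Finset.sum_Ico_consecutive _ (Nat.zero_le _) (hqm (j + 1) hj).1).symm
      rw [h2] at hFj
      obtain ⟨h3, h4⟩ := hFj
      rw [abs_lt] at h3 h4
      rw [abs_le] at h1 ⊢
      constructor <;> linarith [h3.1, h3.2, h4.1, h4.2, h1.1, h1.2]
  calc P {ω | ∀ j < n, |Y (t (j + 1)) ω| ≤ ε₀ * ρ - 1}
      ≤ P E₁ + P (⋃ j ∈ Finset.range n, F j) := (measure_mono hsub).trans (measure_union_le _ _)
    _ ≤ ENNReal.ofReal (1 - c * h) ^ n + ∑ j ∈ Finset.range n, P (F j) := by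
        gcongr
        exact measure_biUnion_finset_le _ _
    _ ≤ ENNReal.ofReal (1 - c * h) ^ n + ∑ _j ∈ Finset.range n, ENNReal.ofReal (η + 8 * C * η) := by
        gcongr with j hj
        rw [ENNReal.ofReal_add hη0.le (by positivity)]
        exact (measure_union_le _ _).trans (add_le_add (hg2 j) (herr j (Finset.mem_range.1 hj)))
    _ ≤ ENNReal.ofReal (1 - c * h) ^ n + ε := by
        gcongr
        rw [Finset.sum_const, Finset.card_range, nsmul_eq_mul, ← ENNReal.ofReal_natCast,
          ← ENNReal.ofReal_mul (by positivity), ← ENNReal.ofReal_coe_nnreal]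
        exact ENNReal.ofReal_le_ofReal hη3

theorem IsFLpMG.exists_unbounded [IsProbabilityMeasure P] (hY : IsFLpMG P H L Y) (hH : H < 1 / 2)
    (hne : ¬ ∀ᵐ ω ∂P, L 1 ω = 0) {T : ℝ≥0} (hT : 0 < T) :
    ∃ A : Set Ω, MeasurableSet A ∧ 0 < P A ∧
      ∀ ω ∈ A, ¬ Bornology.IsBounded ((fun t => Y t ω) '' Icc 0 T) := by
  have hT2 : 0 < T / 2 := half_pos hT
  obtain ⟨c, ε₀, h₀, hc, hε₀, hh₀, key⟩ := hY.exists_measure_forall_abs_le hH hne hT2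
  -- The grids lie in `[T/2, T]`, since the diagonal bounds on the kernel hold only away from the
  -- origin. Using all grids at once keeps the index set countable and the events measurable.
  set τ : ℕ → ℕ → ℝ≥0 := fun n j => T / 2 + ((j + 1 : ℕ) : ℝ≥0) * (T / 2 / n)
  have hτ : ∀ n, ∀ j < n, τ n j ∈ Icc 0 T := by
    intro n j hj
    refine ⟨zero_le, ?_⟩
    have hn : (0 : ℝ≥0) < n := by exact_mod_cast (Nat.zero_le j).trans_lt hj
    have h1 : ((j + 1 : ℕ) : ℝ≥0) * (T / 2 / n) ≤ T / 2 := by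
      calc ((j + 1 : ℕ) : ℝ≥0) * (T / 2 / n) ≤ n * (T / 2 / n) := by
            gcongr
            exact hj
        _ = T / 2 := mul_div_cancel₀ _ hn.ne'
    calc τ n j ≤ T / 2 + T / 2 := by simp only [τ]; gcongr
      _ = T := add_halves T
  set E : ℕ → Set Ω := fun M => {ω | ∀ n, ∀ j < n, |Y (τ n j) ω| ≤ M}
  have hEm : ∀ M, MeasurableSet (E M) := by
    intro M
    have : E M = ⋂ n, ⋂ j, ⋂ (_ : j < n), {ω | |Y (τ n j) ω| ≤ M} := by ext ω; simp [E]
    rw [this]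
    refine MeasurableSet.iInter fun n => MeasurableSet.iInter fun j => MeasurableSet.iInter fun _ => ?_
    have := hY.measurable (τ n j)
    exact measurableSet_le (by fun_prop) measurable_const
  -- For given `M`, some mesh `h = T/(2n)` satisfies `M ≤ ε₀ h^(H-1/2) - 1`, and `(1 - c h)^n ≤
  -- exp(-c T/2)` does not depend on `M`.
  have hEP : ∀ M, P (E M) ≤ ENNReal.ofReal (Real.exp (-(c * (T / 2)))) := by
    intro M
    have hh : Tendsto (fun n : ℕ => ((T / 2 / n : ℝ≥0) : ℝ)) atTop (𝓝[>] 0) := by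
      rw [tendsto_nhdsWithin_iff]
      refine ⟨?_, ?_⟩
      · have := tendsto_const_div_atTop_nhds_zero_nat ((T / 2 : ℝ≥0) : ℝ)
        refine this.congr fun n => by push_cast; rfl
      · filter_upwards [eventually_gt_atTop 0] with n hn
        have : (0 : ℝ≥0) < T / 2 / n := div_pos hT2 (by exact_mod_cast hn)
        exact_mod_cast this
    have hpow : Tendsto (fun n : ℕ => ε₀ * ((T / 2 / n : ℝ≥0) : ℝ) ^ (H - 1 / 2) - 1) atTop atTop := by
      have h1 := (tendsto_rpow_neg_nhdsGT_zero (show H - 1 / 2 < 0 by linarith)).comp hh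
      exact tendsto_atTop_add_const_right _ _ (h1.const_mul_atTop hε₀)
    obtain ⟨n, hn1, hn2, hn3⟩ := ((hpow.eventually (eventually_ge_atTop (M : ℝ))).and
      (((tendsto_nhdsWithin_iff.1 hh).1.eventually (ge_mem_nhds hh₀)).and
        (eventually_gt_atTop 0))).exists
    have hn0 : (0 : ℝ≥0) < n := by exact_mod_cast hn3
    have h2 := key (T / 2 / n) (div_pos hT2 hn0) hn2 n
    refine (measure_mono fun ω hω j hj => ?_).trans (h2.trans ?_)
    · exact (hω n j hj).trans hn1
    · calc ENNReal.ofReal (1 - c * ((T / 2 / n : ℝ≥0) : ℝ)) ^ n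
          ≤ ENNReal.ofReal (Real.exp (-(c * ((T / 2 / n : ℝ≥0) : ℝ)))) ^ n := by
            gcongr
            have := Real.add_one_le_exp (-(c * ((T / 2 / n : ℝ≥0) : ℝ)))
            linarith
        _ = ENNReal.ofReal (Real.exp (-(c * (T / 2)))) := by
            rw [← ENNReal.ofReal_pow (Real.exp_pos _).le, ← Real.exp_nat_mul]
            congr 2
            have : (n : ℝ) ≠ 0 := by exact_mod_cast hn3.ne'
            push_cast
            field_simp
  have hmono : Monotone E := by
    intro M M' hM ω hω n j hj
    exact (hω n j hj).trans (by exact_mod_cast hM)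
  have hU : P (⋃ M, E M) ≤ ENNReal.ofReal (Real.exp (-(c * (T / 2)))) := by
    rw [hmono.measure_iUnion]
    exact iSup_le hEP
  have hlt : ENNReal.ofReal (Real.exp (-(c * (T / 2)))) < 1 := by
    rw [ENNReal.ofReal_lt_one, Real.exp_lt_one_iff]
    have : (0 : ℝ) < T := by exact_mod_cast hT
    have : 0 < c * (T / 2) := by positivity
    linarith
  refine ⟨(⋃ M, E M)ᶜ, (MeasurableSet.iUnion hEm).compl, ?_, ?_⟩
  · rw [prob_compl_eq_one_sub (MeasurableSet.iUnion hEm)]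
    exact tsub_pos_of_lt (hU.trans_lt hlt)
  · intro ω hω hb
    apply hω
    obtain ⟨R, hR⟩ := hb.exists_norm_le
    obtain ⟨M, hM⟩ := exists_nat_ge R
    refine mem_iUnion.2 ⟨M, fun n j hj => ?_⟩
    exact (hR _ (mem_image_of_mem _ (hτ n j hj))).trans hM

theorem IsFLpMG.exists_discontinuous [IsProbabilityMeasure P] (hY : IsFLpMG P H L Y) (hH : H < 1 / 2)
    (hne : ¬ ∀ᵐ ω ∂P, L 1 ω = 0) {T : ℝ≥0} (hT : 0 < T) :
    ∃ A : Set Ω, MeasurableSet A ∧ 0 < P A ∧ ∀ ω ∈ A, ¬ ContinuousOn (fun t => Y t ω) (Icc 0 T) := by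
  obtain ⟨A, hA, hA0, hAb⟩ := hY.exists_unbounded hH hne hT
  exact ⟨A, hA, hA0, fun ω hω hc => hAb ω hω (isCompact_Icc.image_of_continuousOn hc).isBounded⟩

end Unbounded

/-! ### The Kolmogorov-Chentsov criterion for second moments -/

/-- The largest multiple of `2 ^ (-n)` below `t`. -/
def dyadicFloor (n : ℕ) (t : ℝ≥0) : ℝ≥0 := ⌊t * 2 ^ n⌋₊ / 2 ^ n

theorem dyadicFloor_le (n : ℕ) (t : ℝ≥0) : dyadicFloor n t ≤ t :=
  div_le_of_le_mul₀ zero_le zero_le (Nat.floor_le zero_le)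

theorem sub_dyadicFloor_le (n : ℕ) (t : ℝ≥0) : (t : ℝ) - dyadicFloor n t ≤ (1 / 2 : ℝ) ^ n := by
  have h : (t : ℝ) * 2 ^ n < ⌊t * 2 ^ n⌋₊ + 1 := by
    exact_mod_cast Nat.lt_floor_add_one (t * 2 ^ n)
  have h2 : (0 : ℝ) < 2 ^ n := by positivity
  rw [one_div, inv_pow, dyadicFloor]
  push_cast
  rw [sub_le_iff_le_add, ← one_div, ← add_div, le_div_iff₀ h2]
  linarith

/-- Increments over neighbouring dyadic points of `[0, N]` are bounded geometrically. -/
def DyadicBound (N : ℕ) (K r : ℝ) (f : ℝ≥0 → ℝ) : Prop :=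
  ∀ n k : ℕ, k < N * 2 ^ n → |f ((k + 1 : ℕ) / 2 ^ n) - f (k / 2 ^ n)| ≤ K * r ^ n

/-! ### Chaining along dyadic points -/

section Chaining

variable {N : ℕ} {K r : ℝ} {f : ℝ≥0 → ℝ}

theorem DyadicBound.abs_sub_le_of_le_succ (h : DyadicBound N K r f) (hK : 0 ≤ K) (hr : 0 ≤ r)
    {n k l : ℕ} (hkl : k ≤ l) (hlk : l ≤ k + 1) (hl : l ≤ N * 2 ^ n) :
    |f (l / 2 ^ n) - f (k / 2 ^ n)| ≤ K * r ^ n := by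
  rcases hkl.eq_or_lt with rfl | hlt
  · rw [sub_self, abs_zero]; positivity
  · obtain rfl : l = k + 1 := by omega
    exact h n k (by omega)

theorem floor_mul_two_pow_le {t : ℝ≥0} (ht : t ≤ N) (n : ℕ) : ⌊t * 2 ^ n⌋₊ ≤ N * 2 ^ n := by
  refine Nat.floor_le_of_le ?_
  push_cast
  gcongr

theorem DyadicBound.abs_dyadicFloor_succ_sub_le (h : DyadicBound N K r f) (hK : 0 ≤ K) (hr : 0 ≤ r)
    {t : ℝ≥0} (ht : t ≤ N) (n : ℕ) :
    |f (dyadicFloor (n + 1) t) - f (dyadicFloor n t)| ≤ K * r ^ (n + 1) := by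
  have h2 : (⌊t * 2 ^ (n + 1)⌋₊) / 2 = ⌊t * 2 ^ n⌋₊ := by
    rw [← Nat.floor_div_natCast]
    congr 1
    push_cast
    rw [pow_succ, ← mul_assoc, mul_div_cancel_right₀ _ two_ne_zero]
  have h3 : dyadicFloor n t = ((2 * ⌊t * 2 ^ n⌋₊ : ℕ) : ℝ≥0) / 2 ^ (n + 1) := by
    rw [dyadicFloor, pow_succ', Nat.cast_mul, Nat.cast_two, mul_div_mul_left _ _ two_ne_zero]
  rw [h3]
  exact h.abs_sub_le_of_le_succ hK hr (by omega) (by omega) (floor_mul_two_pow_le ht _)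

theorem DyadicBound.abs_dyadicFloor_sub_le (h : DyadicBound N K r f) (hK : 0 ≤ K) (hr : 0 ≤ r)
    {s t : ℝ≥0} (hst : s ≤ t) (ht : t ≤ N) {n : ℕ} (hd : (t : ℝ) - s ≤ (1 / 2 : ℝ) ^ n) :
    |f (dyadicFloor n t) - f (dyadicFloor n s)| ≤ K * r ^ n := by
  refine h.abs_sub_le_of_le_succ hK hr (Nat.floor_le_floor (by gcongr)) ?_
    (floor_mul_two_pow_le ht _)
  rw [← Nat.floor_add_one zero_le]
  refine Nat.floor_le_floor ?_
  have h2 : (0 : ℝ) < 2 ^ n := by positivity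
  rw [one_div, inv_pow, ← one_div, le_div_iff₀ h2] at hd
  rw [← NNReal.coe_le_coe]
  push_cast
  linarith

theorem DyadicBound.exists_tendsto (h : DyadicBound N K r f) (hK : 0 ≤ K) (hr : 0 ≤ r) (hr1 : r < 1)
    {t : ℝ≥0} (ht : t ≤ N) :
    ∃ a, Tendsto (fun n => f (dyadicFloor n t)) atTop (𝓝 a) ∧
      ∀ n, |f (dyadicFloor n t) - a| ≤ K * r / (1 - r) * r ^ n := by
  have hd : ∀ n, dist (f (dyadicFloor n t)) (f (dyadicFloor (n + 1) t)) ≤ K * r * r ^ n := by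
    intro n
    rw [dist_comm, Real.dist_eq]
    exact (h.abs_dyadicFloor_succ_sub_le hK hr ht n).trans_eq (by ring)
  obtain ⟨a, ha⟩ := cauchySeq_tendsto_of_complete (cauchySeq_of_le_geometric r _ hr1 hd)
  refine ⟨a, ha, fun n => ?_⟩
  rw [← Real.dist_eq]
  exact (dist_le_of_le_geometric_of_tendsto r _ hr1 hd ha n).trans_eq (by ring)

/-- At the level `n` matching `t - s`, the dyadic floors of `s` and `t` are equal or neighbours, and
passing from the floors to the limits costs a geometric tail of order `r ^ n`. Distances above `1`
are covered by at most `N` integer steps. -/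
theorem DyadicBound.abs_sub_le_of_tendsto {β : ℝ} (hβ : 0 < β)
    (h : DyadicBound N K ((1 / 2 : ℝ) ^ β) f) (hK : 0 ≤ K) {g : ℝ≥0 → ℝ}
    (hg : ∀ t : ℝ≥0, t ≤ N → Tendsto (fun n => f (dyadicFloor n t)) atTop (𝓝 (g t))) :
    ∃ C : ℝ≥0, ∀ s t : ℝ≥0, s ≤ t → t ≤ N → |g t - g s| ≤ C * ((t : ℝ) - s) ^ β := by
  set r : ℝ := (1 / 2 : ℝ) ^ β with hrdef
  have hr : 0 < r := Real.rpow_pos_of_pos (by norm_num) _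
  have hr1 : r < 1 := Real.rpow_lt_one (by norm_num) (by norm_num) hβ
  set D := K * r / (1 - r) with hD
  have hD0 : 0 ≤ D := div_nonneg (by positivity) (sub_nonneg.2 hr1.le)
  have happrox : ∀ t : ℝ≥0, t ≤ N → ∀ n, |f (dyadicFloor n t) - g t| ≤ D * r ^ n := by
    intro t ht n
    obtain ⟨a, ha, hb⟩ := h.exists_tendsto hK hr.le hr1 ht
    rw [tendsto_nhds_unique (hg t ht) ha]
    exact hb n
  have hlocal : ∀ s t : ℝ≥0, s ≤ t → t ≤ N → (t : ℝ) - s ≤ 1 →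
      |g t - g s| ≤ (K + 2 * D) / r * ((t : ℝ) - s) ^ β := by
    intro s t hst ht h1
    rcases hst.eq_or_lt with rfl | hlt
    · rw [sub_self, abs_zero, sub_self, Real.zero_rpow hβ.ne', mul_zero]
    have hpos : (0 : ℝ) < t - s := sub_pos.2 (by exact_mod_cast hlt)
    -- Here `2^(-(n+1)) < t - s ≤ 2^(-n)`: the upper bound makes the floors neighbours, the lower
    -- one turns `r^(n+1)` into `(t - s)^β`.
    obtain ⟨n, hn1, hn2⟩ := exists_nat_pow_near_of_lt_one hpos h1 (y := (1 / 2 : ℝ)) (by norm_num)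
      (by norm_num)
    have e1 := h.abs_dyadicFloor_sub_le hK hr.le hst ht hn2
    have e2 := happrox t ht n
    have e3 := happrox s (hst.trans ht) n
    have e4 : r ^ (n + 1) ≤ ((t : ℝ) - s) ^ β := by
      rw [hrdef, ← Real.rpow_mul_natCast (by norm_num), mul_comm, Real.rpow_natCast_mul (by norm_num)]
      exact Real.rpow_le_rpow (by positivity) hn1.le hβ.le
    calc |g t - g s| ≤ (K + 2 * D) * r ^ n := by
          rw [abs_le] at *
          constructor <;> linarith [e1.1, e1.2, e2.1, e2.2, e3.1, e3.2]
      _ = (K + 2 * D) / r * r ^ (n + 1) := by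
          rw [pow_succ]
          field_simp
      _ ≤ (K + 2 * D) / r * ((t : ℝ) - s) ^ β := by gcongr
  have hint : ∀ k l : ℕ, k ≤ l → l ≤ N → |f l - f k| ≤ N * K := by
    intro k l hkl hl
    rw [abs_sub_comm, ← Real.dist_eq]
    calc dist (f k) (f l) ≤ ∑ _i ∈ Finset.Ico k l, K := by
          refine dist_le_Ico_sum_of_dist_le (f := fun k : ℕ => f k) hkl fun {i} _ hi2 => ?_
          have := h 0 i (by simpa using hi2.trans_le hl)
          simpa [dist_comm, Real.dist_eq, abs_sub_comm] using this
      _ ≤ N * K := by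
          rw [Finset.sum_const, Nat.card_Ico, nsmul_eq_mul]
          gcongr
          omega
  have hC0 : 0 ≤ max ((K + 2 * D) / r) (N * K + 2 * D) := le_max_of_le_left (by positivity)
  refine ⟨(max ((K + 2 * D) / r) (N * K + 2 * D)).toNNReal, fun s t hst ht => ?_⟩
  rw [Real.coe_toNNReal _ hC0]
  have hpos : (0 : ℝ) ≤ t - s := sub_nonneg.2 (by exact_mod_cast hst)
  rcases le_total ((t : ℝ) - s) 1 with h1 | h1
  · exact (hlocal s t hst ht h1).trans (by gcongr; exact le_max_left _ _)
  · have e1 := hint ⌊s⌋₊ ⌊t⌋₊ (Nat.floor_le_floor hst) (Nat.floor_le_of_le ht)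
    have e2 := happrox t ht 0
    have e3 := happrox s (hst.trans ht) 0
    simp only [dyadicFloor, pow_zero, mul_one, div_one] at e2 e3
    calc |g t - g s| ≤ (N * K + 2 * D) * 1 := by
          rw [abs_le] at *
          constructor <;> linarith [e1.1, e1.2, e2.1, e2.2, e3.1, e3.2]
      _ ≤ _ := by
          gcongr
          · exact le_max_right _ _
          · exact Real.one_le_rpow h1 hβ.le

end Chaining

/-! ### From second moments to a Hölder modification -/

section Modification

variable {Ω : Type*} [MeasurableSpace Ω] {P : Measure Ω} {X : ℝ≥0 → Ω → ℝ}

/-- The random constant is the square root of the sum of all normalised squared dyadic increments.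
Its expectation at level `n` is of order `2^n 2^(-nq) 2^(2βn)`, summable because `q > 1 + 2β`. -/
theorem ae_exists_dyadicBound (hX : ∀ t, Measurable (X t)) {N : ℕ} {C q β : ℝ}
    (hq : 1 + 2 * β < q)
    (h : ∀ s t : ℝ≥0, s ≤ t → t ≤ N →
      ∫⁻ ω, ‖X t ω - X s ω‖ₑ ^ 2 ∂P ≤ ENNReal.ofReal (C * ((t : ℝ) - s) ^ q)) :
    ∀ᵐ ω ∂P, ∃ K, 0 ≤ K ∧ DyadicBound N K ((1 / 2 : ℝ) ^ β) (fun t => X t ω) := by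
  set r : ℝ := (1 / 2 : ℝ) ^ β with hrdef
  have hr : 0 < r := Real.rpow_pos_of_pos (by norm_num) _
  set D : ℕ → ℕ → Ω → ℝ≥0∞ := fun n k ω =>
    ‖(X ((k + 1 : ℕ) / 2 ^ n) ω - X (k / 2 ^ n) ω) / r ^ n‖ₑ ^ 2 with hD
  have hDm : ∀ n k, Measurable (D n k) := by
    intro n k
    have h1 := hX ((k + 1 : ℕ) / 2 ^ n)
    have h2 := hX (k / 2 ^ n)
    exact (((h1.sub h2).div_const _).enorm).pow_const 2
  set a : ℝ := 2 * (1 / 2 : ℝ) ^ q / r ^ 2 with ha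
  have ha0 : 0 ≤ a := by positivity
  have ha1 : a < 1 := by
    have e1 : a = (1 / 2 : ℝ) ^ (q - 1 - 2 * β) := by
      rw [ha, hrdef, Real.rpow_sub (by norm_num), Real.rpow_sub (by norm_num), Real.rpow_one,
        mul_comm 2 β, Real.rpow_mul (by norm_num), Real.rpow_two]
      field_simp
    rw [e1]
    exact Real.rpow_lt_one (by norm_num) (by norm_num) (by linarith)
  have hDi : ∀ n k, k < N * 2 ^ n → ∫⁻ ω, D n k ω ∂P ≤
      ENNReal.ofReal (C * ((1 / 2 : ℝ) ^ q / r ^ 2) ^ n) := by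
    intro n k hk
    have e1 := h (k / 2 ^ n) ((k + 1 : ℕ) / 2 ^ n) (by gcongr; exact Nat.le_succ k) (by
      rw [div_le_iff₀ (by positivity)]
      exact_mod_cast hk)
    have e2 : (((((k + 1 : ℕ) : ℝ≥0) / 2 ^ n : ℝ≥0) : ℝ) - ((k / 2 ^ n : ℝ≥0) : ℝ)) ^ q =
        ((1 / 2 : ℝ) ^ q) ^ n := by
      rw [← Real.rpow_mul_natCast (by norm_num), mul_comm, Real.rpow_natCast_mul (by norm_num)]
      congr 1
      push_cast
      rw [← sub_div, add_sub_cancel_left, one_div_pow]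
    rw [e2] at e1
    have e3 : ∀ ω, D n k ω = ENNReal.ofReal (((r ^ 2) ^ n)⁻¹) *
        ‖X ((k + 1 : ℕ) / 2 ^ n) ω - X (k / 2 ^ n) ω‖ₑ ^ 2 := by
      intro ω
      simp only [hD]
      rw [div_eq_mul_inv, enorm_mul, mul_pow, mul_comm, Real.enorm_of_nonneg (by positivity),
        ← ENNReal.ofReal_pow (by positivity), inv_pow, ← pow_mul, ← pow_mul, mul_comm n 2]
    simp only [e3]
    rw [lintegral_const_mul' _ _ ENNReal.ofReal_ne_top]
    calc _ ≤ ENNReal.ofReal (((r ^ 2) ^ n)⁻¹) * ENNReal.ofReal (C * ((1 / 2 : ℝ) ^ q) ^ n) := by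
          gcongr
      _ = _ := by
          rw [← ENNReal.ofReal_mul (by positivity), div_pow]
          congr 1
          ring
  have hS : ∫⁻ ω, ∑' n, ∑ k ∈ Finset.range (N * 2 ^ n), D n k ω ∂P < ∞ := by
    rw [lintegral_tsum fun n =>
      (Finset.measurable_fun_sum _ fun k _ => hDm n k).aemeasurable]
    calc ∑' n, ∫⁻ ω, ∑ k ∈ Finset.range (N * 2 ^ n), D n k ω ∂P
        ≤ ∑' n : ℕ, ENNReal.ofReal (N * |C| * a ^ n) := by
          refine ENNReal.tsum_le_tsum fun n => ?_
          rw [lintegral_finsetSum _ fun k _ => hDm n k]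
          calc _ ≤ ∑ _k ∈ Finset.range (N * 2 ^ n),
                ENNReal.ofReal (|C| * ((1 / 2 : ℝ) ^ q / r ^ 2) ^ n) := by
                refine Finset.sum_le_sum fun k hk =>
                  (hDi n k (Finset.mem_range.1 hk)).trans (ENNReal.ofReal_le_ofReal ?_)
                gcongr
                exact le_abs_self C
            _ = _ := by
                rw [Finset.sum_const, Finset.card_range, nsmul_eq_mul, ← ENNReal.ofReal_natCast,
                  ← ENNReal.ofReal_mul (by positivity)]
                congr 1
                rw [ha, mul_div_assoc, mul_pow]
                push_cast
                ring
      _ < ∞ := by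
          have hs := (summable_geometric_of_lt_one ha0 ha1).mul_left (N * |C|)
          rw [← ENNReal.ofReal_tsum_of_nonneg (fun n => by positivity) hs]
          exact ENNReal.ofReal_lt_top
  have hSm : Measurable fun ω => ∑' n, ∑ k ∈ Finset.range (N * 2 ^ n), D n k ω :=
    Measurable.tsum fun n => Finset.measurable_fun_sum _ fun k _ => hDm n k
  filter_upwards [ae_lt_top hSm hS.ne] with ω hω
  refine ⟨√(∑' n, ∑ k ∈ Finset.range (N * 2 ^ n), D n k ω).toReal, Real.sqrt_nonneg _,
    fun n k hk => ?_⟩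
  have e1 : D n k ω ≤ ∑' n, ∑ k ∈ Finset.range (N * 2 ^ n), D n k ω :=
    (Finset.single_le_sum (f := fun k => D n k ω) (fun _ _ => zero_le)
      (Finset.mem_range.2 hk)).trans
      (ENNReal.le_tsum (f := fun n => ∑ k ∈ Finset.range (N * 2 ^ n), D n k ω) n)
  have e2 := ENNReal.toReal_mono hω.ne e1
  have e3 : (D n k ω).toReal = ((X ((k + 1 : ℕ) / 2 ^ n) ω - X (k / 2 ^ n) ω) / r ^ n) ^ 2 := by
    simp only [hD, ENNReal.toReal_pow, toReal_enorm, Real.norm_eq_abs, sq_abs]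
  rw [e3] at e2
  have e4 := Real.abs_le_sqrt e2
  rwa [abs_div, abs_of_pos (pow_pos hr n), div_le_iff₀ (pow_pos hr n)] at e4

/-- The values at the dyadic floors converge to `X t` in mean square. By Fatou's lemma the lower
limit of the squared distances vanishes almost surely, which identifies the pointwise limit. -/
theorem ae_eq_limsup_dyadicFloor (hX : ∀ t, Measurable (X t)) {t : ℝ≥0} {C q : ℝ} (hq : 0 < q)
    (h : ∀ s : ℝ≥0, s ≤ t →
      ∫⁻ ω, ‖X t ω - X s ω‖ₑ ^ 2 ∂P ≤ ENNReal.ofReal (C * ((t : ℝ) - s) ^ q))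
    (hconv : ∀ᵐ ω ∂P, ∃ a, Tendsto (fun n => X (dyadicFloor n t) ω) atTop (𝓝 a)) :
    ∀ᵐ ω ∂P, limsup (fun n => X (dyadicFloor n t) ω) atTop = X t ω := by
  have hm : ∀ n, Measurable fun ω => ‖X t ω - X (dyadicFloor n t) ω‖ₑ ^ 2 := fun n =>
    (((hX t).sub (hX _)).enorm).pow_const 2
  have hlim : Tendsto (fun n => ∫⁻ ω, ‖X t ω - X (dyadicFloor n t) ω‖ₑ ^ 2 ∂P) atTop (𝓝 0) := by
    have e1 : Tendsto (fun n : ℕ => ENNReal.ofReal (|C| * ((1 / 2 : ℝ) ^ q) ^ n)) atTop (𝓝 0) := by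
      rw [← ENNReal.ofReal_zero, ← mul_zero |C|]
      refine ENNReal.tendsto_ofReal ((tendsto_pow_atTop_nhds_zero_of_lt_one (by positivity)
        (Real.rpow_lt_one (by norm_num) (by norm_num) hq)).const_mul _)
    refine tendsto_of_tendsto_of_tendsto_of_le_of_le tendsto_const_nhds e1 (fun _ => zero_le)
      fun n => (h _ (dyadicFloor_le n t)).trans (ENNReal.ofReal_le_ofReal ?_)
    have e2 : (0 : ℝ) ≤ t - dyadicFloor n t := sub_nonneg.2 (by exact_mod_cast dyadicFloor_le n t)
    have e3 : ((t : ℝ) - dyadicFloor n t) ^ q ≤ ((1 / 2 : ℝ) ^ q) ^ n := by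
      rw [← Real.rpow_mul_natCast (by norm_num), mul_comm, Real.rpow_natCast_mul (by norm_num)]
      exact Real.rpow_le_rpow e2 (sub_dyadicFloor_le n t) hq.le
    calc C * ((t : ℝ) - dyadicFloor n t) ^ q ≤ |C| * ((t : ℝ) - dyadicFloor n t) ^ q := by
          gcongr
          exact le_abs_self C
      _ ≤ |C| * ((1 / 2 : ℝ) ^ q) ^ n := by gcongr
  have h0 : ∫⁻ ω, liminf (fun n => ‖X t ω - X (dyadicFloor n t) ω‖ₑ ^ 2) atTop ∂P = 0 := by
    refine le_antisymm ((lintegral_liminf_le hm).trans_eq hlim.liminf_eq) zero_le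
  rw [lintegral_eq_zero_iff (Measurable.liminf hm)] at h0
  filter_upwards [h0, hconv] with ω h1 ⟨a, ha⟩
  rw [ha.limsup_eq]
  have h2 : Tendsto (fun n => ‖X t ω - X (dyadicFloor n t) ω‖ₑ ^ 2) atTop
      (𝓝 (‖X t ω - a‖ₑ ^ 2)) := ENNReal.Tendsto.pow (ha.const_sub _).enorm
  rw [h2.liminf_eq] at h1
  have h3 : ‖X t ω - a‖ₑ = 0 := by simpa using h1
  exact (sub_eq_zero.1 (enorm_eq_zero.1 h3)).symm

/-- The Kolmogorov-Chentsov criterion: if `E (X_t - X_s)² = O(|t - s| ^ q)` locally, for every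
`q < p`, where `p > 1`, then `X` has a modification that is locally Hölder continuous of every
order less than `(p - 1) / 2`. -/
theorem exists_modification_holderOnWith (hX : ∀ t, Measurable (X t)) {p : ℝ} (hp : 1 < p)
    (h : ∀ (N : ℕ) (q : ℝ), 1 < q → q < p → ∃ C : ℝ, ∀ s t : ℝ≥0, s ≤ t → t ≤ N →
      ∫⁻ ω, ‖X t ω - X s ω‖ₑ ^ 2 ∂P ≤ ENNReal.ofReal (C * ((t : ℝ) - s) ^ q)) :
    ∃ Y : ℝ≥0 → Ω → ℝ, (∀ t, Measurable (Y t)) ∧ (∀ t, ∀ᵐ ω ∂P, Y t ω = X t ω) ∧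
      ∀ᵐ ω ∂P, ∀ (T β : ℝ≥0), (β : ℝ) < (p - 1) / 2 →
        ∃ C : ℝ≥0, HolderOnWith C β (fun t => Y t ω) (Icc 0 T) := by
  have hbd : ∀ (N : ℕ) (β : ℝ), 0 < β → β < (p - 1) / 2 →
      ∀ᵐ ω ∂P, ∃ K, 0 ≤ K ∧ DyadicBound N K ((1 / 2 : ℝ) ^ β) (fun t => X t ω) := by
    intro N β hβ0 hβ
    obtain ⟨q, hq1, hq2⟩ := exists_between (show 1 + 2 * β < p by linarith)
    obtain ⟨C, hC⟩ := h N q (by linarith) hq2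
    exact ae_exists_dyadicBound hX hq1 hC
  have hconv : ∀ (N : ℕ) (β : ℝ), 0 < β → β < (p - 1) / 2 → ∀ ω,
      (∃ K, 0 ≤ K ∧ DyadicBound N K ((1 / 2 : ℝ) ^ β) (fun t => X t ω)) → ∀ t : ℝ≥0, t ≤ N →
      ∃ a, Tendsto (fun n => X (dyadicFloor n t) ω) atTop (𝓝 a) := by
    rintro N β hβ0 - ω ⟨K, hK, hb⟩ t ht
    obtain ⟨a, ha, -⟩ := hb.exists_tendsto hK (by positivity)
      (Real.rpow_lt_one (by norm_num) (by norm_num) hβ0) ht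
    exact ⟨a, ha⟩
  -- The upper limit is measurable and defined for every outcome, and it is the limit whenever that
  -- exists.
  refine ⟨fun t ω => limsup (fun n => X (dyadicFloor n t) ω) atTop,
    fun t => Measurable.limsup fun n => hX _, fun t => ?_, ?_⟩
  · obtain ⟨N, hN⟩ := exists_nat_ge t
    obtain ⟨β, hβ0, hβ⟩ := exists_between (show (0 : ℝ) < (p - 1) / 2 by linarith)
    obtain ⟨q, hq1, hq2⟩ := exists_between hp
    obtain ⟨C, hC⟩ := h N q hq1 hq2
    refine ae_eq_limsup_dyadicFloor hX (by linarith) (fun s hs => hC s t hs hN) ?_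
    filter_upwards [hbd N β hβ0 hβ] with ω hω
    exact hconv N β hβ0 hβ ω hω t hN
  -- Exponents `u j` tending to `(p-1)/2` and integer horizons `N` leave one null set for all `T`
  -- and `β`. A given `β` lies below some `u j`, and on a bounded interval the Hölder order can be
  -- lowered.
  · obtain ⟨u, -, hu, hulim⟩ := exists_seq_strictMono_tendsto' (show (0 : ℝ) < (p - 1) / 2 by linarith)
    have hall : ∀ᵐ ω ∂P, ∀ N j : ℕ,
        ∃ K, 0 ≤ K ∧ DyadicBound N K ((1 / 2 : ℝ) ^ u j) (fun t => X t ω) :=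
      ae_all_iff.2 fun N => ae_all_iff.2 fun j => hbd N (u j) (hu j).1 (hu j).2
    filter_upwards [hall] with ω hω T β hβ
    obtain ⟨N, hN⟩ := exists_nat_ge T
    obtain ⟨j, hj⟩ := (hulim.eventually (lt_mem_nhds hβ)).exists
    obtain ⟨K, hK, hb⟩ := hω N j
    have hlim : ∀ t : ℝ≥0, t ≤ N → Tendsto (fun n => X (dyadicFloor n t) ω) atTop
        (𝓝 (limsup (fun n => X (dyadicFloor n t) ω) atTop)) := by
      intro t ht
      obtain ⟨a, ha⟩ := hconv N (u j) (hu j).1 (hu j).2 ω ⟨K, hK, hb⟩ t ht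
      rwa [ha.limsup_eq]
    obtain ⟨C, hC⟩ := hb.abs_sub_le_of_tendsto (hu j).1 hK hlim
    have hC' : ∀ s t : ℝ≥0, s ≤ t → t ≤ N → edist
        (limsup (fun n => X (dyadicFloor n t) ω) atTop)
        (limsup (fun n => X (dyadicFloor n s) ω) atTop) ≤
        C * edist t s ^ (((u j).toNNReal : ℝ≥0) : ℝ) := by
      intro s t hst ht
      have hst' : (0 : ℝ) ≤ t - s := sub_nonneg.2 (by exact_mod_cast hst)
      rw [Real.coe_toNNReal _ (hu j).1.le, edist_dist, edist_dist, Real.dist_eq, NNReal.dist_eq,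
        abs_of_nonneg hst', ENNReal.ofReal_rpow_of_nonneg hst' (hu j).1.le,
        ← ENNReal.ofReal_coe_nnreal, ← ENNReal.ofReal_mul C.coe_nonneg]
      exact ENNReal.ofReal_le_ofReal (hC s t hst ht)
    have hH : HolderOnWith C (u j).toNNReal
        (fun t => limsup (fun n => X (dyadicFloor n t) ω) atTop) (Icc 0 T) := by
      intro s hs t ht
      rcases le_total s t with hst | hst
      · rw [edist_comm, edist_comm s t]
        exact hC' s t hst (ht.2.trans hN)
      · exact hC' t s hst (hs.2.trans hN)
    refine ⟨_, hH.of_le (s := β) (D := T) (fun x hx y hy => ?_) ?_⟩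
    · rw [edist_dist, ← ENNReal.ofReal_coe_nnreal]
      refine ENNReal.ofReal_le_ofReal ?_
      have hx2 : (x : ℝ) ≤ T := by exact_mod_cast hx.2
      have hy2 : (y : ℝ) ≤ T := by exact_mod_cast hy.2
      rw [NNReal.dist_eq, abs_le]
      constructor <;> linarith [x.coe_nonneg, y.coe_nonneg]
    · rw [← NNReal.coe_le_coe, Real.coe_toNNReal _ (hu j).1.le]
      exact hj.le

end Modification

/-! ### Hölder continuity for `H > 1/2` -/

section Holder

variable {Ω : Type*} [MeasurableSpace Ω] {P : Measure Ω} {H : ℝ} {L Y : ℝ≥0 → Ω → ℝ}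

theorem lintegral_enorm_sq_eq_eLpNorm_sq {α : Type*} [MeasurableSpace α] (μ : Measure α)
    (f : α → ℝ) : ∫⁻ x, ‖f x‖ₑ ^ 2 ∂μ = eLpNorm f 2 μ ^ 2 := by
  have e1 := eLpNorm_nnreal_pow_eq_lintegral (μ := μ) (f := f) (p := 2) two_ne_zero
  simp only [NNReal.coe_ofNat, ENNReal.coe_ofNat, ENNReal.rpow_ofNat] at e1
  exact e1.symm

/-- The increments of integrals with respect to a centred square integrable Lévy process are bounded
in `L²` by the distance of the integrands. -/
theorem IsLevyIntegral.eLpNorm_sub_le [IsProbabilityMeasure P] (hL : IsLevyProcess P L) {γ C : ℝ}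
    {ν : Measure ℝ} (h : HasLevyTriplet P L γ 0 ν) (hC0 : 0 ≤ C)
    (hC : ∀ u, ‖levyExponent γ 0 ν u‖ ≤ C * u ^ 2) {t t' : ℝ≥0} {f f' : ℝ → ℝ} {X X' : Ω → ℝ}
    (hf : Measurable f) (hf' : Measurable f')
    (hX : IsLevyIntegral P L t f X) (hX' : IsLevyIntegral P L t' f' X') :
    eLpNorm (fun ω => X' ω - X ω) 2 P ^ 2 ≤ ENNReal.ofReal (2 * C) *
      eLpNorm (fun s => (Ioc 0 (t' : ℝ)).indicator f' s - (Ioc 0 (t : ℝ)).indicator f s) 2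
        volume ^ 2 := by
  obtain ⟨g, hg, hgX⟩ := hX
  obtain ⟨g', hg', hgX'⟩ := hX'
  set F := (Ioc 0 (t : ℝ)).indicator f
  set F' := (Ioc 0 (t' : ℝ)).indicator f'
  have hF : Measurable F := hf.indicator measurableSet_Ioc
  have hF' : Measurable F' := hf'.indicator measurableSet_Ioc
  -- A common subsequence makes both approximations converge almost surely, so lower semicontinuity
  -- of the `L²` norm applies to their difference.
  obtain ⟨k₁, hk₁, hae⟩ := hgX.exists_seq_tendsto_ae
  have hsub : TendstoInMeasure P (fun i => (g' (k₁ i)).integral L) atTop X' :=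
    fun ε hε => (hgX' ε hε).comp hk₁.tendsto_atTop
  obtain ⟨k₂, hk₂, hae'⟩ := hsub.exists_seq_tendsto_ae
  have hk : Tendsto (fun i => k₁ (k₂ i)) atTop atTop := hk₁.tendsto_atTop.comp hk₂.tendsto_atTop
  set d : ℕ → StepFun := fun i => (g' (k₁ (k₂ i))).sub (g (k₁ (k₂ i)))
  have hd : ∀ᵐ ω ∂P, Tendsto (fun i => (d i).integral L ω) atTop (𝓝 (X' ω - X ω)) := by
    filter_upwards [hae, hae'] with ω h1 h2
    simp only [d, StepFun.sub_integral]
    exact h2.sub (h1.comp hk₂.tendsto_atTop)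
  set A := eLpNorm (fun s => F' s - F s) 2 volume
  have hA : ∀ i, eLpNorm (d i).toFun 2 volume ≤
      eLpNorm (fun s => (g' (k₁ (k₂ i))).toFun s - F' s) 2 volume +
        (A + eLpNorm (fun s => (g (k₁ (k₂ i))).toFun s - F s) 2 volume) := by
    intro i
    have m1 := ((g' (k₁ (k₂ i))).measurable_toFun.sub hF').aestronglyMeasurable (μ := volume)
    have m2 := (hF'.sub hF).aestronglyMeasurable (μ := volume)
    have m3 := (hF.sub (g (k₁ (k₂ i))).measurable_toFun).aestronglyMeasurable (μ := volume)
    have e1 : (d i).toFun = (fun s => (g' (k₁ (k₂ i))).toFun s - F' s) +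
        ((fun s => F' s - F s) + fun s => F s - (g (k₁ (k₂ i))).toFun s) := by
      funext s
      simp only [d, StepFun.sub_toFun, Pi.add_apply]
      ring
    rw [e1]
    refine (eLpNorm_add_le m1 (m2.add m3) one_le_two).trans (add_le_add le_rfl ?_)
    refine (eLpNorm_add_le m2 m3 one_le_two).trans_eq ?_
    congr 1
    exact eLpNorm_sub_comm _ _ _ _
  have hlim : Tendsto (fun i => ENNReal.ofReal (2 * C) *
      (eLpNorm (fun s => (g' (k₁ (k₂ i))).toFun s - F' s) 2 volume +
        (A + eLpNorm (fun s => (g (k₁ (k₂ i))).toFun s - F s) 2 volume)) ^ 2) atTop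
      (𝓝 (ENNReal.ofReal (2 * C) * A ^ 2)) := by
    have h1 := (hg'.comp hk).add ((tendsto_const_nhds (x := A)).add (hg.comp hk))
    rw [zero_add, add_zero] at h1
    exact ENNReal.Tendsto.const_mul (ENNReal.Tendsto.pow h1) (Or.inr ENNReal.ofReal_ne_top)
  refine le_of_forall_gt fun c hc => ?_
  obtain ⟨c', hc1, hc2⟩ := exists_between hc
  refine lt_of_le_of_lt ?_ hc2
  have hsq : ∀ x : ℝ≥0∞, x ≤ c' ^ (2 : ℝ)⁻¹ ↔ x ^ 2 ≤ c' := fun x => by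
    rw [ENNReal.le_rpow_inv_iff two_pos, ENNReal.rpow_two]
  rw [← hsq]
  refine Lp.eLpNorm_le_of_ae_tendsto ?_
    (fun i => ((d i).measurable_integral hL.measurable).aestronglyMeasurable) hd
  filter_upwards [hlim.eventually (gt_mem_nhds hc1)] with i hi
  rw [hsq]
  refine ((d i).eLpNorm_integral_le hL h hC0 hC).trans (le_trans ?_ hi.le)
  gcongr
  exact hA i

theorem IsFLpMG.exists_lintegral_sub_sq_le [IsProbabilityMeasure P] (hY : IsFLpMG P H L Y)
    (hH : 1 / 2 < H) (N : ℕ) {q : ℝ} (hq1 : 1 < q) (hq : q < 2 * H) :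
    ∃ C : ℝ, ∀ s t : ℝ≥0, s ≤ t → t ≤ N →
      ∫⁻ ω, ‖Y t ω - Y s ω‖ₑ ^ 2 ∂P ≤ ENNReal.ofReal (C * ((t : ℝ) - s) ^ q) := by
  obtain ⟨γ, ν, htrip⟩ := hY.noGaussian
  obtain ⟨C, hC0, hC⟩ := htrip.exists_norm_levyExponent_le_mul_sq hY.sq_integrable hY.mean_zero
  have hH0 := hY.hurst_pos
  have hH1 := hY.hurst_lt_one
  have hcH := molchanGolosovConst_pos hH0 hH1
  set κ := molchanGolosovConst H * (H - 1 / 2)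
  -- With `β = H - 1/2` the kernel estimate has exponent `2β - ε + 1 = q`, and `0 < ε < 2β` is the
  -- same as `1 < q < 2H`.
  set ε := 2 * H - q with hε
  set D := 4 * (1 / (1 - 2 * (H - 1 / 2)) + 1 / ε) * (N : ℝ) ^ ε / (2 * (H - 1 / 2) - ε) with hD
  refine ⟨2 * C * (κ ^ 2 * D), fun s t hst htN => ?_⟩
  have hst' : (s : ℝ) ≤ t := by exact_mod_cast hst
  have htN' : (t : ℝ) ≤ N := by exact_mod_cast htN
  have hκ : 0 ≤ κ := mul_nonneg hcH.le (by linarith)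
  have hmk := fun r : ℝ≥0 => measurable_molchanGolosovKernel hH0 hH.ne' r
  have h1 := (hY.eq_integral s).eLpNorm_sub_le hY.levy htrip hC0 hC (hmk s) (hmk t)
    (hY.eq_integral t)
  rw [lintegral_enorm_sq_eq_eLpNorm_sq]
  refine h1.trans ?_
  rw [mul_assoc, ENNReal.ofReal_mul (p := 2 * C) (by positivity)]
  gcongr
  rw [← lintegral_enorm_sq_eq_eLpNorm_sq]
  have h2 := lintegral_volterra_sq_le (β := H - 1 / 2) (ε := ε) (by linarith) (by linarith)
    (by linarith) (by linarith) s.coe_nonneg hst' htN'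
  have h3 : 2 * (H - 1 / 2) - ε + 1 = q := by rw [hε]; ring
  rw [h3] at h2
  calc ∫⁻ x, ‖(Ioc 0 (t : ℝ)).indicator (molchanGolosovKernel H t) x -
        (Ioc 0 (s : ℝ)).indicator (molchanGolosovKernel H s) x‖ₑ ^ 2
      ≤ ∫⁻ x, ENNReal.ofReal (κ ^ 2) *
          (∫⁻ u in Ioc (s : ℝ) t, volterraKernel (H - 1 / 2) u x) ^ 2 := by
        refine lintegral_mono fun x => ?_
        rw [ENNReal.ofReal_pow hκ, ← mul_pow]
        gcongr
        exact enorm_molchanGolosovKernel_sub_le hH hH1 hst' x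
    _ ≤ ENNReal.ofReal (κ ^ 2) * ENNReal.ofReal (D * ((t : ℝ) - s) ^ q) := by
        rw [lintegral_const_mul' _ _ ENNReal.ofReal_ne_top]
        gcongr
    _ = ENNReal.ofReal (κ ^ 2 * D * ((t : ℝ) - s) ^ q) := by
        rw [← ENNReal.ofReal_mul (by positivity), mul_assoc]

theorem IsFLpMG.exists_holder_modification [IsProbabilityMeasure P] (hY : IsFLpMG P H L Y)
    (hH : 1 / 2 < H) :
    ∃ Y' : ℝ≥0 → Ω → ℝ, (∀ t, Measurable (Y' t)) ∧ (∀ t, ∀ᵐ ω ∂P, Y' t ω = Y t ω) ∧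
      ∀ᵐ ω ∂P, ∀ (T β : ℝ≥0), (β : ℝ) < H - 1 / 2 →
        ∃ C : ℝ≥0, HolderOnWith C β (fun t => Y' t ω) (Icc 0 T) := by
  have h := exists_modification_holderOnWith hY.measurable (show 1 < 2 * H by linarith)
    fun N q hq1 hq => hY.exists_lintegral_sub_sq_le hH N hq1 hq
  rwa [show (2 * H - 1) / 2 = H - 1 / 2 by ring] at h

end Holder

end

theorem mainTheorem7 {Ω : Type*} [MeasurableSpace Ω] (P : Measure Ω) [IsProbabilityMeasure P]
    (H : ℝ) (L Y : ℝ≥0 → Ω → ℝ) (hY : IsFLpMG P H L Y) :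
    (1 / 2 < H →
      ∃ Y' : ℝ≥0 → Ω → ℝ, (∀ t, Measurable (Y' t)) ∧ (∀ t, ∀ᵐ ω ∂P, Y' t ω = Y t ω) ∧
        ∀ᵐ ω ∂P, ∀ (T β : ℝ≥0), (β : ℝ) < H - 1 / 2 →
          ∃ C : ℝ≥0, HolderOnWith C β (fun t => Y' t ω) (Icc 0 T)) ∧
    (H < 1 / 2 → ¬ (∀ᵐ ω ∂P, L 1 ω = 0) → ∀ T : ℝ≥0, 0 < T →
      ∃ A : Set Ω, MeasurableSet A ∧ 0 < P A ∧
        ∀ ω ∈ A, ¬ ContinuousOn (fun t => Y t ω) (Icc 0 T)) ∧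
    (H < 1 / 2 → ¬ (∀ᵐ ω ∂P, L 1 ω = 0) → ∀ T : ℝ≥0, 0 < T →
      ∃ A : Set Ω, MeasurableSet A ∧ 0 < P A ∧
        ∀ ω ∈ A, ¬ Bornology.IsBounded ((fun t => Y t ω) '' Icc 0 T)) := by
  refine ⟨fun hH => ?_, fun hH hne T hT => ?_, fun hH hne T hT => ?_⟩
  · exact hY.exists_holder_modification hH
  · exact hY.exists_discontinuous hH hne hT
  · exact hY.exists_unbounded hH hne hT
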